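/- Let $H$ be a connected simple Lie group whose Killing form $B_{\mathfrak h}$ is negative definite (i.e. $H$ is compact), and let $K\subset H$ be a connected semisimple Lie subgroup, with Lie algebras $\mathfrak k\subset\mathfrak h$. Let $\mathfrak h=\mathfrak a\oplus\mathfrak k$ be the $B_{\mathfrak h}$-orthogonal decomposition and let $\mathfrak k=\mathfrak k_1\oplus\dots\oplus\mathfrak k_r$ be the decomposition of $\mathfrak k$ into simple ideals. Assume that $\mathfrak a\neq 0$ is $\mathrm{Ad}(K)$-irreducible (i.e. $H/K$ is isotropy irreducible) and that there is a constant $c$ with $B_{\mathfrak k_i}=c\,B_{\mathfrak h}|_{\mathfrak k_i}$ for all $i=1,\dots,r$. Put $d=\dim\mathfrak a$, $k=\dim\mathfrak k$, $$t_E=\frac{dc}{(d+2k)(1-c)},\qquad g_t=-B_{\mathfrak h}|_{\mathfrak a}+t\,(-B_{\mathfrak h})|_{\mathfrak k}.$$ Let $G=H\times K$ act on $M=H$ by $(h,x)\cdot y=hyx^{-1}$, and let $H$ act on itself by left translations. For either group $L\in\{G,H\}$ and an $L$-invariant Einstein metric $g$ on $M$, let $\mathcal{TT}^L_g$ be the space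 of $L$-invariant symmetric $2$-tensors $T$ with $\operatorname{tr}_gT=0$ and $\delta_gT=0$, where $\delta_g$ is the divergence. For $T\in\mathcal{TT}_g^L$ let $\mathrm{sc}''_g(T,T)$ be the Hessian at $g$ of the scalar curvature restricted to the $L$-invariant metrics of the same volume as $g$, i.e. the second derivative at $0$ of $\mathrm{sc}$ along a smooth curve of such metrics through $g$ with velocity $T$ (any such curve gives the same value, because $g$ is a critical point). The metric $g$ is $L$-unstable if $\mathrm{sc}''_g(T,T)>0$ for some $T\in\mathcal{TT}_g^L$, and its coindex is the maximal dimension of a subspace of $\mathcal{TT}_g^L$ on which $\mathrm{sc}''_g$ is positive definite. Then $t_E>0$, and the left-invariant metric $g_{t_E}$ on $H$ is a $G$-invariant Einstein metric which is $G$-unstable with coindex $r$. It is a local minimum of the scalar curvature on the space of $G$-invariant metrics on $H$ of the same volume, and it is also $H$-unstable, i.e. unstable as a left-invariant metric on $H$. -/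

import Mathlib

open scoped Manifold ContDiff

noncomputable section

/-!
Left-invariant tensor fields on a Lie group are identified with their values at the identity, so a
left-invariant symmetric `2`-tensor is a symmetric bilinear form on the Lie algebra.  The
Levi-Civita connection, the curvature and the divergence of a left-invariant metric are computed in
the frame of left-invariant vector fields.
-/
namespace LeftInvariant

variable {𝔤 : Type*} [LieRing 𝔤] [LieAlgebra ℝ 𝔤]

/-- A left-invariant Riemannian metric: an inner product on the Lie algebra. -/
structure IsMetric (g : LinearMap.BilinForm ℝ 𝔤) : Prop where
  symm : ∀ x y, g x y = g y x
  pos : ∀ x, x ≠ 0 → 0 < g x x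

theorem IsMetric.nondegenerate {g : LinearMap.BilinForm ℝ 𝔤} (hg : IsMetric g) :
    g.Nondegenerate := by
  constructor
  · intro x hx
    by_contra h
    exact (hg.pos x h).ne' (hx x)
  · intro x hx
    by_contra h
    exact (hg.pos x h).ne' (hx x)

/-- The trilinear form on the right-hand side of Koszul's formula for left-invariant fields,
`(X, Y, Z) ↦ g([X,Y],Z) - g([Y,Z],X) + g([Z,X],Y)`. -/
def koszulForm (g : LinearMap.BilinForm ℝ 𝔤) : 𝔤 →ₗ[ℝ] 𝔤 →ₗ[ℝ] Module.Dual ℝ 𝔤 :=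
  LinearMap.mk₂ ℝ
    (fun X Y =>
      { toFun := fun Z => g ⁅X, Y⁆ Z - g ⁅Y, Z⁆ X + g ⁅Z, X⁆ Y
        map_add' := by intro Z W; simp; ring
        map_smul' := by intro r Z; simp; ring })
    (by intro X X' Y; ext Z; simp; ring)
    (by intro r X Y; ext Z; simp; ring)
    (by intro X Y Y'; ext Z; simp; ring)
    (by intro r X Y; ext Z; simp; ring)

variable [FiniteDimensional ℝ 𝔤]

/-- The endomorphism `A` with `g (A x) y = T x y` (for nondegenerate `g`). -/
def sharp (g T : LinearMap.BilinForm ℝ 𝔤) : 𝔤 →ₗ[ℝ] 𝔤 :=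
  open Classical in
  if h : g.Nondegenerate then T.symmCompOfNondegenerate g h else 0

/-- The trace `tr_g T` of a `2`-tensor with respect to `g`. -/
def metricTrace (g T : LinearMap.BilinForm ℝ 𝔤) : ℝ :=
  LinearMap.trace ℝ 𝔤 (sharp g T)

/-- The determinant `det_g T` of a `2`-tensor with respect to `g`; for a metric `T` it is the
square of the ratio of the volume elements of `T` and `g`. -/
def metricDet (g T : LinearMap.BilinForm ℝ 𝔤) : ℝ :=
  LinearMap.det (sharp g T)

/-- The Levi-Civita connection of `g` on left-invariant vector fields, `(X, Y) ↦ ∇_X Y`. -/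
def leviCivita (g : LinearMap.BilinForm ℝ 𝔤) : 𝔤 →ₗ[ℝ] 𝔤 →ₗ[ℝ] 𝔤 :=
  open Classical in
  if h : g.Nondegenerate then
    (1 / 2 : ℝ) • (koszulForm g).compr₂ (g.toDual h).symm.toLinearMap
  else 0

theorem sharp_spec {g : LinearMap.BilinForm ℝ 𝔤} (hg : IsMetric g)
    (T : LinearMap.BilinForm ℝ 𝔤) (x y : 𝔤) : g (sharp g T x) y = T x y := by
  rw [sharp, dif_pos hg.nondegenerate, LinearMap.BilinForm.symmCompOfNondegenerate_left_apply]

theorem koszul {g : LinearMap.BilinForm ℝ 𝔤} (hg : IsMetric g) (X Y Z : 𝔤) :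
    2 * g (leviCivita g X Y) Z = g ⁅X, Y⁆ Z - g ⁅Y, Z⁆ X + g ⁅Z, X⁆ Y := by
  have h : ∀ f : Module.Dual ℝ 𝔤, g ((g.toDual hg.nondegenerate).symm f) Z = f Z := by
    intro f
    simp
  simp [leviCivita, dif_pos hg.nondegenerate, h, koszulForm]

theorem leviCivita_torsionFree {g : LinearMap.BilinForm ℝ 𝔤} (hg : IsMetric g) (X Y : 𝔤) :
    leviCivita g X Y - leviCivita g Y X = ⁅X, Y⁆ := by
  rw [← sub_eq_zero]
  apply hg.nondegenerate.1
  intro Z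
  have h1 := koszul hg X Y Z
  have h2 := koszul hg Y X Z
  simp only [← lie_skew Y X, ← lie_skew Z X, ← lie_skew Z Y, map_neg, LinearMap.neg_apply,
    map_sub, LinearMap.sub_apply] at h1 h2 ⊢
  linarith

theorem leviCivita_metric {g : LinearMap.BilinForm ℝ 𝔤} (hg : IsMetric g) (X Y Z : 𝔤) :
    g (leviCivita g X Y) Z + g Y (leviCivita g X Z) = 0 := by
  have h1 := koszul hg X Y Z
  have h2 := koszul hg X Z Y
  rw [hg.symm Y]
  simp only [← lie_skew Y X, ← lie_skew Z X, ← lie_skew Z Y, map_neg,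
    LinearMap.neg_apply] at h1 h2
  linarith

/-- The curvature `R(X,Y)Z = ∇_X ∇_Y Z - ∇_Y ∇_X Z - ∇_[X,Y] Z`, as the linear map
`X ↦ R(X,Y)Z`. -/
def curvature (g : LinearMap.BilinForm ℝ 𝔤) (Y Z : 𝔤) : 𝔤 →ₗ[ℝ] 𝔤 where
  toFun X := leviCivita g X (leviCivita g Y Z) - leviCivita g Y (leviCivita g X Z)
    - leviCivita g ⁅X, Y⁆ Z
  map_add' := by intro X X'; simp; abel
  map_smul' := by intro r X; simp [smul_sub]

/-- The Ricci tensor, `Ric(Y,Z) = tr (X ↦ R(X,Y)Z)`. -/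
def ricci (g : LinearMap.BilinForm ℝ 𝔤) : LinearMap.BilinForm ℝ 𝔤 :=
  LinearMap.mk₂ ℝ (fun Y Z => LinearMap.trace ℝ 𝔤 (curvature g Y Z))
    (by
      intro Y Y' Z
      rw [← map_add]
      congr 1
      ext X
      simp [curvature]
      abel)
    (by
      intro r Y Z
      rw [← map_smul]
      congr 1
      ext X
      simp [curvature, smul_sub])
    (by
      intro Y Z Z'
      rw [← map_add]
      congr 1
      ext X
      simp [curvature]
      abel)
    (by
      intro r Y Z
      rw [← map_smul]
      congr 1
      ext X
      simp [curvature, smul_sub])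

/-- The scalar curvature `tr_g Ric(g)`. -/
def scalarCurvature (g : LinearMap.BilinForm ℝ 𝔤) : ℝ :=
  metricTrace g (ricci g)

/-- `g` is an Einstein metric: `Ric(g) = ρ g` for some real `ρ`. -/
def IsEinstein (g : LinearMap.BilinForm ℝ 𝔤) : Prop :=
  IsMetric g ∧ ∃ ρ : ℝ, ricci g = ρ • g

/-- For a left-invariant `2`-tensor `T`, the `2`-tensor
`(U, V) ↦ (∇_U T)(V, X) = - T(∇_U V, X) - T(V, ∇_U X)`. -/
def covariantDerivative (g T : LinearMap.BilinForm ℝ 𝔤) (X : 𝔤) : LinearMap.BilinForm ℝ 𝔤 :=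
  LinearMap.mk₂ ℝ (fun U V => - T (leviCivita g U V) X - T V (leviCivita g U X))
    (by intro U U' V; simp; ring)
    (by intro r U V; simp; ring)
    (by intro U V V'; simp; ring)
    (by intro r U V; simp; ring)

/-- The divergence `(δ_g T)(X) = - ∑ (∇_{X_i} T)(X_i, X)`, the sum running over a `g`-orthonormal
frame `X_i`. -/
def divergence (g T : LinearMap.BilinForm ℝ 𝔤) (X : 𝔤) : ℝ :=
  - metricTrace g (covariantDerivative g T X)

/-- The symmetric bilinear forms invariant under a set `S` of endomorphisms.  If a Lie group `G`
containing the left translations acts on the group manifold and `S` is the isotropy representation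
at the identity, these are the `G`-invariant symmetric `2`-tensors. -/
def invariantForms (S : Set (𝔤 →ₗ[ℝ] 𝔤)) : Submodule ℝ (LinearMap.BilinForm ℝ 𝔤) where
  carrier := {T | (∀ x y, T x y = T y x) ∧ ∀ φ ∈ S, ∀ x y, T (φ x) (φ y) = T x y}
  add_mem' := by
    rintro T T' ⟨h1, h2⟩ ⟨h1', h2'⟩
    refine ⟨fun x y => ?_, fun φ hφ x y => ?_⟩
    · simp [h1 x y, h1' x y]
    · simp [h2 φ hφ x y, h2' φ hφ x y]
  zero_mem' := by simp
  smul_mem' := by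
    rintro r T ⟨h1, h2⟩
    refine ⟨fun x y => ?_, fun φ hφ x y => ?_⟩
    · simp [h1 x y]
    · simp [h2 φ hφ x y]

/-- `G`-invariant Riemannian metrics. -/
def IsInvariantMetric (S : Set (𝔤 →ₗ[ℝ] 𝔤)) (g : LinearMap.BilinForm ℝ 𝔤) : Prop :=
  IsMetric g ∧ g ∈ invariantForms S

/-- `T` is a `G`-invariant `TT`-tensor: invariant, trace-free and divergence-free. -/
def IsTTTensor (S : Set (𝔤 →ₗ[ℝ] 𝔤)) (g T : LinearMap.BilinForm ℝ 𝔤) : Prop :=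
  T ∈ invariantForms S ∧ metricTrace g T = 0 ∧ ∀ X, divergence g T X = 0

/-- The curve `s ↦ det_g(g + sT)^(-1/n) (g + sT)`, `n = dim 𝔤`, of metrics with the same volume
as `g`.  If `tr_g T = 0`, then its velocity at `s = 0` is `T`. -/
def fixedVolumeCurve (g T : LinearMap.BilinForm ℝ 𝔤) (s : ℝ) : LinearMap.BilinForm ℝ 𝔤 :=
  (metricDet g (g + s • T) ^ (-(1 : ℝ) / Module.finrank ℝ 𝔤)) • (g + s • T)

/-- The Hessian `sc''_g(T,T)`, for `tr_g T = 0`, at an Einstein metric `g` of the scalar curvature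
restricted to the metrics of the same volume as `g`: the second derivative along a curve of such
metrics with velocity `T`.  Einstein metrics are critical points of this restriction, so the choice
of the curve does not matter. -/
def scalarHessian (g T : LinearMap.BilinForm ℝ 𝔤) : ℝ :=
  iteratedDeriv 2 (fun s : ℝ => scalarCurvature (fixedVolumeCurve g T s)) 0

/-- `g` is a `G`-unstable Einstein metric: `sc''_g(T,T) > 0` for some `G`-invariant
`TT`-tensor `T`. -/
def IsUnstable (S : Set (𝔤 →ₗ[ℝ] 𝔤)) (g : LinearMap.BilinForm ℝ 𝔤) : Prop :=
  IsInvariantMetric S g ∧ IsEinstein g ∧ ∃ T, IsTTTensor S g T ∧ 0 < scalarHessian g T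

/-- The coindex of `g` is `m`: the largest dimension of a space of `G`-invariant `TT`-tensors on
which `sc''_g` is positive definite is `m`. -/
def HasCoindex (S : Set (𝔤 →ₗ[ℝ] 𝔤)) (g : LinearMap.BilinForm ℝ 𝔤) (m : ℕ) : Prop :=
  IsGreatest {k : ℕ | ∃ V : Submodule ℝ (LinearMap.BilinForm ℝ 𝔤), Module.finrank ℝ V = k ∧
    ∀ T ∈ V, IsTTTensor S g T ∧ (T ≠ 0 → 0 < scalarHessian g T)} m

/-- `g` is a local minimum of the scalar curvature on the space of `G`-invariant metrics of the
same volume as `g`; the sets of metrics `g'` with `|g'(x,x) - g(x,x)| ≤ ε g(x,x)` for all `x`, where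
`ε > 0`, form a basis of neighbourhoods of `g`. -/
def IsLocalMinScalar (S : Set (𝔤 →ₗ[ℝ] 𝔤)) (g : LinearMap.BilinForm ℝ 𝔤) : Prop :=
  ∃ ε : ℝ, 0 < ε ∧ ∀ g', IsInvariantMetric S g' → metricDet g g' = 1 →
    (∀ x, |g' x x - g x x| ≤ ε * g x x) → scalarCurvature g ≤ scalarCurvature g'

theorem isCompl_killingOrthogonal
    (hneg : ∀ X : 𝔤, X ≠ 0 → killingForm ℝ 𝔤 X X < 0) (𝔨 : Submodule ℝ 𝔤) :
    IsCompl 𝔨 (LinearMap.BilinForm.orthogonal (killingForm ℝ 𝔤) 𝔨) := by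
  apply LinearMap.BilinForm.isCompl_orthogonal_of_restrict_nondegenerate
    (LieModule.traceForm_isSymm ℝ 𝔤 𝔤).isRefl
  constructor
  · intro x hx
    by_contra h
    exact (hneg x (by simpa using h)).ne (hx x)
  · intro x hx
    by_contra h
    exact (hneg x (by simpa using h)).ne (hx x)

/-- The bilinear form `g_t = -B|_𝔞 + t (-B)|_𝔨`, where `B` is the Killing form and `𝔞` is the
`B`-orthogonal complement of `𝔨`. -/
def jensenForm (hneg : ∀ X : 𝔤, X ≠ 0 → killingForm ℝ 𝔤 X X < 0) (𝔨 : Submodule ℝ 𝔤) (t : ℝ) :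
    LinearMap.BilinForm ℝ 𝔤 :=
  let P : 𝔤 →ₗ[ℝ] 𝔤 := Submodule.projection _ _ (isCompl_killingOrthogonal hneg 𝔨)
  let Q : 𝔤 →ₗ[ℝ] 𝔤 := Submodule.projection _ _ (isCompl_killingOrthogonal hneg 𝔨).symm
  (-1 : ℝ) • (killingForm ℝ 𝔤).compl₁₂ Q Q + t • (-1 : ℝ) • (killingForm ℝ 𝔤).compl₁₂ P P

end LeftInvariant

/-- Lets smooth real Lie groups use the Lie algebra structure of `GroupLieAlgebra`. -/
instance instLEInftyMinSmoothnessThree : ENat.LEInfty (minSmoothness ℝ 3) where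
  out := by
    rw [minSmoothness_of_isRCLikeNormedField]
    exact ENat.LEInfty.out

section LieGroup

variable {E : Type*} [NormedAddCommGroup E] [NormedSpace ℝ E]
  {H : Type*} [TopologicalSpace H] [ChartedSpace E H] [Group H]

instance instFiniteDimensionalGroupLieAlgebra [FiniteDimensional ℝ E] :
    FiniteDimensional ℝ (GroupLieAlgebra 𝓘(ℝ, E) H) :=
  inferInstanceAs (FiniteDimensional ℝ E)

variable (E) in
/-- The adjoint representation: `Ad h` is the derivative at `1` of `x ↦ h x h⁻¹`. -/
def groupAd (h : H) : GroupLieAlgebra 𝓘(ℝ, E) H →ₗ[ℝ] GroupLieAlgebra 𝓘(ℝ, E) H :=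
  (mfderiv 𝓘(ℝ, E) 𝓘(ℝ, E) (fun x : H => h * x * h⁻¹) 1 :
    TangentSpace 𝓘(ℝ, E) (1 : H) →L[ℝ] TangentSpace 𝓘(ℝ, E) (h * 1 * h⁻¹)).toLinearMap

variable {F : Type*} [NormedAddCommGroup F] [NormedSpace ℝ F]
  {K : Type*} [TopologicalSpace K] [ChartedSpace F K] [Group K]

variable (E F) in
/-- The derivative at the identity of a homomorphism `ι : K → H` of Lie groups. -/
def derivAtOne (ι : K →* H) : GroupLieAlgebra 𝓘(ℝ, F) K →ₗ[ℝ] GroupLieAlgebra 𝓘(ℝ, E) H :=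
  (mfderiv 𝓘(ℝ, F) 𝓘(ℝ, E) ι 1 :
    TangentSpace 𝓘(ℝ, F) (1 : K) →L[ℝ] TangentSpace 𝓘(ℝ, E) (ι 1)).toLinearMap

variable (E) in
/-- The isotropy representation at `1` of `G = H × K` acting on `H` by `(h, k) · x = h x ι(k)⁻¹`:
the isotropy group is `{(ι(k), k)}`, acting on the Lie algebra by `Ad(ι(k))`. -/
def isotropyRep (ι : K →* H) :
    Set (GroupLieAlgebra 𝓘(ℝ, E) H →ₗ[ℝ] GroupLieAlgebra 𝓘(ℝ, E) H) :=
  Set.range fun k : K => groupAd E (ι k)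

end LieGroup

end

/-! Write 𝔥 = 𝔞 ⊕ 𝔨, B for the Killing form of 𝔥, and C for the Casimir constant of 𝔨 on 𝔞. A
`G`-invariant symmetric form is an Ad(K)-invariant one. Schur's lemma makes it a multiple of B on 𝔞
and on each simple ideal of 𝔨, and distinct ideals are orthogonal. A mixed term would be an
intertwiner 𝔞 → 𝔨. If nonzero, it is a bijective similarity, the structure constants are those of a
symmetric pair 𝔨 ⊕ 𝔨 ⊃ 𝔨, and 𝔥 is not simple (`apply_eq_zero`, `IsIsotropyFrame.not_isSimple`). So
the invariant forms have dimension r + 1. The trace-free ones are automatically divergence-free and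
have dimension r.

In a frame adapted to 𝔞 ⊕ 𝔨 an invariant metric is diagonal, with entry x₀ on 𝔞 and entries x_z on
𝔨, and sc = (d + 2k(1-c))/(4x₀) + (c/4) ∑ 1/x_z - ((1-c)/(4x₀²)) ∑ x_z
(`IsIsotropyFrame.scalarCurvature_eq`). The Einstein equation for g_t is (t - 1)((d + 2k)(1 - c)t -
dc) = 0, with t_E as a root. At t_E the Hessian on trace-free forms is bounded below by a positive
definite form times E = (d + 2k)(1 - c)(1 - t)/4 (`secondVariation_ge`). Hence everything follows
once t_E < 1: the Hessian is positive on the whole r-dimensional space, and a Taylor estimate in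
logarithmic coordinates gives the local minimum (`exists_localMin_exp`). `G`-invariant TT-tensors
are left-invariant, which gives `H`-instability.

Computing the trace of the Casimir in two ways gives dC = k(1 - c), so t_E < 1 means c - 2C < u with
u = 1 - c. This is `IsOrthogonalRep.casimir_lt`. Let ρ_i be the action on 𝔞 of an orthonormal basis
of 𝔨, and Φ(A) = ∑ ρ_i A ρ_i on so(𝔞). Then Φ + C is half the Casimir operator of so(𝔞), so it is
nonnegative. Hence Φ²(Φ + C) has nonnegative trace on the orthogonal complement of 𝔨 in so(𝔞).
Evaluating this trace with e = c/2 - C gives u²c/8 - ue² - ce²/2 - eu²/2 ≥ 0, which is impossible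
for e ≥ u/2.

The passage from groups to Lie algebras needs three facts: a homomorphism differentiates to a Lie
algebra homomorphism, Ad differentiates to ad, and a connected K preserves each simple ideal of 𝔨.
-/

set_option linter.unusedSectionVars false

noncomputable section

open scoped Topology

/-! ### Lie brackets and homomorphisms read in a chart at the identity. -/

section ChartMul

variable {E : Type*} [NormedAddCommGroup E] [NormedSpace ℝ E]
  {H : Type*} [TopologicalSpace H] [ChartedSpace E H] [Group H]

variable (E H) in
/-- The coordinate of the identity in the preferred chart around it. -/
def chartOne : E := extChartAt 𝓘(ℝ, E) (1 : H) 1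

variable (H) in
/-- The multiplication of a Lie group read in the preferred chart around the identity. -/
def chartMul (a b : E) : E :=
  extChartAt 𝓘(ℝ, E) (1 : H)
    ((extChartAt 𝓘(ℝ, E) (1 : H)).symm a * (extChartAt 𝓘(ℝ, E) (1 : H)).symm b)

theorem extChartAt_symm_chartOne :
    (extChartAt 𝓘(ℝ, E) (1 : H)).symm (chartOne E H) = 1 := by
  simp [chartOne]

theorem chartMul_chartOne_right {a : E} (ha : a ∈ (extChartAt 𝓘(ℝ, E) (1 : H)).target) :
    chartMul H a (chartOne E H) = a := by
  rw [chartMul, extChartAt_symm_chartOne, mul_one, PartialEquiv.right_inv _ ha]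

theorem chartMul_chartOne_left {a : E} (ha : a ∈ (extChartAt 𝓘(ℝ, E) (1 : H)).target) :
    chartMul H (chartOne E H) a = a := by
  rw [chartMul, extChartAt_symm_chartOne, one_mul, PartialEquiv.right_inv _ ha]

theorem target_mem_nhds_chartOne :
    (extChartAt 𝓘(ℝ, E) (1 : H)).target ∈ 𝓝 (chartOne E H) :=
  extChartAt_target_mem_nhds 1

variable [LieGroup 𝓘(ℝ, E) ∞ H]

theorem contMDiffAt_extChartAt_symm_chartOne :
    ContMDiffAt 𝓘(ℝ, E) 𝓘(ℝ, E) ∞ (extChartAt 𝓘(ℝ, E) (1 : H)).symm (chartOne E H) :=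
  (contMDiffOn_extChartAt_symm (1 : H)).contMDiffAt target_mem_nhds_chartOne

/-- The chart describes the product only near the identity. Identities derived from it therefore
hold only eventually. -/
theorem contDiffAt_chartMul :
    ContDiffAt ℝ ∞ (fun p : E × E => chartMul H p.1 p.2) (chartOne E H, chartOne E H) := by
  rw [← contMDiffAt_iff_contDiffAt]
  have h1 : ContMDiffAt 𝓘(ℝ, E × E) 𝓘(ℝ, E) ∞
      (fun p : E × E => (extChartAt 𝓘(ℝ, E) (1 : H)).symm p.1)
      (chartOne E H, chartOne E H) :=
    contMDiffAt_extChartAt_symm_chartOne.comp (chartOne E H, chartOne E H)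
      contDiffAt_fst.contMDiffAt
  have h2 : ContMDiffAt 𝓘(ℝ, E × E) 𝓘(ℝ, E) ∞
      (fun p : E × E => (extChartAt 𝓘(ℝ, E) (1 : H)).symm p.2)
      (chartOne E H, chartOne E H) :=
    contMDiffAt_extChartAt_symm_chartOne.comp (chartOne E H, chartOne E H)
      contDiffAt_snd.contMDiffAt
  have h3 := h1.mul h2
  refine ContMDiffAt.comp (chartOne E H, chartOne E H)
    (g := extChartAt 𝓘(ℝ, E) (1 : H)) ?_ h3
  simp only [extChartAt_symm_chartOne, mul_one]
  exact contMDiffAt_extChartAt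

omit [LieGroup 𝓘(ℝ, E) ∞ H] [Group H] in
/-- The derivative at the identity, read in charts. -/
theorem mfderiv_one_eq_fderiv {F : Type*} [NormedAddCommGroup F] [NormedSpace ℝ F]
    {K : Type*} [TopologicalSpace K] [ChartedSpace F K] [Group K]
    {f : K → H} (hf : MDifferentiableAt 𝓘(ℝ, F) 𝓘(ℝ, E) f 1) {y : H} (hy : f 1 = y) :
    (mfderiv 𝓘(ℝ, F) 𝓘(ℝ, E) f 1 : F →L[ℝ] E) =
      fderiv ℝ (fun x => extChartAt 𝓘(ℝ, E) y (f ((extChartAt 𝓘(ℝ, F) (1 : K)).symm x)))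
        (chartOne F K) := by
  -- The separate name `y` lets the target chart be centred at `1` when `f 1 = 1` holds only
  -- propositionally.
  subst hy
  rw [hf.mfderiv]
  simp only [modelWithCornersSelf_coe, Set.range_id, fderivWithin_univ]
  rfl

omit [LieGroup 𝓘(ℝ, E) ∞ H] in
theorem mfderiv_one_eq_fderiv_of_vectorSpace
    {f : H → E} (hf : MDifferentiableAt 𝓘(ℝ, E) 𝓘(ℝ, E) f 1) :
    (mfderiv 𝓘(ℝ, E) 𝓘(ℝ, E) f 1 : E →L[ℝ] E) =
      fderiv ℝ (fun x => f ((extChartAt 𝓘(ℝ, E) (1 : H)).symm x)) (chartOne E H) := by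
  rw [hf.mfderiv]
  simp only [modelWithCornersSelf_coe, Set.range_id, fderivWithin_univ]
  rfl

variable (E H) in
/-- The left-invariant vector field with value `w` at the identity, read in the chart. -/
def chartField (w a : E) : E :=
  fderiv ℝ (chartMul H a) (chartOne E H) w

/-- The chain rule for the chart after left translation by x, with the differentials of the chart
and of its inverse mutually inverse. -/
theorem mpullbackWithin_mulInvariantVectorField
    (w : GroupLieAlgebra 𝓘(ℝ, E) H) {a : E}
    (ha : a ∈ (extChartAt 𝓘(ℝ, E) (1 : H)).target) :
    VectorField.mpullbackWithin 𝓘(ℝ, E) 𝓘(ℝ, E) (extChartAt 𝓘(ℝ, E) (1 : H)).symm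
      (mulInvariantVectorField w) (Set.range 𝓘(ℝ, E)) a = chartField E H w a := by
  rw [VectorField.mpullbackWithin_apply]
  set x := (extChartAt 𝓘(ℝ, E) (1 : H)).symm a with hx
  have hxs : x ∈ (extChartAt 𝓘(ℝ, E) (1 : H)).source := (extChartAt _ _).map_target ha
  have hax : extChartAt 𝓘(ℝ, E) (1 : H) x = a := (extChartAt _ _).right_inv ha
  have : IsManifold 𝓘(ℝ, E) 1 H := IsManifold.of_le (n := ∞) (by simp)
  have hinv : (mfderivWithin 𝓘(ℝ, E) 𝓘(ℝ, E) (extChartAt 𝓘(ℝ, E) (1 : H)).symm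
      (Set.range 𝓘(ℝ, E)) a).inverse = mfderiv 𝓘(ℝ, E) 𝓘(ℝ, E) (extChartAt 𝓘(ℝ, E) (1 : H)) x := by
    apply ContinuousLinearMap.inverse_eq
    · exact mfderivWithin_extChartAt_symm_comp_mfderiv_extChartAt ha
    · exact mfderiv_extChartAt_comp_mfderivWithin_extChartAt_symm ha
  have hL : MDifferentiableAt 𝓘(ℝ, E) 𝓘(ℝ, E) (fun y : H => x * y) 1 :=
    (contMDiff_mul_left (n := ∞)).mdifferentiableAt (by simp)
  have hφ : MDifferentiableAt 𝓘(ℝ, E) 𝓘(ℝ, E) (extChartAt 𝓘(ℝ, E) (1 : H)) (x * 1) := by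
    rw [mul_one]
    exact mdifferentiableAt_extChartAt (by simpa using hxs)
  have hcomp := mfderiv_comp_apply (1 : H) hφ hL w
  have hE := mfderiv_one_eq_fderiv_of_vectorSpace (hφ.comp (1 : H) hL)
  rw [hinv]
  have hx1 : x * 1 = x := mul_one x
  -- Left translation by x sends 1 to `x * 1`, whose tangent space is not literally the one at x.
  -- Replacing the point by a variable allows the transport.
  have key : ∀ y : H, y = x → (mfderiv 𝓘(ℝ, E) 𝓘(ℝ, E) (extChartAt 𝓘(ℝ, E) (1 : H)) x : E →L[ℝ] E)
      (mulInvariantVectorField w x : E) =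
      (mfderiv 𝓘(ℝ, E) 𝓘(ℝ, E) (extChartAt 𝓘(ℝ, E) (1 : H)) y : E →L[ℝ] E)
        (mfderiv 𝓘(ℝ, E) 𝓘(ℝ, E) (fun y : H => x * y) 1 w : E) := by
    rintro y rfl
    rfl
  exact ((key _ hx1).trans hcomp.symm).trans (congrArg (fun A : E →L[ℝ] E => A w) hE)

omit [LieGroup 𝓘(ℝ, E) ∞ H] in
theorem chartField_eq_prod {w a : E}
    (h : DifferentiableAt ℝ (fun p : E × E => chartMul H p.1 p.2) (a, chartOne E H)) :
    chartField E H w a =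
      fderiv ℝ (fun p : E × E => chartMul H p.1 p.2) (a, chartOne E H) (0, w) := by
  have h2 : HasFDerivAt (fun b : E => (a, b)) (ContinuousLinearMap.inr ℝ E E) (chartOne E H) :=
    hasFDerivAt_prodMk_right a (chartOne E H)
  have h3 := h.hasFDerivAt.comp (chartOne E H) h2
  have h4 : fderiv ℝ (chartMul H a) (chartOne E H) = _ := h3.fderiv
  rw [chartField, h4]
  simp

theorem contDiffAt_fderiv_chartMul :
    ContDiffAt ℝ ∞ (fderiv ℝ (fun p : E × E => chartMul H p.1 p.2))
      (chartOne E H, chartOne E H) :=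
  contDiffAt_chartMul.fderiv_right (by simp)

theorem eventually_differentiableAt_chartMul :
    ∀ᶠ p in 𝓝 (chartOne E H, chartOne E H),
      DifferentiableAt ℝ (fun p : E × E => chartMul H p.1 p.2) p := by
  have h : ContDiffAt ℝ 1 (fun p : E × E => chartMul H p.1 p.2) (chartOne E H, chartOne E H) :=
    contDiffAt_chartMul.of_le (by simp)
  filter_upwards [h.eventually (by simp)] with p hp using hp.differentiableAt (by simp)

theorem eventually_chartField_eq (w : E) :
    ∀ᶠ a in 𝓝 (chartOne E H), chartField E H w a =
      fderiv ℝ (fun p : E × E => chartMul H p.1 p.2) (a, chartOne E H) (0, w) := by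
  have hc : ContinuousAt (fun a : E => (a, chartOne E H)) (chartOne E H) := by fun_prop
  filter_upwards [hc.eventually eventually_differentiableAt_chartMul] with a ha
    using chartField_eq_prod ha

/-- Near the identity the field is a ↦ ∂₂m(a, 1)w, so its derivative is a mixed second derivative of
the product m. -/
theorem hasFDerivAt_chartField (w : E) :
    HasFDerivAt (chartField E H w)
      (((ContinuousLinearMap.apply ℝ E ((0, w) : E × E)).comp
        (fderiv ℝ (fderiv ℝ (fun p : E × E => chartMul H p.1 p.2))
          (chartOne E H, chartOne E H))).comp (ContinuousLinearMap.inl ℝ E E))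
      (chartOne E H) := by
  have h0 : DifferentiableAt ℝ (fderiv ℝ (fun p : E × E => chartMul H p.1 p.2))
      (chartOne E H, chartOne E H) :=
    (contDiffAt_fderiv_chartMul (E := E) (H := H)).differentiableAt (by simp)
  have h1 := h0.hasFDerivAt
  have h2 : HasFDerivAt (fun a : E => (a, chartOne E H)) (ContinuousLinearMap.inl ℝ E E)
      (chartOne E H) := hasFDerivAt_prodMk_left _ _
  have h3 := ((ContinuousLinearMap.apply ℝ E ((0, w) : E × E)).hasFDerivAt
    (x := fderiv ℝ (fun p : E × E => chartMul H p.1 p.2) (chartOne E H, chartOne E H))).comp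
    (chartOne E H) (HasFDerivAt.comp (f := fun a : E => (a, chartOne E H)) (chartOne E H) h1 h2)
  exact h3.congr_of_eventuallyEq (eventually_chartField_eq w)

omit [LieGroup 𝓘(ℝ, E) ∞ H] in
theorem chartField_chartOne (w : E) : chartField E H w (chartOne E H) = w := by
  have h : chartMul H (chartOne E H) =ᶠ[𝓝 (chartOne E H)] id := by
    filter_upwards [target_mem_nhds_chartOne (H := H)] with a ha using chartMul_chartOne_left ha
  rw [chartField, h.fderiv_eq, fderiv_id]
  rfl

variable [FiniteDimensional ℝ E]

/-- The differential of the chart at its centre is the identity, so the bracket of the chart fields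
needs no correction. -/
theorem lie_eq_lieBracket_chartField (v w : GroupLieAlgebra 𝓘(ℝ, E) H) :
    (⁅v, w⁆ : GroupLieAlgebra 𝓘(ℝ, E) H) =
      VectorField.lieBracket ℝ (chartField E H v) (chartField E H w) (chartOne E H) := by
  rw [GroupLieAlgebra.bracket_def, ← VectorField.mlieBracketWithin_univ,
    VectorField.mlieBracketWithin_apply]
  have : IsManifold 𝓘(ℝ, E) 1 H := IsManifold.of_le (n := ∞) (by simp)
  have hid : mfderiv 𝓘(ℝ, E) 𝓘(ℝ, E) (extChartAt 𝓘(ℝ, E) (1 : H)) 1 =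
      ContinuousLinearMap.id ℝ E := by
    have h := mfderiv_one_eq_fderiv_of_vectorSpace (f := extChartAt 𝓘(ℝ, E) (1 : H))
      (mdifferentiableAt_extChartAt (by simp))
    refine h.trans ?_
    have h' : (fun x => extChartAt 𝓘(ℝ, E) (1 : H) ((extChartAt 𝓘(ℝ, E) (1 : H)).symm x))
        =ᶠ[𝓝 (chartOne E H)] id := by
      filter_upwards [target_mem_nhds_chartOne (H := H)] with a ha
        using (extChartAt 𝓘(ℝ, E) (1 : H)).right_inv ha
    rw [h'.fderiv_eq, fderiv_id]
  rw [hid]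
  have hinv : (ContinuousLinearMap.id ℝ E).inverse = ContinuousLinearMap.id ℝ E :=
    ContinuousLinearMap.inverse_id
  refine (congrArg (fun A : E →L[ℝ] E => A _) hinv).trans ?_
  simp only [Set.preimage_univ, Set.univ_inter, modelWithCornersSelf_coe, Set.range_id]
  refine (congrFun VectorField.lieBracketWithin_univ (chartOne E H)).trans ?_
  refine Filter.EventuallyEq.lieBracket_vectorField_eq ?_ ?_
  · filter_upwards [target_mem_nhds_chartOne (H := H)] with a ha
    have h := mpullbackWithin_mulInvariantVectorField v ha
    rw [modelWithCornersSelf_coe, Set.range_id] at h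
    exact h
  · filter_upwards [target_mem_nhds_chartOne (H := H)] with a ha
    have h := mpullbackWithin_mulInvariantVectorField w ha
    rw [modelWithCornersSelf_coe, Set.range_id] at h
    exact h

omit [FiniteDimensional ℝ E] in
theorem lieBracket_chartField (v w : E) :
    VectorField.lieBracket ℝ (chartField E H v) (chartField E H w) (chartOne E H) =
      fderiv ℝ (fderiv ℝ (fun p : E × E => chartMul H p.1 p.2))
          (chartOne E H, chartOne E H) (v, 0) (0, w) -
        fderiv ℝ (fderiv ℝ (fun p : E × E => chartMul H p.1 p.2))
          (chartOne E H, chartOne E H) (w, 0) (0, v) := by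
  rw [VectorField.lieBracket_eq]
  simp only [chartField_chartOne, (hasFDerivAt_chartField _).fderiv]
  rfl

/-- The bracket is the antisymmetrised mixed second derivative of the product. The differential of
Ad is computed below in the same shape. -/
theorem lie_eq_secondDerivative (v w : GroupLieAlgebra 𝓘(ℝ, E) H) :
    (⁅v, w⁆ : GroupLieAlgebra 𝓘(ℝ, E) H) =
      fderiv ℝ (fderiv ℝ (fun p : E × E => chartMul H p.1 p.2))
          (chartOne E H, chartOne E H) ((v : E), (0 : E)) ((0 : E), (w : E)) -
        fderiv ℝ (fderiv ℝ (fun p : E × E => chartMul H p.1 p.2))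
          (chartOne E H, chartOne E H) ((w : E), (0 : E)) ((0 : E), (v : E)) :=
  (lie_eq_lieBracket_chartField v w).trans (lieBracket_chartField (E := E) (H := H) v w)

section Hom

variable {F : Type*} [NormedAddCommGroup F] [NormedSpace ℝ F] [FiniteDimensional ℝ F]
  {K : Type*} [TopologicalSpace K] [ChartedSpace F K] [Group K] [LieGroup 𝓘(ℝ, F) ∞ K]

/-- A homomorphism of Lie groups read in the preferred charts around the identities. -/
def chartHom (E F : Type*) [NormedAddCommGroup E] [NormedSpace ℝ E] {H : Type*}
    [TopologicalSpace H] [ChartedSpace E H] [Group H] [NormedAddCommGroup F] [NormedSpace ℝ F]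
    {K : Type*} [TopologicalSpace K] [ChartedSpace F K] [Group K] (f : K →* H) (x : F) : E :=
  extChartAt 𝓘(ℝ, E) (1 : H) (f ((extChartAt 𝓘(ℝ, F) (1 : K)).symm x))

omit [LieGroup 𝓘(ℝ, E) ∞ H] [FiniteDimensional ℝ E] [FiniteDimensional ℝ F]
  [LieGroup 𝓘(ℝ, F) ∞ K] in
theorem chartHom_chartOne (f : K →* H) : chartHom E F f (chartOne F K) = chartOne E H := by
  rw [chartHom, extChartAt_symm_chartOne, map_one, chartOne]

theorem contDiffAt_chartHom {f : K →* H} (hf : ContMDiff 𝓘(ℝ, F) 𝓘(ℝ, E) ∞ f) :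
    ContDiffAt ℝ ∞ (chartHom E F f) (chartOne F K) := by
  rw [← contMDiffAt_iff_contDiffAt]
  have h1 : ContMDiffAt 𝓘(ℝ, F) 𝓘(ℝ, E) ∞
      (fun x => f ((extChartAt 𝓘(ℝ, F) (1 : K)).symm x)) (chartOne F K) :=
    hf.contMDiffAt.comp (chartOne F K) contMDiffAt_extChartAt_symm_chartOne
  refine ContMDiffAt.comp (chartOne F K) (g := extChartAt 𝓘(ℝ, E) (1 : H)) ?_ h1
  rw [extChartAt_symm_chartOne, map_one]
  exact contMDiffAt_extChartAt

theorem derivAtOne_eq_fderiv {f : K →* H} (hf : ContMDiff 𝓘(ℝ, F) 𝓘(ℝ, E) ∞ f) (x : F) :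
    (derivAtOne E F f x : E) = fderiv ℝ (chartHom E F f) (chartOne F K) x :=
  congrArg (fun A : F →L[ℝ] E => A x)
    (mfderiv_one_eq_fderiv (hf.mdifferentiable (by simp) 1) (map_one f))

/-- A homomorphism intertwines the multiplications read in charts. -/
theorem eventually_chartHom_chartMul {f : K →* H} (hf : ContMDiff 𝓘(ℝ, F) 𝓘(ℝ, E) ∞ f) :
    ∀ᶠ p in 𝓝 (chartOne F K, chartOne F K),
      chartHom E F f (chartMul K p.1 p.2) =
        chartMul H (chartHom E F f p.1) (chartHom E F f p.2) := by
  have hsymm : ContinuousAt (extChartAt 𝓘(ℝ, F) (1 : K)).symm (chartOne F K) :=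
    contMDiffAt_extChartAt_symm_chartOne.continuousAt
  have hK : (extChartAt 𝓘(ℝ, F) (1 : K)).source ∈ 𝓝 (1 : K) := extChartAt_source_mem_nhds 1
  have hH : f ⁻¹' (extChartAt 𝓘(ℝ, E) (1 : H)).source ∈ 𝓝 (1 : K) := by
    apply hf.continuous.continuousAt.preimage_mem_nhds
    rw [map_one]
    exact extChartAt_source_mem_nhds 1
  have : ContinuousMul K := continuousMul_of_contMDiffMul 𝓘(ℝ, F) ∞
  have h1 : ContinuousAt (fun p : F × F => (extChartAt 𝓘(ℝ, F) (1 : K)).symm p.1)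
      (chartOne F K, chartOne F K) :=
    ContinuousAt.comp (g := (extChartAt 𝓘(ℝ, F) (1 : K)).symm) hsymm continuousAt_fst
  have h2 : ContinuousAt (fun p : F × F => (extChartAt 𝓘(ℝ, F) (1 : K)).symm p.2)
      (chartOne F K, chartOne F K) :=
    ContinuousAt.comp (g := (extChartAt 𝓘(ℝ, F) (1 : K)).symm) hsymm continuousAt_snd
  have h12 := h1.mul h2
  have t1 : Filter.Tendsto (fun p : F × F => (extChartAt 𝓘(ℝ, F) (1 : K)).symm p.1)
      (𝓝 (chartOne F K, chartOne F K)) (𝓝 1) := by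
    simpa only [ContinuousAt, extChartAt_symm_chartOne] using h1
  have t2 : Filter.Tendsto (fun p : F × F => (extChartAt 𝓘(ℝ, F) (1 : K)).symm p.2)
      (𝓝 (chartOne F K, chartOne F K)) (𝓝 1) := by
    simpa only [ContinuousAt, extChartAt_symm_chartOne] using h2
  have t12 : Filter.Tendsto (fun p : F × F => (extChartAt 𝓘(ℝ, F) (1 : K)).symm p.1 *
      (extChartAt 𝓘(ℝ, F) (1 : K)).symm p.2) (𝓝 (chartOne F K, chartOne F K)) (𝓝 1) := by
    simpa using t1.mul t2
  filter_upwards [t1 hH, t2 hH, t12 hK] with p hp1 hp2 hp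
  simp only [chartHom, chartMul, Set.mem_preimage] at *
  rw [PartialEquiv.left_inv _ hp, PartialEquiv.left_inv _ hp1, PartialEquiv.left_inv _ hp2, map_mul]

/-- Differentiating f(ab) = f(a)f(b) in b at the identity shows that corresponding left-invariant
fields are f-related near the identity. -/
theorem fderiv_chartHom_chartField {f : K →* H} (hf : ContMDiff 𝓘(ℝ, F) 𝓘(ℝ, E) ∞ f) (w : F) :
    ∀ᶠ a in 𝓝 (chartOne F K), fderiv ℝ (chartHom E F f) a (chartField F K w a) =
      chartField E H (fderiv ℝ (chartHom E F f) (chartOne F K) w) (chartHom E F f a) := by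
  have hd : ∀ᶠ a in 𝓝 (chartOne F K), DifferentiableAt ℝ (chartHom E F f) a := by
    have h : ContDiffAt ℝ 1 (chartHom E F f) (chartOne F K) :=
      (contDiffAt_chartHom hf).of_le (by simp)
    filter_upwards [h.eventually (by simp)] with p hp using hp.differentiableAt (by simp)
  have hcK : ContinuousAt (fun a : F => (a, chartOne F K)) (chartOne F K) := by fun_prop
  have hcH : ContinuousAt (fun a : F => (chartHom E F f a, chartOne E H)) (chartOne F K) :=
    (contDiffAt_chartHom hf).continuousAt.prodMk continuousAt_const
  have hmH := hcH.eventually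
    (p := fun p => DifferentiableAt ℝ (fun p : E × E => chartMul H p.1 p.2) p) (by
      beta_reduce
      rw [chartHom_chartOne]; exact eventually_differentiableAt_chartMul)
  filter_upwards [hd, target_mem_nhds_chartOne (H := K),
    hcK.eventually eventually_differentiableAt_chartMul, hmH,
    hcK.eventually (eventually_chartHom_chartMul hf).eventually_nhds] with a ha hat haK haH heq
  have hb : ∀ᶠ b in 𝓝 (chartOne F K), chartHom E F f (chartMul K a b) =
      chartMul H (chartHom E F f a) (chartHom E F f b) := by
    have hc : ContinuousAt (fun b : F => (a, b)) (chartOne F K) := by fun_prop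
    exact hc.eventually heq
  have hK : HasFDerivAt (chartMul K a) (fderiv ℝ (chartMul K a) (chartOne F K)) (chartOne F K) :=
    (haK.comp (chartOne F K) (f := fun b : F => (a, b)) (by fun_prop)).hasFDerivAt
  have hH : HasFDerivAt (chartMul H (chartHom E F f a))
      (fderiv ℝ (chartMul H (chartHom E F f a)) (chartOne E H)) (chartHom E F f (chartOne F K)) := by
    rw [chartHom_chartOne]
    exact (haH.comp (chartOne E H) (f := fun b : E => (chartHom E F f a, b))
      (by fun_prop)).hasFDerivAt
  have hl : HasFDerivAt (chartHom E F f) (fderiv ℝ (chartHom E F f) a)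
      (chartMul K a (chartOne F K)) := by
    rw [chartMul_chartOne_right hat]
    exact ha.hasFDerivAt
  have e1 := hl.comp (chartOne F K) hK
  have e2 := hH.comp (chartOne F K) (hd.self_of_nhds.hasFDerivAt)
  have e3 := e1.unique (e2.congr_of_eventuallyEq hb)
  exact congrArg (fun A : F →L[ℝ] E => A w) e3

/-- Related vector fields have related brackets. -/
theorem derivAtOne_lie {f : K →* H} (hf : ContMDiff 𝓘(ℝ, F) 𝓘(ℝ, E) ∞ f)
    (x y : GroupLieAlgebra 𝓘(ℝ, F) K) :
    derivAtOne E F f ⁅x, y⁆ = ⁅derivAtOne E F f x, derivAtOne E F f y⁆ := by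
  have key : ∀ x y : F, fderiv ℝ (chartHom E F f) (chartOne F K)
      (VectorField.lieBracket ℝ (chartField F K x) (chartField F K y) (chartOne F K)) =
      VectorField.lieBracket ℝ (chartField E H (fderiv ℝ (chartHom E F f) (chartOne F K) x))
        (chartField E H (fderiv ℝ (chartHom E F f) (chartOne F K) y)) (chartOne E H) := by
    intro x y
    have hd : HasFDerivAt (chartHom E F f) (fderiv ℝ (chartHom E F f) (chartOne F K))
        (chartOne F K) :=
      ((contDiffAt_chartHom hf).differentiableAt (by simp)).hasFDerivAt
    have hcomp : ∀ z : F, fderiv ℝ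
        (fun a => fderiv ℝ (chartHom E F f) a (chartField F K z a)) (chartOne F K) =
        (fderiv ℝ (chartField E H (fderiv ℝ (chartHom E F f) (chartOne F K) z))
          (chartOne E H)).comp (fderiv ℝ (chartHom E F f) (chartOne F K)) := by
      intro z
      rw [Filter.EventuallyEq.fderiv_eq (fderiv_chartHom_chartField hf z)]
      have h1 := (hasFDerivAt_chartField (E := E) (H := H)
        (fderiv ℝ (chartHom E F f) (chartOne F K) z)).differentiableAt.hasFDerivAt
      rw [← chartHom_chartOne (E := E) (F := F) f] at h1
      have h2 := (h1.comp (chartOne F K) hd).fderiv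
      rw [chartHom_chartOne] at h2
      exact h2
    rw [VectorField.fderiv_apply_lieBracket (contDiffAt_chartHom hf)
      (by simpa using ENat.LEInfty.out)
      (hasFDerivAt_chartField y).differentiableAt (hasFDerivAt_chartField x).differentiableAt,
      hcomp, hcomp, VectorField.lieBracket_eq]
    simp only [chartField_chartOne, ContinuousLinearMap.comp_apply]
  have e1 := derivAtOne_eq_fderiv hf (⁅x, y⁆ : GroupLieAlgebra 𝓘(ℝ, F) K)
  have e2 := lie_eq_lieBracket_chartField x y
  have e3 := lie_eq_lieBracket_chartField (derivAtOne E F f x) (derivAtOne E F f y)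
  have ex := derivAtOne_eq_fderiv hf x
  have ey := derivAtOne_eq_fderiv hf y
  refine e1.trans ?_
  refine Eq.trans ?_ e3.symm
  refine (congrArg (fderiv ℝ (chartHom E F f) (chartOne F K)) e2).trans ?_
  refine (key x y).trans ?_
  congr 2
  · exact ex.symm
  · exact ey.symm

end Hom

end ChartMul

/-! ### The adjoint representation and its differential. -/

section Adjoint

variable {E : Type*} [NormedAddCommGroup E] [NormedSpace ℝ E] [FiniteDimensional ℝ E]
  {H : Type*} [TopologicalSpace H] [ChartedSpace E H] [Group H] [LieGroup 𝓘(ℝ, E) ∞ H]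
  {F : Type*} [NormedAddCommGroup F] [NormedSpace ℝ F] [FiniteDimensional ℝ F]
  {K : Type*} [TopologicalSpace K] [ChartedSpace F K] [Group K] [LieGroup 𝓘(ℝ, F) ∞ K]

theorem contMDiff_conj (h : H) :
    ContMDiff 𝓘(ℝ, E) 𝓘(ℝ, E) ∞ (MulAut.conj h).toMonoidHom := by
  have : ContMDiff 𝓘(ℝ, E) 𝓘(ℝ, E) ∞ (fun x : H => h * x * h⁻¹) :=
    (contMDiff_const.mul contMDiff_id).mul contMDiff_const
  exact this

theorem groupAd_eq_derivAtOne (h : H) :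
    groupAd E h = derivAtOne E E (MulAut.conj h).toMonoidHom := rfl

theorem derivAtOne_comp {F' : Type*} [NormedAddCommGroup F'] [NormedSpace ℝ F']
    [FiniteDimensional ℝ F'] {K' : Type*} [TopologicalSpace K'] [ChartedSpace F' K'] [Group K']
    [LieGroup 𝓘(ℝ, F') ∞ K'] {f : K →* H} (hf : ContMDiff 𝓘(ℝ, F) 𝓘(ℝ, E) ∞ f)
    {f' : K' →* K} (hf' : ContMDiff 𝓘(ℝ, F') 𝓘(ℝ, F) ∞ f') (x : GroupLieAlgebra 𝓘(ℝ, F') K') :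
    derivAtOne E F' (f.comp f') x = derivAtOne E F f (derivAtOne F F' f' x) := by
  have hc : ContMDiff 𝓘(ℝ, F') 𝓘(ℝ, E) ∞ (f.comp f') := hf.comp hf'
  have h1 := derivAtOne_eq_fderiv hc x
  have h2 := derivAtOne_eq_fderiv hf' x
  have h3 := derivAtOne_eq_fderiv hf (derivAtOne F F' f' x)
  refine h1.trans (Eq.trans ?_ h3.symm)
  have hd' : HasFDerivAt (chartHom F F' f') (fderiv ℝ (chartHom F F' f') (chartOne F' K'))
      (chartOne F' K') :=
    ((contDiffAt_chartHom hf').differentiableAt (by simp)).hasFDerivAt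
  have hd : HasFDerivAt (chartHom E F f) (fderiv ℝ (chartHom E F f) (chartOne F K))
      (chartHom F F' f' (chartOne F' K')) := by
    rw [chartHom_chartOne]
    exact ((contDiffAt_chartHom hf).differentiableAt (by simp)).hasFDerivAt
  have heq : chartHom E F' (f.comp f') =ᶠ[𝓝 (chartOne F' K')]
      chartHom E F f ∘ chartHom F F' f' := by
    have hK : f' ⁻¹' (extChartAt 𝓘(ℝ, F) (1 : K)).source ∈ 𝓝 (1 : K') := by
      apply hf'.continuous.continuousAt.preimage_mem_nhds
      rw [map_one]
      exact extChartAt_source_mem_nhds 1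
    have hsymm : ContinuousAt (extChartAt 𝓘(ℝ, F') (1 : K')).symm (chartOne F' K') :=
      contMDiffAt_extChartAt_symm_chartOne.continuousAt
    rw [ContinuousAt, extChartAt_symm_chartOne] at hsymm
    filter_upwards [hsymm hK] with a ha
    simp only [chartHom, Function.comp_apply, MonoidHom.comp_apply]
    rw [PartialEquiv.left_inv _ ha]
  rw [heq.fderiv_eq, (hd.comp (chartOne F' K') hd').fderiv]
  exact congrArg (fderiv ℝ (chartHom E F f) (chartOne F K)) h2.symm

theorem derivAtOne_id (x : GroupLieAlgebra 𝓘(ℝ, E) H) :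
    derivAtOne E E (MonoidHom.id H) x = x := by
  have h : mfderiv 𝓘(ℝ, E) 𝓘(ℝ, E) (id : H → H) 1 = ContinuousLinearMap.id ℝ _ := mfderiv_id
  exact congrArg (fun A : E →L[ℝ] E => A x) h

theorem groupAd_one (x : GroupLieAlgebra 𝓘(ℝ, E) H) : groupAd E (1 : H) x = x := by
  rw [groupAd_eq_derivAtOne]
  have : (MulAut.conj (1 : H)).toMonoidHom = MonoidHom.id H := by ext; simp
  rw [this, derivAtOne_id]

theorem groupAd_mul (h h' : H) (x : GroupLieAlgebra 𝓘(ℝ, E) H) :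
    groupAd E (h * h') x = groupAd E h (groupAd E h' x) := by
  have heq : (MulAut.conj (h * h')).toMonoidHom =
      (MulAut.conj h).toMonoidHom.comp (MulAut.conj h').toMonoidHom := by
    ext y
    simp [mul_assoc]
  rw [groupAd_eq_derivAtOne, groupAd_eq_derivAtOne, groupAd_eq_derivAtOne,
    ← derivAtOne_comp (contMDiff_conj h) (contMDiff_conj h'), heq]

/-- The adjoint representation acts by automorphisms of the Lie algebra. -/
def groupAdEquiv (h : H) : GroupLieAlgebra 𝓘(ℝ, E) H ≃ₗ⁅ℝ⁆ GroupLieAlgebra 𝓘(ℝ, E) H where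
  toFun := groupAd E h
  map_add' := map_add _
  map_smul' := map_smul _
  map_lie' := derivAtOne_lie (contMDiff_conj h) _ _
  invFun := groupAd E h⁻¹
  left_inv x := by rw [← groupAd_mul, inv_mul_cancel, groupAd_one]
  right_inv x := by rw [← groupAd_mul, mul_inv_cancel, groupAd_one]

theorem groupAd_derivAtOne {f : K →* H} (hf : ContMDiff 𝓘(ℝ, F) 𝓘(ℝ, E) ∞ f) (k : K)
    (x : GroupLieAlgebra 𝓘(ℝ, F) K) :
    groupAd E (f k) (derivAtOne E F f x) = derivAtOne E F f (groupAd F k x) := by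
  have heq : (MulAut.conj (f k)).toMonoidHom.comp f = f.comp (MulAut.conj k).toMonoidHom := by
    ext y
    simp
  rw [groupAd_eq_derivAtOne, groupAd_eq_derivAtOne, ← derivAtOne_comp (contMDiff_conj _) hf,
    ← derivAtOne_comp hf (contMDiff_conj k), heq]

/-- The adjoint representation in the chart solves `∂₁m(1, a) (Ad a w) = ∂₂m(a, 1) w`. -/
theorem eventually_fderiv_chartMul_groupAd (w : E) :
    ∀ᶠ a in 𝓝 (chartOne E H),
      fderiv ℝ (fun p : E × E => chartMul H p.1 p.2) (chartOne E H, a)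
        ((groupAd E ((extChartAt 𝓘(ℝ, E) (1 : H)).symm a) w : E), (0 : E)) =
      fderiv ℝ (fun p : E × E => chartMul H p.1 p.2) (a, chartOne E H) (0, w) := by
  have hcl : ContinuousAt (fun a : E => (chartOne E H, a)) (chartOne E H) := by fun_prop
  filter_upwards [eventually_chartField_eq (H := H) w,
    hcl.eventually eventually_differentiableAt_chartMul,
    target_mem_nhds_chartOne (H := H)] with a ha hda hat
  rw [← ha, chartField]
  set x := (extChartAt 𝓘(ℝ, E) (1 : H)).symm a with hx
  have hAd : (groupAd E x w : E) = fderiv ℝ (chartHom E E (MulAut.conj x).toMonoidHom)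
      (chartOne E H) w := derivAtOne_eq_fderiv (contMDiff_conj x) w
  have hd1 : HasFDerivAt (chartHom E E (MulAut.conj x).toMonoidHom)
      (fderiv ℝ (chartHom E E (MulAut.conj x).toMonoidHom) (chartOne E H)) (chartOne E H) :=
    ((contDiffAt_chartHom (contMDiff_conj x)).differentiableAt (by simp)).hasFDerivAt
  have hd2 : HasFDerivAt (fun b : E => (chartHom E E (MulAut.conj x).toMonoidHom b, a))
      ((fderiv ℝ (chartHom E E (MulAut.conj x).toMonoidHom) (chartOne E H)).prod 0)
      (chartOne E H) := hd1.prodMk (hasFDerivAt_const a _)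
  have hd3 : HasFDerivAt (fun p : E × E => chartMul H p.1 p.2)
      (fderiv ℝ (fun p : E × E => chartMul H p.1 p.2) (chartOne E H, a))
      (chartHom E E (MulAut.conj x).toMonoidHom (chartOne E H), a) := by
    rw [chartHom_chartOne]
    exact hda.hasFDerivAt
  have hd4 := HasFDerivAt.comp (f := fun b : E => (chartHom E E (MulAut.conj x).toMonoidHom b, a))
    (chartOne E H) hd3 hd2
  -- This is xb = (xbx⁻¹)x in the chart. Its derivative in b at the identity is the claim.
  have heq : chartMul H a =ᶠ[𝓝 (chartOne E H)] (fun p : E × E => chartMul H p.1 p.2) ∘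
      (fun b : E => (chartHom E E (MulAut.conj x).toMonoidHom b, a)) := by
    have hS : (MulAut.conj x).toMonoidHom ⁻¹' (extChartAt 𝓘(ℝ, E) (1 : H)).source ∈ 𝓝 (1 : H) := by
      apply (contMDiff_conj (E := E) x).continuous.continuousAt.preimage_mem_nhds
      rw [map_one]
      exact extChartAt_source_mem_nhds 1
    have hsymm : ContinuousAt (extChartAt 𝓘(ℝ, E) (1 : H)).symm (chartOne E H) :=
      contMDiffAt_extChartAt_symm_chartOne.continuousAt
    rw [ContinuousAt, extChartAt_symm_chartOne] at hsymm
    filter_upwards [hsymm hS] with b hb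
    simp only [chartHom, Function.comp_apply, chartMul]
    rw [PartialEquiv.left_inv _ hb, ← hx]
    simp
  rw [heq.fderiv_eq, hd4.fderiv, hAd]
  rfl

/-- Near the identity Ad(a)w = M(a)⁻¹X_w(a), where M(a) = ∂₁m(1, a) equals 1 at the identity and X_w
is the left-invariant field. The derivative along v is thus DX_w(v) - DM(v)w, and symmetry of the
second derivative gives the stated form. -/
theorem exists_hasFDerivAt_groupAd (w : E) :
    ∃ A : E →L[ℝ] E, HasFDerivAt
      (fun a : E => (groupAd E ((extChartAt 𝓘(ℝ, E) (1 : H)).symm a) w : E)) A (chartOne E H) ∧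
      ∀ v : E, A v = fderiv ℝ (fderiv ℝ (fun p : E × E => chartMul H p.1 p.2))
          (chartOne E H, chartOne E H) (v, 0) (0, w) -
        fderiv ℝ (fderiv ℝ (fun p : E × E => chartMul H p.1 p.2))
          (chartOne E H, chartOne E H) (w, 0) (0, v) := by
  set D := fderiv ℝ (fun p : E × E => chartMul H p.1 p.2) with hD
  set p₀ : E × E := (chartOne E H, chartOne E H) with hp₀
  have h0 : DifferentiableAt ℝ D p₀ :=
    (contDiffAt_fderiv_chartMul (E := E) (H := H)).differentiableAt (by simp)
  -- `M a = ∂₁ m(1, a)`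
  let M : E → (E →L[ℝ] E) := fun a => (D (chartOne E H, a)).comp (ContinuousLinearMap.inl ℝ E E)
  have hM : HasFDerivAt M
      ((((ContinuousLinearMap.compL ℝ E (E × E) E).flip (ContinuousLinearMap.inl ℝ E E)).comp
        (fderiv ℝ D p₀)).comp (ContinuousLinearMap.inr ℝ E E)) (chartOne E H) := by
    have h2 : HasFDerivAt (fun a : E => (chartOne E H, a)) (ContinuousLinearMap.inr ℝ E E)
      (chartOne E H) := hasFDerivAt_prodMk_right _ _
    exact (((ContinuousLinearMap.compL ℝ E (E × E) E).flip
      (ContinuousLinearMap.inl ℝ E E)).hasFDerivAt (x := D p₀)).comp (chartOne E H)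
      (HasFDerivAt.comp (f := fun a : E => (chartOne E H, a)) (chartOne E H) h0.hasFDerivAt h2)
  have hM1 : M (chartOne E H) = 1 := by
    have hd := (eventually_differentiableAt_chartMul (E := E) (H := H)).self_of_nhds
    have h2 : HasFDerivAt (fun a : E => (a, chartOne E H)) (ContinuousLinearMap.inl ℝ E E)
      (chartOne E H) := hasFDerivAt_prodMk_left _ _
    have h3 := HasFDerivAt.comp (f := fun a : E => (a, chartOne E H)) (chartOne E H)
      hd.hasFDerivAt h2
    have h4 : (fun p : E × E => chartMul H p.1 p.2) ∘ (fun a : E => (a, chartOne E H))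
        =ᶠ[𝓝 (chartOne E H)] id := by
      filter_upwards [target_mem_nhds_chartOne (H := H)] with a ha using chartMul_chartOne_right ha
    exact h3.unique ((hasFDerivAt_id _).congr_of_eventuallyEq h4)
  have hR : HasFDerivAt Ring.inverse (-ContinuousLinearMap.mulLeftRight ℝ (E →L[ℝ] E) 1 1)
      (M (chartOne E H)) := by
    rw [hM1]
    simpa using hasFDerivAt_ringInverse (𝕜 := ℝ) (1 : (E →L[ℝ] E)ˣ)
  have hMinv := hR.comp (chartOne E H) hM
  have hl := hasFDerivAt_chartField (E := E) (H := H) w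
  have hfin := hMinv.clm_apply hl
  have hev : (fun a : E => (groupAd E ((extChartAt 𝓘(ℝ, E) (1 : H)).symm a) w : E))
      =ᶠ[𝓝 (chartOne E H)] fun a => Ring.inverse (M a) (chartField E H w a) := by
    have hu : ∀ᶠ a in 𝓝 (chartOne E H), IsUnit (M a) := by
      apply hM.continuousAt.eventually
      rw [hM1]
      exact Units.isOpen.mem_nhds isUnit_one
    filter_upwards [hu, eventually_fderiv_chartMul_groupAd (H := H) w,
      eventually_chartField_eq (H := H) w] with a ha h1 h2
    rw [h2, ← h1]
    have h3 : Ring.inverse (M a) * M a = 1 := Ring.inverse_mul_cancel _ ha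
    exact (congrArg (fun A : E →L[ℝ] E =>
      A (groupAd E ((extChartAt 𝓘(ℝ, E) (1 : H)).symm a) w : E)) h3).symm
  refine ⟨_, hfin.congr_of_eventuallyEq hev, fun v => ?_⟩
  have hsymm : fderiv ℝ D p₀ (0, v) (w, 0) = fderiv ℝ D p₀ (w, 0) (0, v) :=
    (contDiffAt_chartMul (E := E) (H := H)).isSymmSndFDerivAt
      (by simpa using ENat.LEInfty.out) _ _
  have hcf : chartField E H w (chartOne E H) = w := chartField_chartOne w
  simp [hM1, hcf, ← hD, ← hp₀, hsymm, sub_eq_add_neg]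

/-- The differential of the adjoint representation at the identity is the bracket. -/
theorem hasFDerivAt_groupAd (w : GroupLieAlgebra 𝓘(ℝ, E) H) :
    ∃ A : E →L[ℝ] E, HasFDerivAt
      (fun a : E => (groupAd E ((extChartAt 𝓘(ℝ, E) (1 : H)).symm a) w : E)) A (chartOne E H) ∧
      ∀ v : GroupLieAlgebra 𝓘(ℝ, E) H, A v = (⁅v, w⁆ : GroupLieAlgebra 𝓘(ℝ, E) H) := by
  obtain ⟨A, hA, hA'⟩ := exists_hasFDerivAt_groupAd (E := E) (H := H) w
  exact ⟨A, hA, fun v => (hA' v).trans (lie_eq_secondDerivative v w).symm⟩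

/-- Differentiability gives continuity at 1, and Ad(h₀h) = Ad(h₀)Ad(h) carries it to every point. -/
theorem continuous_groupAd (w : GroupLieAlgebra 𝓘(ℝ, E) H) :
    Continuous (fun h : H => (groupAd E h w : E)) := by
  have h1 : ∀ w : GroupLieAlgebra 𝓘(ℝ, E) H,
      ContinuousAt (fun h : H => (groupAd E h w : E)) 1 := by
    intro w
    obtain ⟨A, hA, -⟩ := hasFDerivAt_groupAd (E := E) (H := H) w
    have hc : ContinuousAt (extChartAt 𝓘(ℝ, E) (1 : H)) 1 := continuousAt_extChartAt 1
    have h2 := ContinuousAt.comp (f := extChartAt 𝓘(ℝ, E) (1 : H)) (x := (1 : H))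
      (HasFDerivAt.continuousAt (𝕜 := ℝ) (E := E) (F := E) hA) hc
    refine h2.congr ?_
    filter_upwards [extChartAt_source_mem_nhds (I := 𝓘(ℝ, E)) (1 : H)] with h hh
    exact congrArg (fun h : H => groupAd E h w) (PartialEquiv.left_inv _ hh)
  have : IsTopologicalGroup H := topologicalGroup_of_lieGroup 𝓘(ℝ, E) ∞
  refine continuous_iff_continuousAt.mpr fun h₀ => ?_
  have h3 : ContinuousAt (fun h : H => h₀⁻¹ * h) h₀ := by fun_prop
  have h4 : ContinuousAt (fun h : H => (groupAd E h w : E)) (h₀⁻¹ * h₀) := by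
    rw [inv_mul_cancel]; exact h1 w
  have h5 := ContinuousAt.comp (f := fun h : H => h₀⁻¹ * h) (x := h₀) h4 h3
  have hlin : Continuous (fun x : E => (groupAd E h₀ x : E)) :=
    let L : E →ₗ[ℝ] E := groupAd E h₀
    L.continuous_of_finiteDimensional
  refine (hlin.continuousAt.comp h5).congr (Filter.Eventually.of_forall fun h => ?_)
  change groupAd E h₀ (groupAd E (h₀⁻¹ * h) w) = groupAd E h w
  rw [← groupAd_mul, mul_inv_cancel_left]

omit [FiniteDimensional ℝ E] [FiniteDimensional ℝ F] in
theorem bilinear_fderiv_eq_zero_of_eventually_const (B : E →L[ℝ] E →L[ℝ] ℝ) {u u₂ : F → E}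
    {A A₂ : F →L[ℝ] E} {a : F} (hu : HasFDerivAt u A a) (hu₂ : HasFDerivAt u₂ A₂ a) {r : ℝ}
    (h : ∀ᶠ b in 𝓝 a, B (u b) (u₂ b) = r) (z : F) :
    B (u a) (A₂ z) + B (A z) (u₂ a) = 0 := by
  have h3 := B.hasFDerivAt_of_bilinear hu hu₂
  have h4 := ((hasFDerivAt_const r a).congr_of_eventuallyEq h).unique h3
  have h5 := congrArg (fun A : F →L[ℝ] ℝ => A z) h4
  simpa using h5.symm

/-- Forms invariant under the adjoint action of a Lie subgroup are invariant under its Lie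
algebra. -/
theorem lie_invariant_of_groupAd_invariant {f : K →* H} (hf : ContMDiff 𝓘(ℝ, F) 𝓘(ℝ, E) ∞ f)
    (T : LinearMap.BilinForm ℝ (GroupLieAlgebra 𝓘(ℝ, E) H))
    (hT : ∀ k x y, T (groupAd E (f k) x) (groupAd E (f k) y) = T x y)
    (z : GroupLieAlgebra 𝓘(ℝ, F) K) (x y : GroupLieAlgebra 𝓘(ℝ, E) H) :
    T ⁅derivAtOne E F f z, x⁆ y + T x ⁅derivAtOne E F f z, y⁆ = 0 := by
  let T' : E →ₗ[ℝ] E →ₗ[ℝ] ℝ := T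
  let B : E →L[ℝ] E →L[ℝ] ℝ := T'.toContinuousBilinearMap
  obtain ⟨A, hA, hA'⟩ := hasFDerivAt_groupAd x
  obtain ⟨A₂, hA₂, hA₂'⟩ := hasFDerivAt_groupAd y
  have hd : HasFDerivAt (chartHom E F f) (fderiv ℝ (chartHom E F f) (chartOne F K))
      (chartOne F K) :=
    ((contDiffAt_chartHom hf).differentiableAt (by simp)).hasFDerivAt
  rw [← chartHom_chartOne (E := E) (F := F) f] at hA hA₂
  have h1 := HasFDerivAt.comp (𝕜 := ℝ) (E := F) (F := E) (G := E) (chartOne F K) hA hd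
  have h2 := HasFDerivAt.comp (𝕜 := ℝ) (E := F) (F := E) (G := E) (chartOne F K) hA₂ hd
  have hev : ∀ᶠ a in 𝓝 (chartOne F K),
      B (groupAd E ((extChartAt 𝓘(ℝ, E) (1 : H)).symm (chartHom E F f a)) x : E)
        (groupAd E ((extChartAt 𝓘(ℝ, E) (1 : H)).symm (chartHom E F f a)) y : E) = T x y := by
    have hS : f ⁻¹' (extChartAt 𝓘(ℝ, E) (1 : H)).source ∈ 𝓝 (1 : K) := by
      apply hf.continuous.continuousAt.preimage_mem_nhds
      rw [map_one]
      exact extChartAt_source_mem_nhds 1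
    have hsymm : ContinuousAt (extChartAt 𝓘(ℝ, F) (1 : K)).symm (chartOne F K) :=
      contMDiffAt_extChartAt_symm_chartOne.continuousAt
    rw [ContinuousAt, extChartAt_symm_chartOne] at hsymm
    filter_upwards [hsymm hS] with a ha
    have : (extChartAt 𝓘(ℝ, E) (1 : H)).symm (chartHom E F f a) =
        f ((extChartAt 𝓘(ℝ, F) (1 : K)).symm a) := PartialEquiv.left_inv _ ha
    rw [this]
    exact hT _ x y
  -- Along K the form is constant on the moving pair, so the product rule gives the infinitesimal
  -- invariance.
  have h6 := bilinear_fderiv_eq_zero_of_eventually_const B h1 h2 hev z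
  have hz : fderiv ℝ (chartHom E F f) (chartOne F K) z = derivAtOne E F f z :=
    (derivAtOne_eq_fderiv hf z).symm
  have hAd1 : ∀ w, groupAd E ((extChartAt 𝓘(ℝ, E) (1 : H)).symm
      (chartHom E F f (chartOne F K))) w = w := by
    intro w
    rw [chartHom_chartOne, extChartAt_symm_chartOne, groupAd_one]
  have e1 : A (fderiv ℝ (chartHom E F f) (chartOne F K) z) = ⁅derivAtOne E F f z, x⁆ :=
    (congrArg A hz).trans (hA' _)
  have e2 : A₂ (fderiv ℝ (chartHom E F f) (chartOne F K) z) = ⁅derivAtOne E F f z, y⁆ :=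
    (congrArg A₂ hz).trans (hA₂' _)
  have e3 : T (groupAd E ((extChartAt 𝓘(ℝ, E) (1 : H)).symm
      (chartHom E F f (chartOne F K))) x) ⁅derivAtOne E F f z, y⁆ +
      T ⁅derivAtOne E F f z, x⁆ (groupAd E ((extChartAt 𝓘(ℝ, E) (1 : H)).symm
      (chartHom E F f (chartOne F K))) y) = 0 := by
    rw [← e1, ← e2]
    exact h6
  rw [hAd1, hAd1] at e3
  rw [add_comm]
  exact e3

end Adjoint

/-! ### Connected groups and the simple ideals of their Lie algebra. -/

section LieIdealLemmas

variable {L : Type*} [LieRing L] [LieAlgebra ℝ L]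

/-- An automorphism permutes the ideals. -/
def LieIdeal.comapOrderIso (e : L ≃ₗ⁅ℝ⁆ L) : LieIdeal ℝ L ≃o LieIdeal ℝ L where
  toFun J := J.comap e.toLieHom
  invFun J := J.comap e.symm.toLieHom
  left_inv J := by ext x; simp [LieIdeal.mem_comap]
  right_inv J := by ext x; simp [LieIdeal.mem_comap]
  map_rel_iff' := by
    intro I J
    constructor
    · intro h x hx
      have h1 : e.symm x ∈ J.comap e.toLieHom := h (by simpa [LieIdeal.mem_comap] using hx)
      simpa [LieIdeal.mem_comap] using h1
    · intro h x hx
      simp only [LieIdeal.mem_comap, Equiv.coe_fn_mk] at hx ⊢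
      exact h hx

theorem LieAlgebra.IsSemisimple.finite_isAtom [FiniteDimensional ℝ L]
    [LieAlgebra.IsSemisimple ℝ L] : {J : LieIdeal ℝ L | IsAtom J}.Finite :=
  WellFoundedGT.finite_of_sSupIndep LieAlgebra.IsSemisimple.sSupIndep_isAtom

end LieIdealLemmas

section ConnectedGroup

variable {F : Type*} [NormedAddCommGroup F] [NormedSpace ℝ F] [FiniteDimensional ℝ F]
  {K : Type*} [TopologicalSpace K] [ChartedSpace F K] [Group K] [LieGroup 𝓘(ℝ, F) ∞ K]
  [ConnectedSpace K]

/-- The adjoint action of a connected group preserves the simple ideals. -/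
theorem groupAd_mem_of_isAtom (hss : LieAlgebra.IsSemisimple ℝ (GroupLieAlgebra 𝓘(ℝ, F) K))
    {J : LieIdeal ℝ (GroupLieAlgebra 𝓘(ℝ, F) K)} (hJ : IsAtom J) (k : K)
    {x : GroupLieAlgebra 𝓘(ℝ, F) K} (hx : x ∈ J) : groupAd F k x ∈ J := by
  -- The closed sets `Z J'`, for the finitely many simple ideals `J'`, cover K. Those with `J' ≠ J`
  -- miss `Z J`, so `Z J` is also open, and it contains 1.
  let Z : LieIdeal ℝ (GroupLieAlgebra 𝓘(ℝ, F) K) → Set K :=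
    fun J' => {k | ∀ x ∈ J, groupAd F k x ∈ J'}
  have hclosed : ∀ J', IsClosed (Z J') := by
    intro J'
    have hset : Z J' = ⋂ x ∈ J, {k | groupAd F k x ∈ J'} := by
      ext k; simp [Z]
    rw [hset]
    refine isClosed_biInter fun x _ => ?_
    let W : Submodule ℝ F := J'.toSubmodule
    exact (W.closed_of_finiteDimensional).preimage (continuous_groupAd x)
  have hcover : ∀ k, ∃ J', IsAtom J' ∧ k ∈ Z J' := by
    intro k
    refine ⟨LieIdeal.comapOrderIso (groupAdEquiv k).symm J,
      (OrderIso.isAtom_iff _ _).mpr hJ, fun x hx => ?_⟩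
    change (groupAdEquiv k).symm ((groupAdEquiv k) x) ∈ J
    simpa using hx
  have hdisj : ∀ J', IsAtom J' → J' ≠ J → Disjoint (Z J') (Z J) := by
    intro J' hJ' hne
    rw [Set.disjoint_left]
    intro k hk hk'
    apply hJ.1
    rw [LieSubmodule.eq_bot_iff]
    intro x hx
    have hbot : J' ⊓ J = ⊥ := disjoint_iff.mp (hJ'.disjoint_of_ne hJ hne)
    have h1 : groupAd F k x ∈ J' ⊓ J := ⟨hk x hx, hk' x hx⟩
    rw [hbot, LieSubmodule.mem_bot] at h1
    exact (groupAdEquiv k).injective (h1.trans (map_zero (groupAdEquiv k)).symm)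
  have hopen : IsOpen (Z J) := by
    have hset : Z J = (⋃ J' ∈ {J' | IsAtom J'} \ {J}, Z J')ᶜ := by
      ext k
      simp only [Set.mem_compl_iff, Set.mem_iUnion, not_exists, Set.mem_sdiff, Set.mem_ofPred_eq,
        Set.mem_singleton_iff]
      constructor
      · rintro hk J' ⟨hJ', hne⟩ hk'
        exact Set.disjoint_left.mp (hdisj J' hJ' hne) hk' hk
      · intro h
        obtain ⟨J', hJ', hk⟩ := hcover k
        by_cases hne : J' = J
        · exact hne ▸ hk
        · exact absurd hk (h J' ⟨hJ', hne⟩)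
    rw [hset, isOpen_compl_iff]
    exact (LieAlgebra.IsSemisimple.finite_isAtom.sdiff).isClosed_biUnion fun J' _ => hclosed J'
  have huniv : Z J = Set.univ := IsClopen.eq_univ ⟨hclosed J, hopen⟩
    ⟨1, fun x hx => by rwa [groupAd_one]⟩
  have hk : k ∈ Z J := huniv ▸ Set.mem_univ k
  exact hk x hx

-- This serves to exclude a trivial K, for which every line of 𝔥 would be Ad(K)-stable.
omit [FiniteDimensional ℝ F] [Group K] [LieGroup 𝓘(ℝ, F) ∞ K] in
theorem subsingleton_of_subsingleton_model [Subsingleton F] : Subsingleton K := by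
  have : DiscreteTopology K := by
    rw [discreteTopology_iff_isOpen_singleton]
    intro x
    have h : (chartAt F x).source = {x} := by
      apply Set.eq_singleton_iff_unique_mem.mpr
      exact ⟨mem_chart_source F x, fun y hy =>
        (chartAt F x).injOn hy (mem_chart_source F x) (Subsingleton.elim _ _)⟩
    rw [← h]
    exact (chartAt F x).open_source
  exact PreconnectedSpace.trivial_of_discrete

end ConnectedGroup

end

section

open Matrix Finset

/-! ### A Casimir inequality for orthogonal representations -/

section MatrixRep

variable {α κ : Type*} [Fintype α] [Fintype κ] [DecidableEq α] [DecidableEq κ]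

/-- Skew-symmetric matrices spanning a Lie algebra with totally antisymmetric structure constants
`F`, with Casimir constants `C` on the representation, `c` on the adjoint representation, and
trace form `-u`. -/
structure IsOrthogonalRep (ρ : κ → Matrix α α ℝ) (F : κ → κ → κ → ℝ) (c u C : ℝ) : Prop where
  skew : ∀ i, (ρ i)ᵀ = -ρ i
  lie : ∀ i j, ρ i * ρ j - ρ j * ρ i = ∑ m, F i j m • ρ m
  antisymm₁ : ∀ i j m, F i j m = -F j i m
  antisymm₂ : ∀ i j m, F i j m = -F i m j
  casimir_adjoint : ∀ m n, ∑ i, ∑ j, F i j m * F i j n = if m = n then c else 0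
  trace_mul : ∀ i j, trace (ρ i * ρ j) = if i = j then -u else 0
  casimir : ∑ i, ρ i * ρ i = -C • (1 : Matrix α α ℝ)

namespace IsOrthogonalRep

variable {ρ : κ → Matrix α α ℝ} {F : κ → κ → κ → ℝ} {c u C : ℝ}

/-- The operator `A ↦ ∑ ρᵢ A ρᵢ`. -/
def contraction (ρ : κ → Matrix α α ℝ) (A : Matrix α α ℝ) : Matrix α α ℝ := ∑ i, ρ i * A * ρ i

/-- Moving ρ_j past ρ_i leaves the Casimir times ρ_j and ∑ F ρ_iρ_m. Antisymmetry turns the latter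
into half a sum of commutators, which contributes half the adjoint Casimir constant c. -/
theorem contraction_rep (h : IsOrthogonalRep ρ F c u C) (j : κ) :
    contraction ρ (ρ j) = (c / 2 - C) • ρ j := by
  have h1 : ∀ i, ρ i * ρ j * ρ i = ρ i * ρ i * ρ j + ∑ m, F j i m • (ρ i * ρ m) := by
    intro i
    have := h.lie j i
    have h2 : ρ j * ρ i = ρ i * ρ j + ∑ m, F j i m • ρ m := by rw [← this]; abel
    rw [mul_assoc, h2, mul_add, mul_assoc, Finset.mul_sum]
    simp
  have h2 : ∑ i, ∑ m, F j i m • (ρ i * ρ m) = (c / 2) • ρ j := by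
    have hswap : ∑ i, ∑ m, F j i m • (ρ i * ρ m) = -∑ i, ∑ m, F j i m • (ρ m * ρ i) := by
      rw [Finset.sum_comm, ← Finset.sum_neg_distrib]
      refine Finset.sum_congr rfl fun i _ => ?_
      rw [← Finset.sum_neg_distrib]
      refine Finset.sum_congr rfl fun m _ => ?_
      rw [h.antisymm₂ j m i, neg_smul]
    have h3 : (2 : ℝ) • ∑ i, ∑ m, F j i m • (ρ i * ρ m) = c • ρ j := by
      rw [two_smul]
      nth_rewrite 2 [hswap]
      rw [← sub_eq_add_neg, ← Finset.sum_sub_distrib]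
      simp_rw [← Finset.sum_sub_distrib, ← smul_sub, h.lie, Finset.smul_sum, smul_smul]
      have : ∀ i, ∑ m, ∑ l, (F j i m * F i m l) • ρ l =
          ∑ l, (∑ m, F j i m * F i m l) • ρ l := by
        intro i
        rw [Finset.sum_comm]
        simp_rw [Finset.sum_smul]
      simp_rw [this]
      rw [Finset.sum_comm]
      simp_rw [← Finset.sum_smul]
      have hcas : ∀ l, ∑ i, ∑ m, F j i m * F i m l = if j = l then c else 0 := by
        intro l
        rw [← h.casimir_adjoint j l]
        refine Finset.sum_congr rfl fun i _ => Finset.sum_congr rfl fun m _ => ?_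
        rw [h.antisymm₁ j i m, h.antisymm₂ i j m, neg_neg]
      simp [hcas]
    have h4 : ∑ i, ∑ m, F j i m • (ρ i * ρ m) = (1 / 2 : ℝ) • c • ρ j := by
      rw [← h3, smul_smul]; norm_num
    rw [h4, smul_smul]; congr 1; ring
  unfold contraction
  simp_rw [h1]
  rw [Finset.sum_add_distrib, h2, ← Finset.sum_mul, h.casimir]
  simp only [neg_smul, neg_mul, smul_mul_assoc, one_mul, sub_smul]
  abel

/-- Transposing three skew matrices reverses their order and changes the sign, so the trace is half
that of a commutator times the third matrix. -/
theorem trace_triple (h : IsOrthogonalRep ρ F c u C) (i j l : κ) :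
    trace (ρ i * ρ j * ρ l) = -(u / 2) * F i j l := by
  have h1 : trace (ρ i * ρ j * ρ l) = -trace (ρ j * ρ i * ρ l) := by
    rw [← trace_transpose (ρ i * ρ j * ρ l)]
    simp only [transpose_mul, h.skew]
    rw [show -ρ l * (-ρ j * -ρ i) = -(ρ l * (ρ j * ρ i)) by simp, trace_neg,
      trace_mul_comm]
  have h2 : trace (ρ i * ρ j * ρ l) - trace (ρ j * ρ i * ρ l) = -u * F i j l := by
    rw [← trace_sub, ← sub_mul, h.lie, Finset.sum_mul, trace_sum]
    simp [h.trace_mul, mul_comm]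
  linarith

theorem sum_sq_structure (h : IsOrthogonalRep ρ F c u C) :
    ∑ i, ∑ j, ∑ l, F i j l ^ 2 = c * Fintype.card κ := by
  have h1 : ∑ l, ∑ i, ∑ j, F i j l * F i j l = ∑ l : κ, c := by
    refine Finset.sum_congr rfl fun l _ => ?_
    simpa using h.casimir_adjoint l l
  rw [Finset.sum_const, Finset.card_univ, nsmul_eq_mul, mul_comm] at h1
  rw [← h1, Finset.sum_comm]
  have h2 : ∀ i, ∑ j, ∑ l, F j i l ^ 2 = ∑ j, ∑ l, F i j l * F i j l := by
    intro i
    refine Finset.sum_congr rfl fun j _ => Finset.sum_congr rfl fun l _ => ?_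
    rw [h.antisymm₁ j i l]; ring
  simp_rw [h2]
  rw [Finset.sum_comm]
  have h3 : ∀ j, ∑ i, ∑ l, F i j l * F i j l = ∑ i, ∑ l, F i l j * F i l j := by
    intro j
    refine Finset.sum_congr rfl fun i _ => Finset.sum_congr rfl fun l _ => ?_
    rw [h.antisymm₂ i j l]; ring
  simp_rw [h3]

theorem contraction_add (A B : Matrix α α ℝ) :
    contraction ρ (A + B) = contraction ρ A + contraction ρ B := by
  simp [contraction, mul_add, add_mul, Finset.sum_add_distrib]

theorem contraction_smul (r : ℝ) (A : Matrix α α ℝ) :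
    contraction ρ (r • A) = r • contraction ρ A := by
  simp [contraction, Finset.smul_sum]

theorem contraction_sum (A : κ → Matrix α α ℝ) :
    contraction ρ (∑ i, A i) = ∑ i, contraction ρ (A i) := by
  simp only [contraction, Finset.mul_sum, Finset.sum_mul]
  rw [Finset.sum_comm]

theorem trace_mul_contraction (A B : Matrix α α ℝ) :
    trace (A * contraction ρ B) = trace (contraction ρ A * B) := by
  simp only [contraction, Finset.mul_sum, Finset.sum_mul, trace_sum]
  refine Finset.sum_congr rfl fun i _ => ?_
  rw [← mul_assoc, ← mul_assoc, trace_mul_comm]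
  simp only [mul_assoc]

theorem transpose_contraction (h : IsOrthogonalRep ρ F c u C) {A : Matrix α α ℝ} (hA : Aᵀ = -A) :
    (contraction ρ A)ᵀ = -contraction ρ A := by
  simp only [contraction, transpose_sum, transpose_mul, h.skew, hA, ← Finset.sum_neg_distrib]
  refine Finset.sum_congr rfl fun i _ => ?_
  simp [mul_assoc]

/-- Half of ∑ ‖[ρ_l, X]‖². For the inner product -tr(XY) it says that Φ + C ≥ 0 on skew matrices,
where Φ is `contraction ρ`. -/
theorem casimir_nonneg (h : IsOrthogonalRep ρ F c u C) {X : Matrix α α ℝ} (hX : Xᵀ = -X) :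
    0 ≤ -trace (X * contraction ρ X) - C * trace (X * X) := by
  have h1 : ∀ l, 0 ≤ trace ((ρ l * X - X * ρ l) * (ρ l * X - X * ρ l)ᵀ) := by
    intro l
    simp only [trace, Matrix.diag, mul_apply, transpose_apply]
    exact Finset.sum_nonneg fun a _ => Finset.sum_nonneg fun b _ => mul_self_nonneg _
  have h2 : ∀ l, trace ((ρ l * X - X * ρ l) * (ρ l * X - X * ρ l)ᵀ) =
      -2 * trace (X * (ρ l * X * ρ l)) + 2 * trace (ρ l * ρ l * (X * X)) := by
    intro l
    have e1 : (ρ l * X - X * ρ l)ᵀ = X * ρ l - ρ l * X := by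
      simp [transpose_mul, h.skew, hX]
    rw [e1]
    have e2 : (ρ l * X - X * ρ l) * (X * ρ l - ρ l * X) =
        ρ l * X * X * ρ l - ρ l * X * ρ l * X - X * ρ l * X * ρ l + X * ρ l * ρ l * X := by
      noncomm_ring
    have e3 : trace (ρ l * X * X * ρ l) = trace (ρ l * ρ l * (X * X)) := by
      rw [trace_mul_comm]; simp only [mul_assoc]
    have e4 : trace (ρ l * X * ρ l * X) = trace (X * (ρ l * X * ρ l)) := by
      rw [trace_mul_comm]
    have e5 : trace (X * ρ l * ρ l * X) = trace (ρ l * ρ l * (X * X)) := by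
      rw [trace_mul_comm, mul_assoc X (ρ l), ← mul_assoc X X, trace_mul_comm]
    have e6 : trace (X * ρ l * X * ρ l) = trace (X * (ρ l * X * ρ l)) := by
      simp only [mul_assoc]
    rw [e2, trace_add, trace_sub, trace_sub, e3, e4, e5, e6]
    ring
  have h3 : 0 ≤ ∑ l, (-2 * trace (X * (ρ l * X * ρ l)) + 2 * trace (ρ l * ρ l * (X * X))) :=
    Finset.sum_nonneg fun l _ => (h2 l) ▸ h1 l
  rw [Finset.sum_add_distrib, ← Finset.mul_sum, ← Finset.mul_sum, ← trace_sum, ← trace_sum,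
    ← Finset.sum_mul, h.casimir, ← Finset.mul_sum] at h3
  rw [contraction]
  simp only [neg_smul, neg_mul, smul_mul_assoc, one_mul, trace_neg, trace_smul, smul_eq_mul] at h3
  linarith

/-- `casimir_nonneg` for X = Φ(A + N/u), where A + N/u is the component of A orthogonal to the span
of the ρ_i. Removing that span produces the term -ce²/2 on which `casimir_lt` depends. -/
theorem casimir_nonneg_corrected (h : IsOrthogonalRep ρ F c u C) (hu : 0 < u)
    {A : Matrix α α ℝ} (hA : Aᵀ = -A) :
    0 ≤ -(trace (contraction ρ A * contraction ρ (contraction ρ A)) +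
        (c / 2 - C) ^ 3 / u * ∑ i, trace (A * ρ i) ^ 2) -
      C * (trace (contraction ρ A * contraction ρ A) +
        (c / 2 - C) ^ 2 / u * ∑ i, trace (A * ρ i) ^ 2) := by
  set e := c / 2 - C with he
  set t : κ → ℝ := fun i => trace (A * ρ i) with ht
  set N : Matrix α α ℝ := ∑ i, t i • ρ i with hN
  have hΦN : contraction ρ N = e • N := by
    simp_rw [hN, contraction_sum, contraction_smul, h.contraction_rep, Finset.smul_sum]
    exact Finset.sum_congr rfl fun i _ => smul_comm _ _ _
  have hNT : Nᵀ = -N := by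
    simp [hN, transpose_sum, h.skew]
  have hXT : (contraction ρ A + (e / u) • N)ᵀ = -(contraction ρ A + (e / u) • N) := by
    rw [transpose_add, transpose_smul, hNT, h.transpose_contraction hA, smul_neg, neg_add]
  have htr : ∀ B, trace (B * N) = ∑ i, t i * trace (B * ρ i) := by
    intro B
    simp [hN, Finset.mul_sum, trace_sum]
  have hNN : trace (N * N) = -u * ∑ i, t i ^ 2 := by
    rw [htr, Finset.mul_sum]
    refine Finset.sum_congr rfl fun i _ => ?_
    rw [trace_mul_comm, htr]
    simp [h.trace_mul]
    ring
  have hAN : trace (A * N) = ∑ i, t i ^ 2 := by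
    rw [htr]; simp [ht, sq]
  have hΦAN : trace (contraction ρ A * N) = e * ∑ i, t i ^ 2 := by
    rw [← trace_mul_contraction, hΦN, mul_smul_comm, trace_smul, hAN, smul_eq_mul]
  have hΦΦAN : trace (contraction ρ (contraction ρ A) * N) = e ^ 2 * ∑ i, t i ^ 2 := by
    rw [← trace_mul_contraction, hΦN, mul_smul_comm, trace_smul, hΦAN, smul_eq_mul]
    ring
  have key := h.casimir_nonneg hXT
  have e1 : trace ((contraction ρ A + (e / u) • N) * (contraction ρ A + (e / u) • N)) =
      trace (contraction ρ A * contraction ρ A) + e ^ 2 / u * ∑ i, t i ^ 2 := by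
    simp only [add_mul, mul_add, smul_mul_assoc, mul_smul_comm, trace_add, trace_smul,
      smul_eq_mul, trace_mul_comm N, hΦAN, hNN]
    field_simp
    ring
  have e2 : trace ((contraction ρ A + (e / u) • N) *
      contraction ρ (contraction ρ A + (e / u) • N)) =
      trace (contraction ρ A * contraction ρ (contraction ρ A)) +
        e ^ 3 / u * ∑ i, t i ^ 2 := by
    rw [contraction_add, contraction_smul, hΦN]
    simp only [add_mul, mul_add, smul_mul_assoc, mul_smul_comm, trace_add, trace_smul,
      smul_eq_mul, hΦAN, hNN, trace_mul_comm N, hΦΦAN]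
    field_simp
    ring
  rw [e1, e2] at key
  exact key

/-- The elementary skew-symmetric matrix. -/
def elemSkew (a b : α) : Matrix α α ℝ := single a b 1 - single b a 1

theorem transpose_elemSkew (a b : α) : (elemSkew a b)ᵀ = -elemSkew a b := by
  simp [elemSkew]

theorem trace_single_sandwich (X Y : Matrix α α ℝ) (a b a' b' : α) :
    trace (single a b 1 * X * single a' b' 1 * Y) = X b a' * Y b' a := by
  rw [mul_assoc, mul_assoc, trace_single_mul, one_smul, ← mul_assoc, mul_apply]
  simp [mul_apply, single_apply, ite_and]

/-- A sum of a quadratic form over these matrices is four times its trace over the skew matrices: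
ordered pairs count each one twice, and its squared norm is 2. -/
theorem sum_trace_elemSkew_sandwich (X Y : Matrix α α ℝ) :
    ∑ a, ∑ b, trace (elemSkew a b * X * elemSkew a b * Y) =
      2 * trace (X * Yᵀ) - 2 * (trace X * trace Y) := by
  have h1 : ∀ a b, trace (elemSkew a b * X * elemSkew a b * Y) =
      X b a * Y b a - X b b * Y a a - X a a * Y b b + X a b * Y a b := by
    intro a b
    simp only [elemSkew, sub_mul, mul_sub, trace_sub, trace_single_sandwich]
    ring
  simp_rw [h1, Finset.sum_add_distrib, Finset.sum_sub_distrib]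
  have h2 : trace (X * Yᵀ) = ∑ a, ∑ b, X a b * Y a b := by
    simp [trace, mul_apply]
  have h3 : trace X * trace Y = ∑ a, ∑ b, X a a * Y b b := by
    simp [trace, Finset.sum_mul_sum]
  have h4 : ∑ a, ∑ b, X b a * Y b a = ∑ a, ∑ b, X a b * Y a b := Finset.sum_comm
  have h5 : ∑ a, ∑ b, X b b * Y a a = ∑ a, ∑ b, X a a * Y b b := Finset.sum_comm
  rw [h2, h3, h4, h5]
  ring

omit [DecidableEq α] [DecidableEq κ] in
theorem sum_comm_pair (f : α → α → κ → ℝ) :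
    ∑ a, ∑ b, ∑ i, f a b i = ∑ i, ∑ a, ∑ b, f a b i := by
  rw [Finset.sum_comm]
  simp_rw [Finset.sum_comm (s := (univ : Finset α)) (t := (univ : Finset κ))]
  exact Finset.sum_congr rfl fun i _ => Finset.sum_comm

omit [DecidableEq α] [DecidableEq κ] in
theorem sum_comm_pair₂ (f : α → α → κ → κ → ℝ) :
    ∑ a, ∑ b, ∑ i, ∑ j, f a b i j = ∑ i, ∑ j, ∑ a, ∑ b, f a b i j := by
  rw [sum_comm_pair]
  exact Finset.sum_congr rfl fun i _ => sum_comm_pair _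

omit [DecidableEq α] [DecidableEq κ] in
theorem sum_comm_pair₃ (f : α → α → κ → κ → κ → ℝ) :
    ∑ a, ∑ b, ∑ i, ∑ j, ∑ l, f a b i j l = ∑ i, ∑ j, ∑ l, ∑ a, ∑ b, f a b i j l := by
  rw [sum_comm_pair]
  exact Finset.sum_congr rfl fun i _ => sum_comm_pair₂ _

/-- This is -4 times the trace of Φ² on skew matrices. The sign is that of tr(XY) against the inner
product. -/
theorem sum_trace_contraction_sq (h : IsOrthogonalRep ρ F c u C) :
    ∑ a, ∑ b, trace (contraction ρ (elemSkew a b) * contraction ρ (elemSkew a b)) =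
      -2 * (c / 2 - C) * u * Fintype.card κ - 2 * u ^ 2 * Fintype.card κ := by
  have h1 : ∀ A : Matrix α α ℝ, trace (contraction ρ A * contraction ρ A) =
      ∑ i, ∑ j, trace (A * (ρ i * ρ j) * A * (ρ j * ρ i)) := by
    intro A
    simp only [contraction, Finset.sum_mul_sum, trace_sum]
    refine Finset.sum_congr rfl fun i _ => Finset.sum_congr rfl fun j _ => ?_
    rw [mul_assoc, mul_assoc, trace_mul_comm]
    simp only [mul_assoc]
  simp_rw [h1]
  rw [sum_comm_pair₂]
  simp_rw [sum_trace_elemSkew_sandwich]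
  simp_rw [Finset.sum_sub_distrib, ← Finset.mul_sum]
  have h2 : ∑ i, ∑ j, trace (ρ i * ρ j * (ρ j * ρ i)ᵀ) =
      -(c / 2 - C) * u * Fintype.card κ := by
    rw [Finset.sum_comm]
    have : ∀ j, ∑ i, trace (ρ i * ρ j * (ρ j * ρ i)ᵀ) = -(c / 2 - C) * u := by
      intro j
      have e1 : ∀ i, trace (ρ i * ρ j * (ρ j * ρ i)ᵀ) = trace (ρ i * ρ j * ρ i * ρ j) := by
        intro i
        simp [transpose_mul, h.skew, mul_assoc]
      simp_rw [e1]
      rw [← trace_sum, ← Finset.sum_mul]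
      have := h.contraction_rep j
      rw [contraction] at this
      rw [this, smul_mul_assoc, trace_smul, h.trace_mul]
      simp only [if_true, smul_eq_mul]
      ring
    simp_rw [this]
    rw [Finset.sum_const, Finset.card_univ, nsmul_eq_mul]
    ring
  have h3 : ∑ i, ∑ j, trace (ρ i * ρ j) * trace (ρ j * ρ i) = u ^ 2 * Fintype.card κ := by
    simp [h.trace_mul, sq, mul_comm]
  rw [h2, h3]
  ring

/-- Exchanging the middle factors ρ_lρ_i leaves the trace of Φ(ρ_j)² and a commutator term, in which
Φ(ρ_m) = eρ_m reduces everything to triple traces. -/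
theorem sum_trace_hexagon (h : IsOrthogonalRep ρ F c u C) :
    ∑ i, ∑ j, ∑ l, trace (ρ i * ρ j * ρ l * (ρ i * ρ j * ρ l)) =
      -(c / 2 - C) ^ 2 * u * Fintype.card κ - (c / 2 - C) * u * c * Fintype.card κ / 2 := by
  set e := c / 2 - C with he
  have hΦ : ∀ j, ∑ i, ρ i * ρ j * ρ i = e • ρ j := h.contraction_rep
  have h1 : ∀ i j l, trace (ρ i * ρ j * ρ l * (ρ i * ρ j * ρ l)) =
      trace (ρ i * ρ j * ρ i * (ρ l * ρ j * ρ l)) +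
        ∑ m, F l i m * trace (ρ i * (ρ j * ρ m * ρ j) * ρ l) := by
    intro i j l
    have h2 : ρ l * ρ i = ρ i * ρ l + ∑ m, F l i m • ρ m := by rw [← h.lie]; abel
    have h3 : ρ i * ρ j * ρ l * (ρ i * ρ j * ρ l) = ρ i * ρ j * (ρ l * ρ i) * (ρ j * ρ l) := by
      simp only [mul_assoc]
    rw [h3, h2, mul_add, add_mul, trace_add, Finset.mul_sum, Finset.sum_mul, trace_sum]
    congr 1
    · simp only [mul_assoc]
    · refine Finset.sum_congr rfl fun m _ => ?_
      simp only [mul_smul_comm, smul_mul_assoc, trace_smul, smul_eq_mul, mul_assoc]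
  simp_rw [h1, Finset.sum_add_distrib]
  have p1 : ∑ i, ∑ j, ∑ l, trace (ρ i * ρ j * ρ i * (ρ l * ρ j * ρ l)) =
      -e ^ 2 * u * Fintype.card κ := by
    rw [Finset.sum_comm]
    have : ∀ j, ∑ i, ∑ l, trace (ρ i * ρ j * ρ i * (ρ l * ρ j * ρ l)) = -e ^ 2 * u := by
      intro j
      simp_rw [← trace_sum]
      rw [← Finset.sum_mul_sum, hΦ, smul_mul_assoc, mul_smul_comm, trace_smul, trace_smul,
        h.trace_mul]
      simp only [if_true, smul_eq_mul]
      ring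
    simp [this, mul_comm]
  have p2 : ∑ i, ∑ j, ∑ l, ∑ m, F l i m * trace (ρ i * (ρ j * ρ m * ρ j) * ρ l) =
      -(e * u * c * Fintype.card κ / 2) := by
    have q1 : ∀ i, ∑ j, ∑ l, ∑ m, F l i m * trace (ρ i * (ρ j * ρ m * ρ j) * ρ l) =
        ∑ l, ∑ m, -(e * u / 2) * F i l m ^ 2 := by
      intro i
      rw [Finset.sum_comm]
      refine Finset.sum_congr rfl fun l _ => ?_
      rw [Finset.sum_comm]
      refine Finset.sum_congr rfl fun m _ => ?_
      rw [← Finset.mul_sum, ← trace_sum, ← Finset.sum_mul, ← Finset.mul_sum, hΦ,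
        mul_smul_comm, smul_mul_assoc, trace_smul, h.trace_triple, h.antisymm₁ l i m,
        h.antisymm₂ i m l, smul_eq_mul]
      ring
    simp_rw [q1, ← Finset.mul_sum]
    rw [h.sum_sq_structure]
    ring
  rw [p1, p2]
  ring

theorem sum_trace_contraction_cube (h : IsOrthogonalRep ρ F c u C) :
    ∑ a, ∑ b, trace (contraction ρ (elemSkew a b) *
        contraction ρ (contraction ρ (elemSkew a b))) =
      2 * (c / 2 - C) ^ 2 * u * Fintype.card κ + (c / 2 - C) * u * c * Fintype.card κ +
        u ^ 2 * c * Fintype.card κ / 2 := by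
  have h1 : ∀ A : Matrix α α ℝ, trace (contraction ρ A * contraction ρ (contraction ρ A)) =
      ∑ i, ∑ j, ∑ l, trace (A * (ρ i * ρ j * ρ l) * A * (ρ l * ρ j * ρ i)) := by
    intro A
    have e1 : contraction ρ (contraction ρ A) = ∑ j, ∑ l, ρ j * ρ l * A * (ρ l * ρ j) := by
      simp only [contraction, Finset.mul_sum, Finset.sum_mul]
      refine Finset.sum_congr rfl fun j _ => Finset.sum_congr rfl fun l _ => ?_
      simp only [mul_assoc]
    rw [e1, contraction, Finset.sum_mul, trace_sum]
    refine Finset.sum_congr rfl fun i _ => ?_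
    rw [Finset.mul_sum, trace_sum]
    refine Finset.sum_congr rfl fun j _ => ?_
    rw [Finset.mul_sum, trace_sum]
    refine Finset.sum_congr rfl fun l _ => ?_
    rw [mul_assoc, mul_assoc, trace_mul_comm]
    simp only [mul_assoc]
  simp_rw [h1]
  rw [sum_comm_pair₃]
  simp_rw [sum_trace_elemSkew_sandwich]
  simp_rw [Finset.sum_sub_distrib, ← Finset.mul_sum]
  have h2 : ∑ i, ∑ j, ∑ l, trace (ρ i * ρ j * ρ l * (ρ l * ρ j * ρ i)ᵀ) =
      (c / 2 - C) ^ 2 * u * Fintype.card κ + (c / 2 - C) * u * c * Fintype.card κ / 2 := by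
    have e1 : ∀ i j l, trace (ρ i * ρ j * ρ l * (ρ l * ρ j * ρ i)ᵀ) =
        -trace (ρ i * ρ j * ρ l * (ρ i * ρ j * ρ l)) := by
      intro i j l
      simp [transpose_mul, h.skew, mul_assoc]
    simp_rw [e1, Finset.sum_neg_distrib]
    rw [h.sum_trace_hexagon]
    ring
  have h3 : ∑ i, ∑ j, ∑ l, trace (ρ i * ρ j * ρ l) * trace (ρ l * ρ j * ρ i) =
      -(u ^ 2 / 4) * c * Fintype.card κ := by
    have e1 : ∀ i j l, trace (ρ i * ρ j * ρ l) * trace (ρ l * ρ j * ρ i) =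
        -(u ^ 2 / 4) * F i j l ^ 2 := by
      intro i j l
      rw [h.trace_triple, h.trace_triple, h.antisymm₁ l j i, h.antisymm₂ j l i,
        h.antisymm₁ j i l]
      ring
    simp_rw [e1, ← Finset.mul_sum]
    rw [h.sum_sq_structure]
    ring
  rw [h2, h3]
  ring

theorem sum_trace_elemSkew_sq (h : IsOrthogonalRep ρ F c u C) :
    ∑ a, ∑ b, ∑ i, trace (elemSkew a b * ρ i) ^ 2 = 4 * u * Fintype.card κ := by
  have h1 : ∀ a b i, trace (elemSkew a b * ρ i) ^ 2 = -4 * (ρ i a b * ρ i b a) := by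
    intro a b i
    have hs : ρ i b a = -ρ i a b := by
      have := congrFun (congrFun (h.skew i) a) b
      simpa using this
    simp only [elemSkew, sub_mul, trace_sub, trace_single_mul, one_smul]
    rw [hs]
    simp
    ring
  simp_rw [h1]
  have h2 : ∀ i, ∑ a, ∑ b, ρ i a b * ρ i b a = -u := by
    intro i
    have := h.trace_mul i i
    simpa [trace, mul_apply] using this
  calc _ = ∑ i, ∑ a, ∑ b, -4 * (ρ i a b * ρ i b a) := by
        exact sum_comm_pair _
    _ = _ := by
        simp_rw [← Finset.mul_sum, h2]
        simp
        ring

/-- The Casimir inequality: positivity of the Casimir operator on skew-symmetric matrices forces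
`c - 2 C < u`. -/
theorem casimir_lt [Nonempty κ] (h : IsOrthogonalRep ρ F c u C) (hu : 0 < u) (hc : 0 < c) :
    c - 2 * C < u := by
  by_contra hcon
  push Not at hcon
  -- Four times the trace of Φ²(Φ + C) over the skew matrices orthogonal to all ρ_i.
  have h1 : 0 ≤ ∑ a, ∑ b, (-(trace (contraction ρ (elemSkew a b) *
        contraction ρ (contraction ρ (elemSkew a b))) +
        (c / 2 - C) ^ 3 / u * ∑ i, trace (elemSkew a b * ρ i) ^ 2) -
      C * (trace (contraction ρ (elemSkew a b) * contraction ρ (elemSkew a b)) +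
        (c / 2 - C) ^ 2 / u * ∑ i, trace (elemSkew a b * ρ i) ^ 2)) :=
    Finset.sum_nonneg fun a _ => Finset.sum_nonneg fun b _ =>
      h.casimir_nonneg_corrected hu (transpose_elemSkew a b)
  simp only [Finset.sum_sub_distrib, Finset.sum_neg_distrib, ← Finset.mul_sum,
    Finset.sum_add_distrib, h.sum_trace_contraction_sq, h.sum_trace_contraction_cube,
    h.sum_trace_elemSkew_sq] at h1
  set e := c / 2 - C with he
  have hC : C = c / 2 - e := by rw [he]; ring
  have hk : (0 : ℝ) < Fintype.card κ := by exact_mod_cast Fintype.card_pos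
  have h2 : 0 ≤ (u ^ 2 * c / 8 - u * e ^ 2 - c * e ^ 2 / 2 - e * u ^ 2 / 2) *
      (4 * Fintype.card κ) := by
    refine h1.trans (le_of_eq ?_)
    rw [hC]
    field_simp
    ring
  have h3 : 0 ≤ u ^ 2 * c / 8 - u * e ^ 2 - c * e ^ 2 / 2 - e * u ^ 2 / 2 :=
    nonneg_of_mul_nonneg_left h2 (by positivity)
  -- Now ce²/2 ≥ cu²/8 absorbs the only positive term, while -ue² ≤ 0 and -eu²/2 < 0.
  have he2 : u / 2 ≤ e := by rw [he]; linarith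
  nlinarith [mul_pos hu hu, mul_pos hu hc, mul_nonneg hc.le (sub_nonneg.mpr he2),
    mul_nonneg (mul_nonneg hc.le (sub_nonneg.mpr he2)) (by linarith : 0 ≤ e + u / 2),
    mul_pos (mul_pos hu hu) (by linarith : 0 < e), mul_nonneg hu.le (sq_nonneg e)]

end IsOrthogonalRep
end MatrixRep

end

noncomputable section

open Finset

namespace LeftInvariant

/-! ### Curvature of diagonal metrics in a Killing-orthonormal basis. -/

section Orthonormal

variable {𝔤 : Type*} [LieRing 𝔤] [LieAlgebra ℝ 𝔤] [FiniteDimensional ℝ 𝔤]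
  {ι : Type*} [Fintype ι] [DecidableEq ι]

/-- A basis orthonormal for minus the Killing form. -/
def IsKillingOrthonormal (e : Module.Basis ι ℝ 𝔤) : Prop :=
  ∀ i j, killingForm ℝ 𝔤 (e i) (e j) = if i = j then -1 else 0

/-- The structure constants of a basis with respect to minus the Killing form. -/
def structureConst (e : Module.Basis ι ℝ 𝔤) (i j m : ι) : ℝ := -killingForm ℝ 𝔤 ⁅e i, e j⁆ (e m)

theorem killingForm_lie_left (x y z : 𝔤) :
    killingForm ℝ 𝔤 ⁅x, y⁆ z = killingForm ℝ 𝔤 x ⁅y, z⁆ :=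
  LieModule.traceForm_apply_lie_apply ℝ 𝔤 𝔤 x y z

theorem killingForm_comm (x y : 𝔤) : killingForm ℝ 𝔤 x y = killingForm ℝ 𝔤 y x :=
  LieModule.traceForm_comm ℝ 𝔤 𝔤 x y

theorem killingForm_lie_add (x y z : 𝔤) :
    killingForm ℝ 𝔤 ⁅x, y⁆ z + killingForm ℝ 𝔤 y ⁅x, z⁆ = 0 := by
  rw [← lie_skew x y, map_neg, LinearMap.neg_apply, killingForm_lie_left]
  ring

variable {e : Module.Basis ι ℝ 𝔤}

theorem structureConst_antisymm₁ (i j m : ι) :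
    structureConst e i j m = -structureConst e j i m := by
  rw [structureConst, structureConst, ← lie_skew, map_neg, LinearMap.neg_apply]

theorem structureConst_antisymm₂ (i j m : ι) :
    structureConst e i j m = -structureConst e i m j := by
  have h := killingForm_lie_add (e i) (e j) (e m)
  rw [killingForm_comm (e j)] at h
  rw [structureConst, structureConst]
  linarith

theorem structureConst_cyclic (i j m : ι) :
    structureConst e i j m = structureConst e j m i := by
  rw [structureConst_antisymm₁ i j m, structureConst_antisymm₂ j i m, neg_neg]

theorem structureConst_self (i m : ι) : structureConst e i i m = 0 := by
  simp [structureConst]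

namespace IsKillingOrthonormal

theorem repr_eq (he : IsKillingOrthonormal e) (v : 𝔤) (i : ι) :
    e.repr v i = -killingForm ℝ 𝔤 v (e i) := by
  have h := congrArg (fun w => killingForm ℝ 𝔤 w (e i)) (e.sum_repr v)
  simp only [map_sum, LinearMap.sum_apply, map_smul, LinearMap.smul_apply, he _ _, smul_eq_mul,
    mul_ite, mul_neg, mul_one, mul_zero, Finset.sum_ite_eq', Finset.mem_univ, if_true] at h
  rw [← h, neg_neg]

theorem lie_eq (he : IsKillingOrthonormal e) (i j : ι) :
    ⁅e i, e j⁆ = ∑ m, structureConst e i j m • e m := by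
  rw [← e.sum_repr ⁅e i, e j⁆]
  simp_rw [he.repr_eq]
  rfl

theorem eq_sum (he : IsKillingOrthonormal e) (v : 𝔤) :
    v = ∑ m, (-killingForm ℝ 𝔤 v (e m)) • e m := by
  conv_lhs => rw [← e.sum_repr v]
  simp_rw [he.repr_eq]

theorem trace_eq (he : IsKillingOrthonormal e) (A : 𝔤 →ₗ[ℝ] 𝔤) :
    LinearMap.trace ℝ 𝔤 A = -∑ i, killingForm ℝ 𝔤 (A (e i)) (e i) := by
  rw [LinearMap.trace_eq_matrix_trace ℝ e, Matrix.trace]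
  simp [LinearMap.toMatrix_apply, he.repr_eq]

theorem killingForm_lie_lie (he : IsKillingOrthonormal e) (i j i' j' : ι) :
    killingForm ℝ 𝔤 ⁅e i, e j⁆ ⁅e i', e j'⁆ =
      -∑ m, structureConst e i j m * structureConst e i' j' m := by
  rw [he.lie_eq i' j', map_sum, ← Finset.sum_neg_distrib]
  refine Finset.sum_congr rfl fun m _ => ?_
  have h : structureConst e i j m = -killingForm ℝ 𝔤 ⁅e i, e j⁆ (e m) := rfl
  rw [map_smul, smul_eq_mul, h]
  ring

/-- The Killing form is the trace of ad ∘ ad, here evaluated in a basis orthonormal for its own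
negative. -/
theorem sum_structureConst_mul (he : IsKillingOrthonormal e) (i i' : ι) :
    ∑ j, ∑ m, structureConst e i j m * structureConst e i' j m = if i = i' then 1 else 0 := by
  have h1 := he i i'
  rw [killingForm_apply_apply, he.trace_eq] at h1
  have h2 : ∀ j, killingForm ℝ 𝔤 ((LieAlgebra.ad ℝ 𝔤 (e i) ∘ₗ LieAlgebra.ad ℝ 𝔤 (e i')) (e j))
      (e j) = ∑ m, structureConst e i j m * structureConst e i' j m := by
    intro j
    have h3 := killingForm_lie_add (e i) ⁅e i', e j⁆ (e j)
    rw [killingForm_comm ⁅e i', e j⁆, he.killingForm_lie_lie] at h3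
    simp only [LinearMap.comp_apply, LieAlgebra.ad_apply]
    linarith
  simp_rw [h2] at h1
  split_ifs at h1 ⊢ <;> linarith

end IsKillingOrthonormal

/-- `g` is diagonal in the basis `e` with positive entries `x`. -/
structure IsDiagonalMetric (e : Module.Basis ι ℝ 𝔤) (g : LinearMap.BilinForm ℝ 𝔤) (x : ι → ℝ) :
    Prop where
  apply : ∀ i j, g (e i) (e j) = if i = j then x i else 0
  pos : ∀ i, 0 < x i

theorem bilin_eq_sum (e : Module.Basis ι ℝ 𝔤) {T : LinearMap.BilinForm ℝ 𝔤} {τ : ι → ℝ}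
    (hT : ∀ i j, T (e i) (e j) = if i = j then τ i else 0) (v w : 𝔤) :
    T v w = ∑ i, τ i * (e.repr v i * e.repr w i) := by
  conv_lhs => rw [← e.sum_repr v, ← e.sum_repr w]
  simp only [map_sum, LinearMap.sum_apply, map_smul, LinearMap.smul_apply, hT, smul_eq_mul]
  simp
  exact Finset.sum_congr rfl fun i _ => by ring

namespace IsDiagonalMetric

variable {g : LinearMap.BilinForm ℝ 𝔤} {x : ι → ℝ}

theorem isMetric (hg : IsDiagonalMetric e g x) : IsMetric g where
  symm v w := by
    rw [bilin_eq_sum e hg.apply, bilin_eq_sum e hg.apply]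
    exact Finset.sum_congr rfl fun i _ => by ring
  pos v hv := by
    rw [bilin_eq_sum e hg.apply]
    obtain ⟨i, hi⟩ : ∃ i, e.repr v i ≠ 0 := by
      by_contra h
      push Not at h
      apply hv
      rw [← e.sum_repr v]
      simp [h]
    exact Finset.sum_pos' (fun i _ => mul_nonneg (hg.pos i).le (mul_self_nonneg _))
      ⟨i, Finset.mem_univ i, mul_pos (hg.pos i) (mul_self_pos.mpr hi)⟩

theorem repr_eq (hg : IsDiagonalMetric e g x) (v : 𝔤) (i : ι) :
    e.repr v i = g v (e i) / x i := by
  have h : g v (e i) = e.repr v i * x i := by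
    have h := congrArg (fun w => g w (e i)) (e.sum_repr v)
    simp only [map_sum, LinearMap.sum_apply, map_smul, LinearMap.smul_apply, hg.apply,
      smul_eq_mul, mul_ite, mul_zero, Finset.sum_ite_eq', Finset.mem_univ, if_true] at h
    exact h.symm
  rw [h, mul_div_cancel_right₀ _ (hg.pos i).ne']

theorem metricTrace_eq (hg : IsDiagonalMetric e g x) (T : LinearMap.BilinForm ℝ 𝔤) :
    metricTrace g T = ∑ i, T (e i) (e i) / x i := by
  rw [metricTrace, LinearMap.trace_eq_matrix_trace ℝ e, Matrix.trace]
  refine Finset.sum_congr rfl fun i _ => ?_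
  rw [Matrix.diag, LinearMap.toMatrix_apply, hg.repr_eq, sharp_spec hg.isMetric]

theorem metricDet_eq (hg : IsDiagonalMetric e g x) {T : LinearMap.BilinForm ℝ 𝔤} {τ : ι → ℝ}
    (hT : ∀ i j, T (e i) (e j) = if i = j then τ i else 0) :
    metricDet g T = ∏ i, τ i / x i := by
  rw [metricDet, ← LinearMap.det_toMatrix e]
  have h : LinearMap.toMatrix e e (sharp g T) = Matrix.diagonal fun i => τ i / x i := by
    ext i j
    rw [LinearMap.toMatrix_apply, hg.repr_eq, sharp_spec hg.isMetric, hT, Matrix.diagonal_apply]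
    by_cases hij : i = j
    · simp [hij]
    · simp [hij, Ne.symm hij]
  rw [h, Matrix.det_diagonal]

/-- In Koszul's formula the cyclic symmetry turns the three structure constants into one, so only
their weights differ. -/
theorem repr_leviCivita (he : IsKillingOrthonormal e) (hg : IsDiagonalMetric e g x) (i j m : ι) :
    e.repr (leviCivita g (e i) (e j)) m =
      structureConst e i j m * (x m - x i + x j) / (2 * x m) := by
  have hlie : ∀ i j m, g ⁅e i, e j⁆ (e m) = structureConst e i j m * x m := by
    intro i j m
    rw [he.lie_eq]
    simp [map_sum, LinearMap.sum_apply, hg.apply]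
  have h := koszul hg.isMetric (e i) (e j) (e m)
  have c1 : structureConst e j m i = structureConst e i j m := (structureConst_cyclic i j m).symm
  have c2 : structureConst e m i j = structureConst e i j m := structureConst_cyclic m i j
  rw [hlie, hlie, hlie, c1, c2] at h
  have hx := (hg.pos m).ne'
  rw [hg.repr_eq]
  field_simp
  linarith

theorem leviCivita_eq (he : IsKillingOrthonormal e) (hg : IsDiagonalMetric e g x) (i j : ι) :
    leviCivita g (e i) (e j) =
      ∑ m, (structureConst e i j m * (x m - x i + x j) / (2 * x m)) • e m := by
  conv_lhs => rw [← e.sum_repr (leviCivita g (e i) (e j))]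
  simp_rw [hg.repr_leviCivita he]

/-- The Ricci tensor of a diagonal metric. -/
theorem ricci_eq (he : IsKillingOrthonormal e) (hg : IsDiagonalMetric e g x) (j l : ι) :
    ricci g (e j) (e l) = ∑ i, ∑ m, structureConst e j i m * structureConst e l i m *
      ((x i - x m + x l) / (2 * x i) -
        (x m - x i + x l) * (x i - x j + x m) / (4 * (x m * x i))) := by
  have h0 : ricci g (e j) (e l) = LinearMap.trace ℝ 𝔤 (curvature g (e j) (e l)) := rfl
  rw [h0, LinearMap.trace_eq_matrix_trace ℝ e, Matrix.trace]
  refine Finset.sum_congr rfl fun i _ => ?_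
  rw [Matrix.diag, LinearMap.toMatrix_apply]
  have h1 : curvature g (e j) (e l) (e i) = leviCivita g (e i) (leviCivita g (e j) (e l)) -
      leviCivita g (e j) (leviCivita g (e i) (e l)) - leviCivita g ⁅e i, e j⁆ (e l) := rfl
  rw [h1, hg.leviCivita_eq he j l, hg.leviCivita_eq he i l, he.lie_eq i j]
  simp only [map_sum, map_smul, map_sub, LinearMap.sum_apply, LinearMap.smul_apply,
    Finsupp.coe_sub, Pi.sub_apply, Finsupp.coe_finsetSum, Finset.sum_apply, Finsupp.coe_smul,
    Pi.smul_apply, smul_eq_mul, hg.repr_leviCivita he]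
  rw [← Finset.sum_sub_distrib, ← Finset.sum_sub_distrib]
  refine Finset.sum_congr rfl fun m _ => ?_
  have hxi := (hg.pos i).ne'
  have hxm := (hg.pos m).ne'
  have e1 : structureConst e i m i = 0 := by
    rw [structureConst_antisymm₂ i m i, structureConst_self, neg_zero]
  have e2 : structureConst e i l m = -structureConst e l i m := structureConst_antisymm₁ _ _ _
  have e3 : structureConst e j m i = -structureConst e j i m := structureConst_antisymm₂ _ _ _
  have e4 : structureConst e i j m = -structureConst e j i m := structureConst_antisymm₁ _ _ _
  have e5 : structureConst e m l i = structureConst e l i m := structureConst_cyclic _ _ _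
  rw [e1, e2, e3, e4, e5]
  field_simp
  ring

theorem scalarCurvature_eq (hg : IsDiagonalMetric e g x) :
    scalarCurvature g = ∑ j, ricci g (e j) (e j) / x j :=
  hg.metricTrace_eq _

/-- Every term carries a structure constant with a repeated index. For forms diagonal in the same
frame as g, the TT condition is therefore just trace-freeness. -/
theorem divergence_eq_zero (he : IsKillingOrthonormal e) (hg : IsDiagonalMetric e g x)
    {T : LinearMap.BilinForm ℝ 𝔤} {τ : ι → ℝ}
    (hT : ∀ i j, T (e i) (e j) = if i = j then τ i else 0) (X : 𝔤) : divergence g T X = 0 := by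
  rw [divergence, hg.metricTrace_eq, neg_eq_zero]
  refine Finset.sum_eq_zero fun i _ => ?_
  have h1 : covariantDerivative g T X (e i) (e i) =
      -T (leviCivita g (e i) (e i)) X - T (e i) (leviCivita g (e i) X) := rfl
  have h2 : leviCivita g (e i) (e i) = 0 := by
    rw [hg.leviCivita_eq he]
    simp [structureConst_self]
  have h3 : T (e i) (leviCivita g (e i) X) = 0 := by
    rw [← e.sum_repr X]
    simp only [map_sum, map_smul]
    refine Finset.sum_eq_zero fun j _ => ?_
    rw [hg.leviCivita_eq he]
    have e1 : structureConst e i j i = 0 := by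
      rw [structureConst_antisymm₂ i j i, structureConst_self, neg_zero]
    simp [map_sum, hT, e1]
  rw [h1, h2, h3]
  simp

end IsDiagonalMetric

end Orthonormal

end LeftInvariant

namespace LeftInvariant

/-! ### Structure constants in a frame adapted to 𝔞 ⊕ 𝔨. -/

section Frame

open Sum

variable {𝔤 : Type*} [LieRing 𝔤] [LieAlgebra ℝ 𝔤] [FiniteDimensional ℝ 𝔤]
  {α κ : Type*} [Fintype α] [DecidableEq α] [Fintype κ] [DecidableEq κ]

/-- A Killing-orthonormal basis `e` adapted to a decomposition `𝔤 = 𝔞 ⊕ 𝔨`, where `𝔨` (with basis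
indexed by `κ`) is a subalgebra whose Killing form is `c` times that of `𝔤` and whose Casimir
operator acts on `𝔞` (with basis indexed by `α`) as `-C`. -/
structure IsIsotropyFrame (e : Module.Basis (α ⊕ κ) ℝ 𝔤) (c C : ℝ) : Prop where
  orthonormal : IsKillingOrthonormal e
  subalgebra : ∀ z w a, structureConst e (inr z) (inr w) (inl a) = 0
  killing : ∀ z z', ∑ w, ∑ v, structureConst e (inr z) (inr w) (inr v) *
    structureConst e (inr z') (inr w) (inr v) = if z = z' then c else 0
  casimir : ∀ a a', ∑ z, ∑ b, structureConst e (inr z) (inl a) (inl b) *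
    structureConst e (inr z) (inl a') (inl b) = if a = a' then C else 0

namespace IsIsotropyFrame

variable {e : Module.Basis (α ⊕ κ) ℝ 𝔤} {c C : ℝ}

theorem inr_inl_inr (he : IsIsotropyFrame e c C) (z : κ) (a : α) (w : κ) :
    structureConst e (inr z) (inl a) (inr w) = 0 := by
  rw [structureConst_antisymm₂, he.subalgebra, neg_zero]

theorem inl_inr_inr (he : IsIsotropyFrame e c C) (a : α) (z w : κ) :
    structureConst e (inl a) (inr z) (inr w) = 0 := by
  rw [structureConst_antisymm₁, he.inr_inl_inr, neg_zero]

/-- On 𝔨 the form B is the sum of the Killing form of 𝔨, which contributes c, and the trace form of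
𝔨 on 𝔞. -/
theorem sum_inr (he : IsIsotropyFrame e c C) (z z' : κ) :
    ∑ a, ∑ b, structureConst e (inr z) (inl a) (inl b) *
      structureConst e (inr z') (inl a) (inl b) = if z = z' then 1 - c else 0 := by
  have h := he.orthonormal.sum_structureConst_mul (inr z) (inr z')
  simp only [Fintype.sum_sum_type, he.subalgebra, he.inr_inl_inr, mul_zero, Finset.sum_const_zero,
    zero_add, add_zero, he.killing, inr.injEq] at h
  split_ifs at h ⊢ <;> linarith

theorem casimir' (he : IsIsotropyFrame e c C) (a a' : α) :
    ∑ b, ∑ z, structureConst e (inl a) (inl b) (inr z) *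
      structureConst e (inl a') (inl b) (inr z) = if a = a' then C else 0 := by
  rw [← he.casimir, Finset.sum_comm]
  refine Finset.sum_congr rfl fun z _ => Finset.sum_congr rfl fun b _ => ?_
  rw [← structureConst_cyclic (inr z), ← structureConst_cyclic (inr z)]

theorem casimir'' (he : IsIsotropyFrame e c C) (a a' : α) :
    ∑ z, ∑ b, structureConst e (inl a) (inr z) (inl b) *
      structureConst e (inl a') (inr z) (inl b) = if a = a' then C else 0 := by
  rw [← he.casimir]
  refine Finset.sum_congr rfl fun z _ => Finset.sum_congr rfl fun b _ => ?_
  rw [structureConst_antisymm₁ (inl a), structureConst_antisymm₁ (inl a'), neg_mul_neg]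

/-- Of the total 1, the index pairs in 𝔞 × 𝔨 and in 𝔨 × 𝔞 each take C. -/
theorem sum_inl (he : IsIsotropyFrame e c C) (a a' : α) :
    ∑ b, ∑ b', structureConst e (inl a) (inl b) (inl b') *
      structureConst e (inl a') (inl b) (inl b') = if a = a' then 1 - 2 * C else 0 := by
  have h := he.orthonormal.sum_structureConst_mul (inl a) (inl a')
  simp only [Fintype.sum_sum_type, he.inl_inr_inr, mul_zero, Finset.sum_const_zero,
    add_zero, Finset.sum_add_distrib, he.casimir', he.casimir'', inl.injEq] at h
  split_ifs at h ⊢ <;> linarith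

theorem sum_inl_inr (he : IsIsotropyFrame e c C) (a : α) (z : κ) :
    ∑ b, ∑ b', structureConst e (inl a) (inl b) (inl b') *
      structureConst e (inr z) (inl b) (inl b') = 0 := by
  have h := he.orthonormal.sum_structureConst_mul (inl a) (inr z)
  simpa only [Fintype.sum_sum_type, he.inl_inr_inr, he.inr_inl_inr, he.subalgebra, mul_zero,
    zero_mul, Finset.sum_const_zero, add_zero, reduceCtorEq, if_false] using h

/-- The trace of the Casimir on 𝔞, summed first over 𝔞 and then over 𝔨. -/
theorem card_mul_casimir (he : IsIsotropyFrame e c C) :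
    (Fintype.card α : ℝ) * C = Fintype.card κ * (1 - c) := by
  have h1 : ∑ a : α, ∑ z : κ, ∑ b, structureConst e (inr z) (inl a) (inl b) *
      structureConst e (inr z) (inl a) (inl b) = Fintype.card α * C := by
    simp [he.casimir]
  have h2 : ∑ z : κ, ∑ a : α, ∑ b, structureConst e (inr z) (inl a) (inl b) *
      structureConst e (inr z) (inl a) (inl b) = Fintype.card κ * (1 - c) := by
    simp only [he.sum_inr]
    simp [mul_sub]
  rw [← h1, ← h2, Finset.sum_comm]

/-- The Jacobi identity in terms of structure constants. -/
theorem _root_.LeftInvariant.IsKillingOrthonormal.jacobi {ι : Type*} [Fintype ι] [DecidableEq ι]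
    {e : Module.Basis ι ℝ 𝔤} (he : IsKillingOrthonormal e) (i j l m : ι) :
    ∑ n, structureConst e i j n * structureConst e n l m =
      ∑ n, structureConst e j l n * structureConst e i n m -
        ∑ n, structureConst e i l n * structureConst e j n m := by
  have h := congrArg (fun v => -killingForm ℝ 𝔤 v (e m)) (lie_lie (e i) (e j) (e l))
  rw [he.lie_eq i j, he.lie_eq j l, he.lie_eq i l] at h
  simp only [sum_lie, lie_sum, smul_lie, lie_smul, map_sum, map_sub, LinearMap.sub_apply, map_smul,
    LinearMap.sum_apply, LinearMap.smul_apply, smul_eq_mul, neg_sub] at h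
  simp only [structureConst, mul_neg, neg_mul, Finset.sum_neg_distrib, neg_neg] at h ⊢
  linarith

/-- The matrices are those of ad(e_z) on 𝔞. The trace constant u = 1 - c comes from `sum_inr`. -/
theorem isOrthogonalRep (he : IsIsotropyFrame e c C) :
    IsOrthogonalRep (fun z : κ => Matrix.of fun b a : α => structureConst e (inr z) (inl a) (inl b))
      (fun z w v : κ => structureConst e (inr z) (inr w) (inr v)) c (1 - c) C where
  skew z := by
    ext a b
    simp [structureConst_antisymm₂ (inr z) (inl a) (inl b)]
  lie z w := by
    ext b a
    have h := he.orthonormal.jacobi (inr z) (inr w) (inl a) (inl b)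
    simp only [Fintype.sum_sum_type, he.subalgebra, he.inr_inl_inr, zero_mul,
      Finset.sum_const_zero, zero_add, add_zero] at h
    simp only [Matrix.sub_apply, Matrix.mul_apply, Matrix.of_apply, Matrix.sum_apply,
      Matrix.smul_apply, smul_eq_mul]
    rw [h]
    congr 1 <;> exact Finset.sum_congr rfl fun _ _ => mul_comm _ _
  antisymm₁ z w v := structureConst_antisymm₁ _ _ _
  antisymm₂ z w v := structureConst_antisymm₂ _ _ _
  casimir_adjoint z z' := by
    rw [← he.killing, Finset.sum_comm]
    rw [Finset.sum_comm]
    refine Finset.sum_congr rfl fun w _ => Finset.sum_congr rfl fun v _ => ?_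
    rw [← structureConst_cyclic (inr z), ← structureConst_cyclic (inr z')]
  trace_mul z w := by
    simp only [Matrix.trace, Matrix.diag, Matrix.mul_apply, Matrix.of_apply]
    have h := he.sum_inr z w
    rw [Finset.sum_comm] at h
    have h2 : ∑ b, ∑ a, structureConst e (inr z) (inl a) (inl b) *
        structureConst e (inr w) (inl b) (inl a) = -∑ b, ∑ a,
        structureConst e (inr z) (inl a) (inl b) * structureConst e (inr w) (inl a) (inl b) := by
      simp only [← Finset.sum_neg_distrib]
      refine Finset.sum_congr rfl fun b _ => Finset.sum_congr rfl fun a _ => ?_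
      rw [structureConst_antisymm₂ (inr w) (inl b), mul_neg]
    rw [h2, h]
    split_ifs <;> simp
  casimir := by
    ext a a'
    simp only [Matrix.sum_apply, Matrix.mul_apply, Matrix.of_apply, Matrix.smul_apply,
      Matrix.one_apply, smul_eq_mul, mul_ite, mul_one, mul_zero]
    have h2 : ∑ z, ∑ b, structureConst e (inr z) (inl b) (inl a) *
        structureConst e (inr z) (inl a') (inl b) = -∑ z, ∑ b,
        structureConst e (inr z) (inl a) (inl b) * structureConst e (inr z) (inl a') (inl b) := by
      simp only [← Finset.sum_neg_distrib]
      refine Finset.sum_congr rfl fun b _ => Finset.sum_congr rfl fun b _ => ?_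
      rw [structureConst_antisymm₂ (inr _) (inl b) (inl a), neg_mul]
    rw [h2, he.casimir]
    split_ifs <;> simp

/-- This is t_E < 1. By `card_mul_casimir` it is the Casimir inequality multiplied by d. -/
theorem lt_of_card (he : IsIsotropyFrame e c C) [Nonempty κ] [Nonempty α] (hc : 0 < c)
    (hc1 : c < 1) : (Fintype.card α : ℝ) * c <
      (Fintype.card α + 2 * Fintype.card κ) * (1 - c) := by
  have h := he.isOrthogonalRep.casimir_lt (by linarith) hc
  have h2 := he.card_mul_casimir
  have h3 : (0 : ℝ) < Fintype.card α := by exact_mod_cast Fintype.card_pos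
  nlinarith [mul_lt_mul_of_pos_left h h3]

end IsIsotropyFrame

/-- A metric which is a multiple of the Killing form on `𝔞` and diagonal on `𝔨`, with equal entries
on elements of the frame of `𝔨` which are linked by a nonzero structure constant. -/
structure IsBlockForm (e : Module.Basis (α ⊕ κ) ℝ 𝔤) (T : LinearMap.BilinForm ℝ 𝔤) (x₀ : ℝ)
    (x : κ → ℝ) : Prop where
  apply : ∀ i j, T (e i) (e j) = if i = j then Sum.elim (fun _ => x₀) x i else 0
  linked : ∀ z w v, structureConst e (inr z) (inr w) (inr v) ≠ 0 → x w = x v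

namespace IsBlockForm

variable {e : Module.Basis (α ⊕ κ) ℝ 𝔤} {c C : ℝ} {g : LinearMap.BilinForm ℝ 𝔤} {x₀ : ℝ}
  {x : κ → ℝ}

theorem isDiagonalMetric (hg : IsBlockForm e g x₀ x) (h₀ : 0 < x₀) (hx : ∀ z, 0 < x z) :
    IsDiagonalMetric e g (Sum.elim (fun _ => x₀) x) where
  apply := hg.apply
  pos i := by cases i <;> simp [h₀, hx]

end IsBlockForm

/-- The scalar curvature of a diagonal metric. -/
theorem IsDiagonalMetric.scalarCurvature_eq_sum {ι : Type*} [Fintype ι] [DecidableEq ι]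
    {e : Module.Basis ι ℝ 𝔤} {g : LinearMap.BilinForm ℝ 𝔤} {x : ι → ℝ}
    (he : IsKillingOrthonormal e) (hg : IsDiagonalMetric e g x) :
    scalarCurvature g = 1 / 2 * ∑ j, (x j)⁻¹ -
      1 / 4 * ∑ j, ∑ i, ∑ m, structureConst e j i m ^ 2 * (x m / (x i * x j)) := by
  -- F² is cyclically symmetric, so the weights may be rotated. The six sums of `hterm` then
  -- collapse to two, with coefficients 1/2 + 1/2 - 1/2 and -3/4 + 1/4 + 1/4.
  have cyc : ∀ w : ι → ι → ι → ℝ, ∑ j, ∑ i, ∑ m, structureConst e j i m ^ 2 * w i m j =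
      ∑ j, ∑ i, ∑ m, structureConst e j i m ^ 2 * w j i m := by
    intro w
    have h1 : ∀ F : ι → ι → ι → ℝ, ∑ j, ∑ i, ∑ m, F i m j = ∑ j, ∑ i, ∑ m, F j i m := by
      intro F
      rw [Finset.sum_comm]
      exact Finset.sum_congr rfl fun i _ => Finset.sum_comm
    refine Eq.trans ?_ (h1 fun j i m => structureConst e j i m ^ 2 * w j i m)
    refine Finset.sum_congr rfl fun j _ => Finset.sum_congr rfl fun i _ =>
      Finset.sum_congr rfl fun m _ => ?_
    rw [structureConst_cyclic]
  have k1 : ∑ j, ∑ i, ∑ m, structureConst e j i m ^ 2 * (x j)⁻¹ = ∑ j, (x j)⁻¹ := by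
    refine Finset.sum_congr rfl fun j _ => ?_
    have h := he.sum_structureConst_mul j j
    simp only [← Finset.sum_mul, ← sq, if_true] at h ⊢
    rw [h, one_mul]
  have k2 := cyc fun j _ _ => (x j)⁻¹
  have k3 := cyc fun _ j _ => (x j)⁻¹
  have k4 := cyc fun j i m => x m / (x i * x j)
  have k5 := cyc fun j i m => x j / (x m * x i)
  have hterm : ∀ j, ricci g (e j) (e j) / x j = ∑ i, ∑ m, (1 / 2 *
      (structureConst e j i m ^ 2 * (x j)⁻¹) + 1 / 2 * (structureConst e j i m ^ 2 * (x i)⁻¹) -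
      1 / 2 * (structureConst e j i m ^ 2 * (x m)⁻¹) -
      3 / 4 * (structureConst e j i m ^ 2 * (x m / (x i * x j))) +
      1 / 4 * (structureConst e j i m ^ 2 * (x i / (x j * x m))) +
      1 / 4 * (structureConst e j i m ^ 2 * (x j / (x m * x i)))) := by
    intro j
    rw [hg.ricci_eq he, Finset.sum_div]
    refine Finset.sum_congr rfl fun i _ => ?_
    rw [Finset.sum_div]
    refine Finset.sum_congr rfl fun m _ => ?_
    have h1 := (hg.pos i).ne'
    have h2 := (hg.pos j).ne'
    have h3 := (hg.pos m).ne'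
    field_simp
    ring
  rw [hg.scalarCurvature_eq]
  simp only [hterm, Finset.sum_add_distrib, Finset.sum_sub_distrib, ← Finset.mul_sum]
  linarith

end Frame

end LeftInvariant

namespace LeftInvariant

/-! ### Scalar curvature of block metrics and the Einstein equation. -/

section Block

open Sum

variable {𝔤 : Type*} [LieRing 𝔤] [LieAlgebra ℝ 𝔤] [FiniteDimensional ℝ 𝔤]
  {α κ : Type*} [Fintype α] [DecidableEq α] [Fintype κ] [DecidableEq κ]
  {e : Module.Basis (α ⊕ κ) ℝ 𝔤} {c C : ℝ} {g : LinearMap.BilinForm ℝ 𝔤} {x₀ : ℝ}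
  {x : κ → ℝ}

/-- Only index triples with zero, two or three indices in 𝔨... contribute when 𝔨 is a subalgebra,
and each family of squares has a known sum: 1 - 2C, 1 - c or c. The constant C is eliminated by
`card_mul_casimir`. -/
theorem IsIsotropyFrame.scalarCurvature_eq (he : IsIsotropyFrame e c C) (hg : IsBlockForm e g x₀ x)
    (h₀ : 0 < x₀) (hx : ∀ z, 0 < x z) :
    scalarCurvature g = (Fintype.card α + 2 * Fintype.card κ * (1 - c)) / (4 * x₀) +
      c / 4 * ∑ z, (x z)⁻¹ - (1 - c) / (4 * x₀ ^ 2) * ∑ z, x z := by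
  rw [(hg.isDiagonalMetric h₀ hx).scalarCurvature_eq_sum he.orthonormal]
  have s1 : ∀ a, ∑ b, ∑ b', structureConst e (inl a) (inl b) (inl b') ^ 2 = 1 - 2 * C := by
    intro a
    have h := he.sum_inl a a
    simpa only [← sq, if_true] using h
  have s2 : ∀ a, ∑ b, ∑ z, structureConst e (inl a) (inl b) (inr z) ^ 2 * (x z / (x₀ * x₀)) =
      ∑ z, (∑ b, structureConst e (inl a) (inl b) (inr z) ^ 2) * (x z / (x₀ * x₀)) := by
    intro a
    rw [Finset.sum_comm]
    simp only [Finset.sum_mul]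
  have t1 : ∀ z, ∑ a, ∑ b, structureConst e (inl a) (inl b) (inr z) ^ 2 = 1 - c := by
    intro z
    have h := he.sum_inr z z
    simp only [← sq, if_true] at h
    rw [← h]
    refine Finset.sum_congr rfl fun a _ => Finset.sum_congr rfl fun b _ => ?_
    rw [← structureConst_cyclic]
  have t2 : ∀ z, ∑ a, ∑ b, structureConst e (inl a) (inr z) (inl b) ^ 2 = 1 - c := by
    intro z
    have h := he.sum_inr z z
    simp only [← sq, if_true] at h
    rw [← h]
    refine Finset.sum_congr rfl fun a _ => Finset.sum_congr rfl fun b _ => ?_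
    rw [structureConst_antisymm₁, neg_sq]
  have t3 : ∀ z, ∑ a, ∑ b, structureConst e (inr z) (inl a) (inl b) ^ 2 = 1 - c := by
    intro z
    have h := he.sum_inr z z
    simpa only [← sq, if_true] using h
  have t4 : ∀ z, ∑ w, ∑ v, structureConst e (inr z) (inr w) (inr v) ^ 2 * (x v / (x w * x z)) =
      c * (x z)⁻¹ := by
    intro z
    have h := he.killing z z
    simp only [← sq, if_true] at h
    rw [← h]
    simp only [Finset.sum_mul]
    refine Finset.sum_congr rfl fun w _ => Finset.sum_congr rfl fun v _ => ?_
    -- Where the structure constant is nonzero, linkedness gives x_v = x_w and the weight is 1/x_z.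
    by_cases hf : structureConst e (inr z) (inr w) (inr v) = 0
    · simp [hf]
    · rw [hg.linked z w v hf, div_mul_cancel_left₀ (hx v).ne']
  have t5 : ∀ z, x₀ / (x z * x₀) = (x z)⁻¹ := fun z => by
    rw [mul_comm, div_mul_cancel_left₀ h₀.ne']
  have t6 : ∀ z, x₀ / (x₀ * x z) = (x z)⁻¹ := fun z => by
    rw [div_mul_cancel_left₀ h₀.ne']
  have u1 : ∑ a, ∑ b, ∑ b', structureConst e (inl a) (inl b) (inl b') ^ 2 * (x₀ / (x₀ * x₀)) =
      Fintype.card α * ((1 - 2 * C) * (x₀ / (x₀ * x₀))) := by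
    simp only [← Finset.sum_mul, s1]
    rw [Finset.sum_const, Finset.card_univ, nsmul_eq_mul, mul_assoc]
  have u2 : ∑ a, ∑ b, ∑ z, structureConst e (inl a) (inl b) (inr z) ^ 2 * (x z / (x₀ * x₀)) =
      (1 - c) * ((∑ z, x z) / (x₀ * x₀)) := by
    simp only [s2]
    rw [Finset.sum_comm]
    simp only [← Finset.sum_mul, t1, ← Finset.mul_sum, Finset.sum_div]
  have u3 : ∑ a, ∑ z, ∑ b, structureConst e (inl a) (inr z) (inl b) ^ 2 * (x z)⁻¹ =
      (1 - c) * ∑ z, (x z)⁻¹ := by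
    rw [Finset.sum_comm]
    simp only [← Finset.sum_mul, t2, ← Finset.mul_sum]
  have u4 : ∑ z, ∑ a, ∑ b, structureConst e (inr z) (inl a) (inl b) ^ 2 * (x z)⁻¹ =
      (1 - c) * ∑ z, (x z)⁻¹ := by
    simp only [← Finset.sum_mul, t3, ← Finset.mul_sum]
  simp only [Fintype.sum_sum_type, Sum.elim_inl, Sum.elim_inr, he.subalgebra, he.inr_inl_inr,
    he.inl_inr_inr, ne_eq, OfNat.ofNat_ne_zero, not_false_eq_true, zero_pow, zero_mul,
    Finset.sum_const_zero, add_zero, zero_add, t5, t6, t4, Finset.sum_add_distrib, u1, u2, u3, u4,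
    ← Finset.mul_sum]
  have hC := he.card_mul_casimir
  rw [Finset.sum_const, Finset.card_univ, nsmul_eq_mul]
  have h1 := h₀.ne'
  field_simp
  linear_combination (4 * x₀) * hC

/-- The Einstein equation for `g_t`. -/
theorem IsIsotropyFrame.isEinstein (he : IsIsotropyFrame e c C) [Nonempty α] {t : ℝ} (ht : 0 < t)
    (hg : IsBlockForm e g 1 fun _ => t)
    (hE : t * ((Fintype.card α + 2 * Fintype.card κ) * (1 - c)) = Fintype.card α * c) :
    IsEinstein g := by
  have hd := hg.isDiagonalMetric one_pos fun _ => ht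
  have hC := he.card_mul_casimir
  have hn : (Fintype.card α : ℝ) ≠ 0 := by exact_mod_cast Fintype.card_ne_zero
  -- The 𝔨-part of the Einstein equation, with the Einstein constant read off from 𝔞. Multiplied by
  -- d, and with dC = k(1 - c), its two sides differ by (t - 1)((d + 2k)(1 - c)t - dc)/4.
  have hEC : c / 4 + (1 - c) * t ^ 2 / 4 = t * (1 / 4 + C / 2 - C * t / 2) := by
    apply mul_left_cancel₀ hn
    linear_combination (-t / 2 + t ^ 2 / 2) * hC + (-1 / 4 + t / 4) * hE
  refine ⟨hd.isMetric, 1 / 4 + C / 2 - C * t / 2, ?_⟩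
  have ht' := ht.ne'
  apply LinearMap.BilinForm.ext_basis e
  intro i j
  rw [LinearMap.smul_apply, LinearMap.smul_apply, hg.apply, hd.ricci_eq he.orthonormal]
  rcases i with a | z <;> rcases j with a' | z'
  · simp only [Fintype.sum_sum_type, Sum.elim_inl, Sum.elim_inr, he.inl_inr_inr, zero_mul,
      Finset.sum_const_zero, add_zero, Finset.sum_add_distrib, ← Finset.sum_mul, he.casimir',
      he.casimir'', he.sum_inl, inl.injEq, smul_eq_mul]
    split_ifs
    · field_simp
      ring
    · simp
  · simp [Fintype.sum_sum_type, he.inl_inr_inr, he.subalgebra, he.inr_inl_inr,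
      Finset.sum_add_distrib, ← Finset.sum_mul, he.sum_inl_inr]
  · have h := he.sum_inl_inr a' z
    simp only [mul_comm (structureConst e (inl a') _ _)] at h
    simp [Fintype.sum_sum_type, he.inl_inr_inr, he.subalgebra, he.inr_inl_inr,
      Finset.sum_add_distrib, ← Finset.sum_mul, h]
  · simp only [Fintype.sum_sum_type, Sum.elim_inl, Sum.elim_inr, he.subalgebra, he.inr_inl_inr,
      zero_mul, Finset.sum_const_zero, add_zero, zero_add, ← Finset.sum_mul, he.killing,
      he.sum_inr, inr.injEq, smul_eq_mul]
    split_ifs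
    · refine Eq.trans ?_ (hEC.trans (mul_comm _ _))
      field_simp
      ring
    · simp

end Block

end LeftInvariant

/-! ### Second variation and local minimum of an explicit function of several real variables. -/

section Analysis

/-- Computes a second derivative from a formula for the first derivative near the point. -/
theorem iteratedDeriv_two_eq {f f' : ℝ → ℝ} {a f'' : ℝ}
    (h : ∀ᶠ s in nhds a, HasDerivAt f (f' s) s) (h' : HasDerivAt f' f'' a) :
    iteratedDeriv 2 f a = f'' := by
  rw [iteratedDeriv_succ, iteratedDeriv_one]
  have h1 : deriv f =ᶠ[nhds a] f' := h.mono fun s hs => hs.deriv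
  rw [h1.deriv_eq, h'.deriv]

variable {κ : Type*} [Fintype κ]

/-- The quadratic form of the second variation is positive definite. -/
theorem secondVariation_ge {d p q α : ℝ} {β : κ → ℝ} (hd : 0 < d) (hq : 0 < q)
    (htr : d * α + ∑ z, β z = 0) :
    (d * p - (d + 2 * Fintype.card κ) * q) / d * ∑ z, β z ^ 2 +
      (d * p - (d + 2 * Fintype.card κ) * q) * α ^ 2 ≤
    (p - q) * ∑ z, β z ^ 2 + α ^ 2 * (d * p - 3 * d * q - 2 * Fintype.card κ * q) := by
  -- Cauchy–Schwarz with ∑ β = -dα. The two sides of the claim differ by (2q/d)(k ∑ β² - d²α²).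
  have hcs := sq_sum_le_card_mul_sum_sq (s := Finset.univ) (f := β)
  rw [Finset.card_univ, show ∑ z, β z = -(d * α) by linarith] at hcs
  have h1 : (p - q) * ∑ z, β z ^ 2 + α ^ 2 * (d * p - 3 * d * q - 2 * Fintype.card κ * q) -
      ((d * p - (d + 2 * Fintype.card κ) * q) / d * ∑ z, β z ^ 2 +
      (d * p - (d + 2 * Fintype.card κ) * q) * α ^ 2) =
      2 * q / d * (Fintype.card κ * ∑ z, β z ^ 2 - (-(d * α)) ^ 2) := by
    field_simp
    ring
  have h2 : 0 ≤ 2 * q / d * (Fintype.card κ * ∑ z, β z ^ 2 - (-(d * α)) ^ 2) :=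
    mul_nonneg (by positivity) (by linarith)
  linarith

theorem exp_cubic_bound {x : ℝ} (hx : |x| ≤ 1) :
    |Real.exp x - (1 + x + x ^ 2 / 2)| ≤ |x| * x ^ 2 := by
  have h := Real.exp_bound hx (n := 3) (by norm_num)
  have h1 : ∑ m ∈ Finset.range 3, x ^ m / (m.factorial : ℝ) = 1 + x + x ^ 2 / 2 := by
    simp [Finset.sum_range_succ, Nat.factorial]
  rw [h1] at h
  refine h.trans ?_
  have h2 : |x| ^ 3 = |x| * x ^ 2 := by rw [pow_succ', sq_abs]
  rw [h2]
  have h3 : 0 ≤ |x| * x ^ 2 := by positivity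
  norm_num [Nat.factorial]
  linarith

/-- The scalar curvature function in logarithmic coordinates has a local minimum at the origin
along the hypersurface of fixed volume. -/
theorem exists_localMin_exp {d p q A : ℝ} (hd : 0 < d) (hp : 0 < p) (hq : 0 < q)
    (h : (d + 2 * Fintype.card κ) * q < d * p)
    (hA : A = 2 * Fintype.card κ * q + d * (p + q)) :
    ∃ δ : ℝ, 0 < δ ∧ ∀ (α : ℝ) (β : κ → ℝ), |α| ≤ δ → (∀ z, |β z| ≤ δ) →
      d * α + ∑ z, β z = 0 →
      A + p * Fintype.card κ - q * Fintype.card κ ≤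
        A * Real.exp (-α) + p * ∑ z, Real.exp (-β z) - q * ∑ z, Real.exp (β z - 2 * α) := by
  set k : ℝ := ((Fintype.card κ : ℕ) : ℝ) with hk
  have hk0 : 0 ≤ k := by positivity
  set E : ℝ := d * p - (d + 2 * k) * q with hE
  have hE0 : 0 < E := by linarith
  have hA0 : 0 < A := by rw [hA]; positivity
  set M : ℝ := A + p + 6 * q + 24 * k * q with hM
  have hM0 : 0 < M := by positivity
  -- The bound 1/3 keeps |β - 2α| ≤ 1 for `exp_cubic_bound`. The other two keep the cubic
  -- remainders, whose coefficients M dominates, below half the quadratic lower bound of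
  -- `secondVariation_ge`.
  refine ⟨min (1 / 3) (min (E / (2 * M)) (E / (2 * d * M))), by positivity, ?_⟩
  intro α β hα hβ htr
  set δ := min (1 / 3) (min (E / (2 * M)) (E / (2 * d * M))) with hδ
  have hδ3 : δ ≤ 1 / 3 := min_le_left _ _
  have hδ1 : δ * M ≤ E / 2 := by
    have : δ ≤ E / (2 * M) := (min_le_right _ _).trans (min_le_left _ _)
    rw [le_div_iff₀ (by positivity)] at this
    linarith
  have hδ2 : δ * M ≤ E / d / 2 := by
    have : δ ≤ E / (2 * d * M) := (min_le_right _ _).trans (min_le_right _ _)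
    rw [le_div_iff₀ (by positivity)] at this
    rw [div_div, le_div_iff₀ (by positivity)]
    linarith
  have hδ0 : 0 ≤ δ := (abs_nonneg _).trans hα
  have b1 : 1 - α + α ^ 2 / 2 - δ * α ^ 2 ≤ Real.exp (-α) := by
    have := exp_cubic_bound (x := -α) (by rw [abs_neg]; linarith)
    rw [abs_neg, neg_sq] at this
    have h2 := mul_le_mul_of_nonneg_right hα (sq_nonneg α)
    have := (abs_le.mp this).1
    linarith
  have b2 : ∀ z, 1 - β z + β z ^ 2 / 2 - δ * β z ^ 2 ≤ Real.exp (-β z) := by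
    intro z
    have := exp_cubic_bound (x := -β z) (by rw [abs_neg]; linarith [hβ z])
    rw [abs_neg, neg_sq] at this
    have h2 := mul_le_mul_of_nonneg_right (hβ z) (sq_nonneg (β z))
    have := (abs_le.mp this).1
    linarith
  have b3 : ∀ z, Real.exp (β z - 2 * α) ≤ 1 + (β z - 2 * α) + (β z - 2 * α) ^ 2 / 2 +
      δ * (6 * β z ^ 2 + 24 * α ^ 2) := by
    intro z
    have ha := abs_le.mp hα
    have hb := abs_le.mp (hβ z)
    have habs : |β z - 2 * α| ≤ 3 * δ := abs_le.mpr ⟨by linarith, by linarith⟩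
    have := exp_cubic_bound (x := β z - 2 * α) (by linarith)
    have h2 := mul_le_mul_of_nonneg_right habs (sq_nonneg (β z - 2 * α))
    have := (abs_le.mp this).2
    have h4 : (β z - 2 * α) ^ 2 ≤ 2 * β z ^ 2 + 8 * α ^ 2 := by nlinarith [sq_nonneg (β z + 2 * α)]
    have h5 := mul_le_mul_of_nonneg_left h4 (show 0 ≤ 3 * δ by linarith)
    linarith
  have s2 : k - ∑ z, β z + (∑ z, β z ^ 2) / 2 - δ * ∑ z, β z ^ 2 ≤ ∑ z, Real.exp (-β z) := by
    refine le_trans (le_of_eq ?_) (Finset.sum_le_sum fun z _ => b2 z)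
    simp only [Finset.sum_add_distrib, Finset.sum_sub_distrib, ← Finset.mul_sum,
      ← Finset.sum_div, Finset.sum_const, Finset.card_univ, nsmul_eq_mul, mul_one, ← hk]
  have s3 : ∑ z, Real.exp (β z - 2 * α) ≤ k + (∑ z, β z - 2 * k * α) +
      (∑ z, β z ^ 2 - 4 * α * ∑ z, β z + 4 * k * α ^ 2) / 2 +
      δ * (6 * ∑ z, β z ^ 2 + 24 * k * α ^ 2) := by
    refine le_trans (Finset.sum_le_sum fun z _ => b3 z) (le_of_eq ?_)
    have : ∀ z, (β z - 2 * α) ^ 2 = β z ^ 2 - 4 * α * β z + 4 * α ^ 2 := fun z => by ring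
    simp only [this, Finset.sum_add_distrib, Finset.sum_sub_distrib, ← Finset.mul_sum,
      ← Finset.sum_div, Finset.sum_const, Finset.card_univ, nsmul_eq_mul, mul_one, ← hk]
    ring
  have hsv := secondVariation_ge (p := p) hd hq htr
  rw [← hk, ← hE] at hsv
  have hS : 0 ≤ ∑ z, β z ^ 2 := Finset.sum_nonneg fun z _ => sq_nonneg _
  have m1 := mul_le_mul_of_nonneg_left b1 hA0.le
  have m2 := mul_le_mul_of_nonneg_left s2 hp.le
  have m3 := mul_le_mul_of_nonneg_left s3 hq.le
  have r1 := mul_le_mul_of_nonneg_right hδ1 (sq_nonneg α)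
  have r2 := mul_le_mul_of_nonneg_right hδ2 hS
  have hβs : ∑ z, β z = -(d * α) := by linarith
  rw [hβs] at m2 m3
  have e1 : δ * (A * α ^ 2 + p * ∑ z, β z ^ 2 + q * (6 * ∑ z, β z ^ 2 + 24 * k * α ^ 2)) ≤
      δ * M * α ^ 2 + δ * M * ∑ z, β z ^ 2 := by
    rw [← sub_nonneg]
    have : δ * M * α ^ 2 + δ * M * ∑ z, β z ^ 2 -
      δ * (A * α ^ 2 + p * ∑ z, β z ^ 2 + q * (6 * ∑ z, β z ^ 2 + 24 * k * α ^ 2)) =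
      δ * ((p + 6 * q) * α ^ 2 + (A + 24 * k * q) * ∑ z, β z ^ 2) := by rw [hM]; ring
    rw [this]
    positivity
  -- The value of A makes the first-order terms cancel on the hyperplane dα + ∑ β = 0.
  rw [hA] at m1 e1 ⊢
  linarith

/-- The second derivative at `0` of the scalar curvature along a curve of fixed volume. -/
theorem iteratedDeriv_two_scalar {d p q A α n : ℝ} {β : κ → ℝ} (D : ℕ) (hD : (D : ℝ) = d)
    (hn : n = d + Fintype.card κ) (hn0 : n ≠ 0)
    (hA : A = 2 * Fintype.card κ * q + d * (p + q)) (htr : d * α + ∑ z, β z = 0) :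
    iteratedDeriv 2 (fun s : ℝ => ((1 + s * α) ^ D * ∏ z, (1 + s * β z)) ^ (1 / n) *
      (A * (1 + s * α)⁻¹ + p * ∑ z, (1 + s * β z)⁻¹ -
        q * ((1 + s * α) ^ 2)⁻¹ * ∑ z, (1 + s * β z))) 0 =
    (p - q) * ∑ z, β z ^ 2 + α ^ 2 * (d * p - 3 * d * q - 2 * Fintype.card κ * q) := by
  have lin : ∀ a s : ℝ, HasDerivAt (fun s => 1 + s * a) a s := fun a s => by
    simpa using ((hasDerivAt_id s).mul_const a).const_add 1
  have pos : ∀ a : ℝ, ∀ᶠ s : ℝ in nhds 0, 0 < 1 + s * a := fun a => by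
    have := (lin a 0).continuousAt.eventually (lt_mem_nhds (show (0 : ℝ) < 1 + 0 * a by simp))
    exact this
  have hpos : ∀ᶠ s : ℝ in nhds 0, 0 < 1 + s * α ∧ ∀ z, 0 < 1 + s * β z :=
    (pos α).and (Filter.eventually_all.mpr fun z => pos (β z))
  have inv : ∀ a s : ℝ, 0 < 1 + s * a →
      HasDerivAt (fun s => (1 + s * a)⁻¹) (-a / (1 + s * a) ^ 2) s :=
    fun a s h => (lin a s).fun_inv h.ne'
  have invsq : ∀ a s : ℝ, 0 < 1 + s * a →
      HasDerivAt (fun s => ((1 + s * a) ^ 2)⁻¹) (-(2 * (1 + s * a) * a) / ((1 + s * a) ^ 2) ^ 2) s :=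
    fun a s h => by
      have h1 := ((lin a s).fun_pow 2).fun_inv (pow_pos h 2).ne'
      simpa using h1
  -- The volume factor is written exp L, so that L'(0) = 0 is the trace condition.
  set L : ℝ → ℝ := fun s => 1 / n * (d * Real.log (1 + s * α) + ∑ z, Real.log (1 + s * β z)) with hL
  set l : ℝ → ℝ := fun s => 1 / n * (d * (α / (1 + s * α)) + ∑ z, β z / (1 + s * β z)) with hl
  set B : ℝ → ℝ := fun s => A * (1 + s * α)⁻¹ + p * ∑ z, (1 + s * β z)⁻¹ -
        q * ((1 + s * α) ^ 2)⁻¹ * ∑ z, (1 + s * β z) with hB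
  set B' : ℝ → ℝ := fun s => A * (-α / (1 + s * α) ^ 2) + p * ∑ z, (-β z / (1 + s * β z) ^ 2) -
        (q * (-(2 * (1 + s * α) * α) / ((1 + s * α) ^ 2) ^ 2) * ∑ z, (1 + s * β z) +
          q * ((1 + s * α) ^ 2)⁻¹ * ∑ z, β z) with hB'
  have dL : ∀ s, 0 < 1 + s * α → (∀ z, 0 < 1 + s * β z) → HasDerivAt L (l s) s := by
    intro s h1 h2
    exact (((lin α s).log h1.ne').const_mul d |>.add
      (HasDerivAt.fun_sum fun z _ => (lin (β z) s).log (h2 z).ne')).const_mul _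
  have dB : ∀ s, 0 < 1 + s * α → (∀ z, 0 < 1 + s * β z) → HasDerivAt B (B' s) s := by
    intro s h1 h2
    exact (((inv α s h1).const_mul A).add
      ((HasDerivAt.fun_sum fun z _ => inv (β z) s (h2 z)).const_mul p)).sub
      (((invsq α s h1).const_mul q).mul (HasDerivAt.fun_sum fun z _ => lin (β z) s))
  have dl : HasDerivAt l (1 / n * (d * (α * -α) + ∑ z, β z * -β z)) 0 := by
    have h1 : ∀ a : ℝ, HasDerivAt (fun s => a / (1 + s * a)) (a * -a) 0 := fun a => by
      have := (inv a 0 (by simp)).const_mul a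
      simpa [div_eq_mul_inv] using this
    exact (((h1 α).const_mul d).add (HasDerivAt.fun_sum fun z _ => h1 (β z))).const_mul _
  have dB' : HasDerivAt B' (A * (2 * α ^ 2) + p * ∑ z, 2 * β z ^ 2 -
      (q * (6 * α ^ 2) * Fintype.card κ + q * (-2 * α) * ∑ z, β z +
        q * (-2 * α) * ∑ z, β z)) 0 := by
    have h1 : ∀ a : ℝ, HasDerivAt (fun s => -a / (1 + s * a) ^ 2) (2 * a ^ 2) 0 := fun a => by
      have := (invsq a 0 (by simp)).const_mul (-a)
      simp only [div_eq_mul_inv] at this ⊢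
      refine this.congr_deriv ?_
      simp
      ring
    have h2 : HasDerivAt (fun s => -(2 * (1 + s * α) * α) / ((1 + s * α) ^ 2) ^ 2) (6 * α ^ 2) 0 := by
      have h3 := (((lin α 0).const_mul 2).mul_const α).fun_neg.fun_div
        (((lin α 0).fun_pow 2).fun_pow 2) (by simp)
      refine h3.congr_deriv ?_
      simp
      ring
    have h3 := (((h1 α).const_mul A).add
      ((HasDerivAt.fun_sum fun z (_ : z ∈ univ) => h1 (β z)).const_mul p)).sub
      (((h2.const_mul q).mul (HasDerivAt.fun_sum fun z (_ : z ∈ univ) => lin (β z) 0)).add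
        (((invsq α 0 (by simp)).const_mul q).mul_const (∑ z, β z)))
    refine h3.congr_deriv ?_
    simp
  have heq : (fun s : ℝ => ((1 + s * α) ^ D * ∏ z, (1 + s * β z)) ^ (1 / n) * B s) =ᶠ[nhds 0]
      fun s => Real.exp (L s) * B s := by
    filter_upwards [hpos] with s hs
    congr 1
    rw [Real.rpow_def_of_pos (mul_pos (pow_pos hs.1 _) (Finset.prod_pos fun z _ => hs.2 z)),
      Real.log_mul (pow_pos hs.1 _).ne' (Finset.prod_pos fun z _ => hs.2 z).ne', Real.log_pow,
      Real.log_prod fun z _ => (hs.2 z).ne', hL, hD, mul_comm]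
  rw [heq.iteratedDeriv_eq]
  have z1 : L 0 = 0 := by simp [hL]
  have z2 : l 0 = 0 := by simp [hl, htr]
  -- By `hA` this value is n(p + q), which cancels the 1/n in L''(0).
  have z3 : B 0 = A + p * Fintype.card κ - q * Fintype.card κ := by simp [hB]
  rw [iteratedDeriv_two_eq (f := fun s => Real.exp (L s) * B s)
    (f' := fun s => Real.exp (L s) * l s * B s + Real.exp (L s) * B' s)
    (hpos.mono fun s hs => (dL s hs.1 hs.2).exp.mul (dB s hs.1 hs.2))
    ((((dL 0 (by simp) (by simp)).exp.mul dl).mul (dB 0 (by simp) (by simp))).add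
      ((dL 0 (by simp) (by simp)).exp.mul dB'))]
  have hβs : ∑ z, β z = -(d * α) := by linarith
  simp only [Pi.mul_apply, z1, z2, z3, Real.exp_zero, mul_neg, Finset.sum_neg_distrib, ← Finset.mul_sum, ← sq, hβs]
  rw [hA]
  rw [hn] at hn0 ⊢
  field_simp
  ring

end Analysis

namespace LeftInvariant

/-! ### Hessian and local minimality for block metrics. -/

section Variation

open Sum

variable {𝔤 : Type*} [LieRing 𝔤] [LieAlgebra ℝ 𝔤] [FiniteDimensional ℝ 𝔤]
  {α κ : Type*} [Fintype α] [DecidableEq α] [Fintype κ] [DecidableEq κ]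
  {e : Module.Basis (α ⊕ κ) ℝ 𝔤} {c C t : ℝ} {g T : LinearMap.BilinForm ℝ 𝔤} {τ₀ : ℝ}
  {τ : κ → ℝ}

namespace IsBlockForm

theorem smul (hT : IsBlockForm e T τ₀ τ) (r : ℝ) :
    IsBlockForm e (r • T) (r * τ₀) fun z => r * τ z where
  apply i j := by
    rw [LinearMap.smul_apply, LinearMap.smul_apply, hT.apply]
    rcases i with i | i <;> simp
  linked z w v h := by rw [hT.linked z w v h]

theorem add {T' : LinearMap.BilinForm ℝ 𝔤} {τ₀' : ℝ} {τ' : κ → ℝ} (hT : IsBlockForm e T τ₀ τ)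
    (hT' : IsBlockForm e T' τ₀' τ') : IsBlockForm e (T + T') (τ₀ + τ₀') fun z => τ z + τ' z where
  apply i j := by
    rw [LinearMap.add_apply, LinearMap.add_apply, hT.apply, hT'.apply]
    rcases i with i | i <;> split_ifs <;> simp
  linked z w v h := by rw [hT.linked z w v h, hT'.linked z w v h]

theorem metricTrace_eq (ht : 0 < t) (hg : IsBlockForm e g 1 fun _ => t)
    (hT : IsBlockForm e T τ₀ τ) :
    metricTrace g T = Fintype.card α * τ₀ + ∑ z, τ z / t := by
  rw [(hg.isDiagonalMetric one_pos fun _ => ht).metricTrace_eq]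
  simp [hT.apply]

theorem metricDet_eq (ht : 0 < t) (hg : IsBlockForm e g 1 fun _ => t)
    (hT : IsBlockForm e T τ₀ τ) :
    metricDet g T = τ₀ ^ Fintype.card α * ∏ z, (τ z / t) := by
  rw [(hg.isDiagonalMetric one_pos fun _ => ht).metricDet_eq hT.apply, Fintype.prod_sum_type]
  simp

theorem divergence_eq_zero (he : IsIsotropyFrame e c C) (ht : 0 < t)
    (hg : IsBlockForm e g 1 fun _ => t) (hT : IsBlockForm e T τ₀ τ) (X : 𝔤) :
    divergence g T X = 0 :=
  (hg.isDiagonalMetric one_pos fun _ => ht).divergence_eq_zero he.orthonormal hT.apply X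

/-- Rescaling a metric by r⁻¹ multiplies sc by r, so the fixed-volume curve yields the function of
`iteratedDeriv_two_scalar` with p = c/(4t), q = (1 - c)t/4, α = τ₀ and β = τ/t. -/
theorem scalarHessian_eq [Nonempty α] (he : IsIsotropyFrame e c C) (ht : 0 < t)
    (hg : IsBlockForm e g 1 fun _ => t)
    (hE : t * ((Fintype.card α + 2 * Fintype.card κ) * (1 - c)) = Fintype.card α * c)
    (hT : IsBlockForm e T τ₀ τ) (htr : metricTrace g T = 0) :
    scalarHessian g T = (c / (4 * t) - (1 - c) * t / 4) * ∑ z, (τ z / t) ^ 2 +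
      τ₀ ^ 2 * (Fintype.card α * (c / (4 * t)) - 3 * Fintype.card α * ((1 - c) * t / 4) -
        2 * Fintype.card κ * ((1 - c) * t / 4)) := by
  set n : ℝ := Fintype.card α + Fintype.card κ with hn
  have hn0 : 0 < n := by
    have : (0 : ℝ) < Fintype.card α := by exact_mod_cast Fintype.card_pos
    positivity
  have hfr : (Module.finrank ℝ 𝔤 : ℝ) = n := by
    rw [Module.finrank_eq_card_basis e, Fintype.card_sum]
    push_cast
    rfl
  rw [hg.metricTrace_eq ht hT] at htr
  -- The equation for t, in the form of the criticality condition on the coefficient A.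
  have hA : ((Fintype.card α : ℝ) + 2 * Fintype.card κ * (1 - c)) / 4 =
      2 * Fintype.card κ * ((1 - c) * t / 4) +
        Fintype.card α * (c / (4 * t) + (1 - c) * t / 4) := by
    field_simp
    linear_combination (1 - t) * hE
  rw [← iteratedDeriv_two_scalar (Fintype.card α) rfl hn hn0.ne' hA htr, scalarHessian]
  apply Filter.EventuallyEq.iteratedDeriv_eq
  have pos : ∀ a : ℝ, ∀ᶠ s : ℝ in nhds 0, 0 < 1 + s * a := fun a => by
    have h : ContinuousAt (fun s : ℝ => 1 + s * a) 0 := by fun_prop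
    exact h.eventually (lt_mem_nhds (show (0 : ℝ) < 1 + 0 * a by simp))
  filter_upwards [(pos τ₀).and (Filter.eventually_all.mpr fun z => pos (τ z / t))] with s hs
  have hx : ∀ z, t + s * τ z = t * (1 + s * (τ z / t)) := fun z => by field_simp
  have hb := hg.add (hT.smul s)
  rw [fixedVolumeCurve, hg.metricDet_eq ht hb, hfr]
  have hdiv : ∀ z, (t + s * τ z) / t = 1 + s * (τ z / t) := fun z => by field_simp
  simp only [hdiv]
  set D : ℝ := (1 + s * τ₀) ^ Fintype.card α * ∏ z, (1 + s * (τ z / t)) with hD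
  have hD0 : 0 < D := mul_pos (pow_pos hs.1 _) (Finset.prod_pos fun z _ => hs.2 z)
  have hinv : D ^ (-(1 : ℝ) / n) = (D ^ (1 / n))⁻¹ := by rw [neg_div, Real.rpow_neg hD0.le]
  have hr : 0 < D ^ (1 / n) := Real.rpow_pos_of_pos hD0 _
  rw [hinv]
  set r : ℝ := D ^ (1 / n) with hrdef
  rw [he.scalarCurvature_eq (hb.smul r⁻¹) (mul_pos (inv_pos.mpr hr) hs.1) fun z => by
    rw [hx]; exact mul_pos (inv_pos.mpr hr) (mul_pos ht (hs.2 z))]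
  simp only [hx, mul_inv, inv_inv, ← Finset.mul_sum]
  have h1 := hs.1.ne'
  have h2 := hr.ne'
  field_simp

/-- By `hE` the right side is (d + 2k)(1 - c)/4, so the inequality amounts to t < 1. -/
theorem card_mul_lt [Nonempty α] (ht : 0 < t) (ht1 : t < 1) (hc : c < 1)
    (hE : t * ((Fintype.card α + 2 * Fintype.card κ) * (1 - c)) = Fintype.card α * c) :
    ((Fintype.card α : ℝ) + 2 * Fintype.card κ) * ((1 - c) * t / 4) <
      Fintype.card α * (c / (4 * t)) := by
  have hd : (0 : ℝ) < Fintype.card α := by exact_mod_cast Fintype.card_pos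
  have h1c : 0 < 1 - c := by linarith
  have h1 : (Fintype.card α : ℝ) * (c / (4 * t)) =
      ((Fintype.card α : ℝ) + 2 * Fintype.card κ) * (1 - c) / 4 := by
    field_simp
    linarith
  rw [h1]
  have h2 : 0 < ((Fintype.card α : ℝ) + 2 * Fintype.card κ) * (1 - c) := by positivity
  nlinarith

theorem scalarHessian_pos [Nonempty α] (he : IsIsotropyFrame e c C) (ht : 0 < t) (ht1 : t < 1)
    (hc : c < 1) (hg : IsBlockForm e g 1 fun _ => t)
    (hE : t * ((Fintype.card α + 2 * Fintype.card κ) * (1 - c)) = Fintype.card α * c)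
    (hT : IsBlockForm e T τ₀ τ) (htr : metricTrace g T = 0) (hne : T ≠ 0) :
    0 < scalarHessian g T := by
  rw [hg.scalarHessian_eq he ht hE hT htr]
  rw [hg.metricTrace_eq ht hT] at htr
  have hd : (0 : ℝ) < Fintype.card α := by exact_mod_cast Fintype.card_pos
  have h1c : 0 < 1 - c := by linarith
  have hlt := card_mul_lt ht ht1 hc hE
  refine lt_of_lt_of_le ?_ (secondVariation_ge hd (by positivity) htr)
  rw [← sub_pos] at hlt
  set E := (Fintype.card α : ℝ) * (c / (4 * t)) -
    ((Fintype.card α : ℝ) + 2 * Fintype.card κ) * ((1 - c) * t / 4)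
  have hS : 0 ≤ ∑ z, (τ z / t) ^ 2 := Finset.sum_nonneg fun z _ => sq_nonneg _
  by_cases h0 : τ₀ = 0
  · obtain ⟨z, hz⟩ : ∃ z, τ z ≠ 0 := by
      by_contra h
      push Not at h
      apply hne
      apply LinearMap.BilinForm.ext_basis e
      intro i j
      rw [hT.apply]
      rcases i with i | i <;> simp [h0, h]
    have : 0 < ∑ z, (τ z / t) ^ 2 := Finset.sum_pos' (fun z _ => sq_nonneg _)
      ⟨z, Finset.mem_univ z, by positivity⟩
    positivity
  · positivity

theorem _root_.Real.abs_log_le_of_abs_sub_one_le {y ε : ℝ} (hε : ε ≤ 1 / 2) (hy : |y - 1| ≤ ε) :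
    |Real.log y| ≤ 2 * ε := by
  have h := abs_le.mp hy
  have hy0 : 1 / 2 ≤ y := by linarith
  have hy1 : 0 < y := by linarith
  have h1 := Real.log_le_sub_one_of_pos hy1
  have h2 := Real.one_sub_inv_le_log_of_pos hy1
  have h3 : -(2 * ε) ≤ 1 - y⁻¹ := by
    have h4 : 1 - y⁻¹ = (y - 1) / y := by field_simp
    rw [h4, le_div_iff₀ hy1]
    nlinarith
  exact abs_le.mpr ⟨by linarith, by linarith⟩

variable (𝔤 α κ) in
/-- Among the block metrics of the same volume, those close to `g_t` have larger scalar curvature,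
uniformly in the frame. -/
theorem exists_localMin [Nonempty α] (ht : 0 < t) (ht1 : t < 1) (hc0 : 0 < c) (hc : c < 1)
    (hE : t * ((Fintype.card α + 2 * Fintype.card κ) * (1 - c)) = Fintype.card α * c) :
    ∃ ε : ℝ, 0 < ε ∧ ∀ (e : Module.Basis (α ⊕ κ) ℝ 𝔤) (C : ℝ) (g g' : LinearMap.BilinForm ℝ 𝔤)
      (x₀ : ℝ) (x : κ → ℝ), IsIsotropyFrame e c C → IsBlockForm e g 1 (fun _ => t) →
      IsBlockForm e g' x₀ x → 0 < x₀ → (∀ z, 0 < x z) → metricDet g g' = 1 →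
      (∀ v, |g' v v - g v v| ≤ ε * g v v) → scalarCurvature g ≤ scalarCurvature g' := by
  have hd : (0 : ℝ) < Fintype.card α := by exact_mod_cast Fintype.card_pos
  have h1c : 0 < 1 - c := by linarith
  have hA : ((Fintype.card α : ℝ) + 2 * Fintype.card κ * (1 - c)) / 4 =
      2 * Fintype.card κ * ((1 - c) * t / 4) +
        Fintype.card α * (c / (4 * t) + (1 - c) * t / 4) := by
    field_simp
    linear_combination (1 - t) * hE
  -- δ depends only on d, k, c and t. One ε therefore serves all frames, as is necessary because the
  -- frame is chosen after g'.
  obtain ⟨δ, hδ, hmin⟩ := exists_localMin_exp (κ := κ) hd (p := c / (4 * t))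
    (q := (1 - c) * t / 4) (by positivity) (by positivity) (card_mul_lt ht ht1 hc hE) hA
  refine ⟨min (1 / 2) (δ / 2), by positivity, ?_⟩
  intro e C g g' x₀ x he hg hg' h₀ hx hdet hclose
  set ε := min (1 / 2) (δ / 2)
  have hε : ε ≤ 1 / 2 := min_le_left _ _
  have hε' : 2 * ε ≤ δ := by linarith [min_le_right (1 / 2) (δ / 2)]
  have hlog : ∀ z, Real.log (x z / t) = Real.log (x z) - Real.log t := fun z =>
    Real.log_div (hx z).ne' ht.ne'
  have a1 : |Real.log x₀| ≤ δ := by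
    refine (Real.abs_log_le_of_abs_sub_one_le hε ?_).trans hε'
    have h := hclose (e (inl (Classical.arbitrary α)))
    simpa [hg.apply, hg'.apply] using h
  have a2 : ∀ z, |Real.log (x z / t)| ≤ δ := by
    intro z
    refine (Real.abs_log_le_of_abs_sub_one_le hε ?_).trans hε'
    have h := hclose (e (inr z))
    simp only [hg.apply, hg'.apply, if_true, Sum.elim_inr] at h
    have h1 : x z / t - 1 = (x z - t) / t := by field_simp
    rw [h1, abs_div, abs_of_pos ht, div_le_iff₀ ht]
    exact h
  have hy : ∀ z, 0 < x z / t := fun z => div_pos (hx z) ht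
  have a3 : (Fintype.card α : ℝ) * Real.log x₀ + ∑ z, Real.log (x z / t) = 0 := by
    rw [hg.metricDet_eq ht hg'] at hdet
    have h := congrArg Real.log hdet
    rwa [Real.log_mul (pow_pos h₀ _).ne' (Finset.prod_pos fun z _ => hy z).ne', Real.log_pow,
      Real.log_prod fun z _ => (hy z).ne', Real.log_one] at h
  have key := hmin (Real.log x₀) (fun z => Real.log (x z / t)) a1 a2 a3
  rw [he.scalarCurvature_eq hg one_pos fun _ => ht, he.scalarCurvature_eq hg' h₀ hx]
  have e1 : Real.exp (-Real.log x₀) = x₀⁻¹ := by rw [Real.exp_neg, Real.exp_log h₀]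
  have e2 : ∀ z, Real.exp (-Real.log (x z / t)) = t * (x z)⁻¹ := fun z => by
    rw [Real.exp_neg, Real.exp_log (hy z), inv_div, div_eq_mul_inv]
  have e3 : ∀ z, Real.exp (Real.log (x z / t) - 2 * Real.log x₀) = x z * (t⁻¹ * (x₀ ^ 2)⁻¹) :=
    fun z => by
      rw [Real.exp_sub, Real.exp_log (hy z), two_mul, Real.exp_add, Real.exp_log h₀]
      field_simp
  simp only [e1, e2, e3, ← Finset.mul_sum, ← Finset.sum_mul] at key
  refine (le_of_eq ?_).trans (key.trans (le_of_eq ?_))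
  · simp only [Finset.sum_const, Finset.card_univ, nsmul_eq_mul]
    field_simp
  · field_simp

end IsBlockForm

end Variation

end LeftInvariant

/-! ### Diagonalising frames adapted to a subspace and its Killing complement. -/

/-- Simultaneous diagonalisation of a symmetric bilinear form and an inner product. -/
theorem LinearMap.BilinForm.exists_orthonormal_diagonal {V : Type*} [AddCommGroup V] [Module ℝ V]
    [FiniteDimensional ℝ V] (Q T : LinearMap.BilinForm ℝ V) (hQ : ∀ x y, Q x y = Q y x)
    (hpos : ∀ x, x ≠ 0 → 0 < Q x x) (hT : ∀ x y, T x y = T y x) :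
    ∃ (b : Module.Basis (Fin (Module.finrank ℝ V)) ℝ V) (τ : Fin (Module.finrank ℝ V) → ℝ),
      (∀ i j, Q (b i) (b j) = if i = j then 1 else 0) ∧
        ∀ i j, T (b i) (b j) = if i = j then τ i else 0 := by
  have hnd : Q.Nondegenerate := by
    constructor <;>
    · intro x hx
      by_contra h
      exact (hpos x h).ne' (hx x)
  let core : InnerProductSpace.Core ℝ V :=
    { inner := fun x y => Q x y
      conj_inner_symm := fun x y => by simp [hQ y x]
      re_inner_nonneg := fun x => by
        by_cases h : x = 0
        · simp [h]
        · exact (hpos x h).le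
      add_left := fun x y z => by simp
      smul_left := fun x y r => by simp
      definite := fun x hx => by
        by_contra h
        exact (hpos x h).ne' hx }
  let : NormedAddCommGroup V := core.toNormedAddCommGroup
  let : InnerProductSpace ℝ V := InnerProductSpace.ofCore core.toCore
  have hinner : ∀ x y : V, inner ℝ x y = Q x y := fun x y => rfl
  have hA : (T.symmCompOfNondegenerate Q hnd).IsSymmetric := by
    intro x y
    rw [hinner, hinner, hQ x, LinearMap.BilinForm.symmCompOfNondegenerate_left_apply,
      LinearMap.BilinForm.symmCompOfNondegenerate_left_apply, hT]
  have hb : ∀ i j, Q (hA.eigenvectorBasis rfl i) (hA.eigenvectorBasis rfl j) =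
      if i = j then 1 else 0 := fun i j => by
    rw [← hinner, orthonormal_iff_ite.mp (hA.eigenvectorBasis rfl).orthonormal]
  refine ⟨(hA.eigenvectorBasis rfl).toBasis, hA.eigenvalues rfl, ?_, ?_⟩
  · intro i j
    simpa using hb i j
  · intro i j
    simp only [OrthonormalBasis.coe_toBasis]
    rw [← LinearMap.BilinForm.symmCompOfNondegenerate_left_apply T hnd, hA.apply_eigenvectorBasis,
      map_smul, LinearMap.smul_apply, hb]
    split_ifs <;> simp

namespace LeftInvariant

open Sum

variable {𝔤 : Type*} [LieRing 𝔤] [LieAlgebra ℝ 𝔤] [FiniteDimensional ℝ 𝔤]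

/-- The orthogonal complement for the Killing form. -/
abbrev killingOrthogonal (U : Submodule ℝ 𝔤) : Submodule ℝ 𝔤 :=
  LinearMap.BilinForm.orthogonal (killingForm ℝ 𝔤) U

theorem killingForm_eq_zero {U : Submodule ℝ 𝔤} {x y : 𝔤} (hx : x ∈ U)
    (hy : y ∈ killingOrthogonal U) : killingForm ℝ 𝔤 x y = 0 :=
  LinearMap.BilinForm.mem_orthogonal_iff.mp hy x hx

theorem killingForm_eq_zero' {U : Submodule ℝ 𝔤} {x y : 𝔤} (hx : x ∈ killingOrthogonal U)
    (hy : y ∈ U) : killingForm ℝ 𝔤 x y = 0 := by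
  rw [killingForm_comm, killingForm_eq_zero hy hx]

theorem exists_add_eq (hneg : ∀ X : 𝔤, X ≠ 0 → killingForm ℝ 𝔤 X X < 0) (U : Submodule ℝ 𝔤)
    (x : 𝔤) : ∃ y ∈ U, ∃ z ∈ killingOrthogonal U, y + z = x := by
  rw [← Submodule.mem_sup, (isCompl_killingOrthogonal hneg U).sup_eq_top]
  trivial

theorem mem_of_killingForm_eq_zero (hneg : ∀ X : 𝔤, X ≠ 0 → killingForm ℝ 𝔤 X X < 0)
    {U : Submodule ℝ 𝔤} {x : 𝔤} (hx : ∀ y ∈ killingOrthogonal U, killingForm ℝ 𝔤 x y = 0) :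
    x ∈ U := by
  obtain ⟨u, hu, v, hv, rfl⟩ := exists_add_eq hneg U x
  have h := hx v hv
  rw [map_add, LinearMap.add_apply, killingForm_eq_zero hu hv, zero_add] at h
  have : v = 0 := by
    by_contra h0
    exact (hneg v h0).ne h
  rw [this, add_zero]
  exact hu

theorem exists_basis_of_orthonormal {ι : Type*} [Fintype ι] [DecidableEq ι]
    (hneg : ∀ X : 𝔤, X ≠ 0 → killingForm ℝ 𝔤 X X < 0) (v : ι → 𝔤)
    (hv : ∀ i j, killingForm ℝ 𝔤 (v i) (v j) = if i = j then -1 else 0)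
    (hs : ∀ u, (∀ i, killingForm ℝ 𝔤 (v i) u = 0) → u = 0) :
    ∃ e : Module.Basis ι ℝ 𝔤, ∀ i, e i = v i := by
  have hli : LinearIndependent ℝ v := by
    rw [Fintype.linearIndependent_iff]
    intro a ha i
    have h := congrArg (fun w => killingForm ℝ 𝔤 w (v i)) ha
    simpa [map_sum, LinearMap.sum_apply, hv] using h
  have hspan : ⊤ ≤ Submodule.span ℝ (Set.range v) := by
    have h1 : killingOrthogonal (Submodule.span ℝ (Set.range v)) = ⊥ := by
      rw [eq_bot_iff]
      intro u hu
      exact hs u fun i => killingForm_eq_zero (Submodule.subset_span (Set.mem_range_self i)) hu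
    have h2 : _ ⊔ killingOrthogonal (Submodule.span ℝ (Set.range v)) = ⊤ :=
      (isCompl_killingOrthogonal hneg (Submodule.span ℝ (Set.range v))).sup_eq_top
    rw [h1, sup_bot_eq] at h2
    exact h2.ge
  exact ⟨Module.Basis.mk hli hspan, fun i => Module.Basis.mk_apply hli hspan i⟩

/-- A Killing-orthonormal basis adapted to a subspace and its orthogonal complement. -/
structure IsAdaptedBasis {α κ : Type*} [DecidableEq α] [DecidableEq κ] (𝔨 : Submodule ℝ 𝔤)
    (e : Module.Basis (α ⊕ κ) ℝ 𝔤) : Prop where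
  orthonormal : IsKillingOrthonormal e
  inl_mem : ∀ a, e (inl a) ∈ killingOrthogonal 𝔨
  inr_mem : ∀ z, e (inr z) ∈ 𝔨

/-- T is diagonalised separately on 𝔨 and on its complement, and `hcross` makes the union diagonal.
-/
theorem exists_isAdaptedBasis (hneg : ∀ X : 𝔤, X ≠ 0 → killingForm ℝ 𝔤 X X < 0)
    (𝔨 : Submodule ℝ 𝔤) (T : LinearMap.BilinForm ℝ 𝔤) (hT : ∀ x y, T x y = T y x)
    (hcross : ∀ x ∈ killingOrthogonal 𝔨, ∀ y ∈ 𝔨, T x y = 0) :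
    ∃ (e : Module.Basis (Fin (Module.finrank ℝ (killingOrthogonal 𝔨)) ⊕ Fin (Module.finrank ℝ 𝔨))
      ℝ 𝔤) (τ : _ → ℝ), IsAdaptedBasis 𝔨 e ∧
        ∀ i j, T (e i) (e j) = if i = j then τ i else 0 := by
  have hsub : ∀ U : Submodule ℝ 𝔤, ∃ (b : Fin (Module.finrank ℝ U) → 𝔤) (τ : _ → ℝ),
      (∀ i, b i ∈ U) ∧ (∀ i j, killingForm ℝ 𝔤 (b i) (b j) = if i = j then -1 else 0) ∧
      (∀ i j, T (b i) (b j) = if i = j then τ i else 0) ∧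
      ∀ u ∈ U, (∀ i, killingForm ℝ 𝔤 (b i) u = 0) → u = 0 := by
    intro U
    obtain ⟨b, τ, h1, h2⟩ := LinearMap.BilinForm.exists_orthonormal_diagonal
      (-((killingForm ℝ 𝔤).restrict U)) (T.restrict U)
      (fun x y => by simp [killingForm_comm (x : 𝔤)])
      (fun x hx => by
        have := hneg x (by simpa using hx)
        simpa using this)
      (fun x y => by simp [hT (x : 𝔤)])
    have h1' : ∀ i j, killingForm ℝ 𝔤 (b i) (b j) = if i = j then -1 else 0 := by
      intro i j
      have := h1 i j
      simp only [LinearMap.neg_apply, LinearMap.BilinForm.restrict_apply,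
        LinearMap.domRestrict_apply] at this
      split_ifs at this ⊢ <;> linarith
    refine ⟨fun i => b i, τ, fun i => (b i).2, h1', fun i j => h2 i j, ?_⟩
    intro u hu h
    have h3 := b.sum_repr ⟨u, hu⟩
    have h4 : ∀ i, b.repr ⟨u, hu⟩ i = 0 := by
      intro i
      have h5 := h i
      have h6 : u = ∑ j, b.repr ⟨u, hu⟩ j • (b j : 𝔤) := by
        have := congrArg U.subtype h3
        simp only [map_sum, map_smul, Submodule.subtype_apply] at this
        exact this.symm
      rw [h6, map_sum] at h5
      simpa [h1'] using h5
    have h7 : (⟨u, hu⟩ : U) = 0 := by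
      rw [← h3]
      simp [h4]
    exact congrArg Subtype.val h7
  obtain ⟨b, τ, hb, hb1, hb2, hb3⟩ := hsub (killingOrthogonal 𝔨)
  obtain ⟨b', τ', hb', hb1', hb2', hb3'⟩ := hsub 𝔨
  obtain ⟨e, he⟩ := exists_basis_of_orthonormal hneg (Sum.elim b b')
    (by
      rintro (i | i) (j | j)
      · simp [hb1]
      · simp [killingForm_eq_zero' (hb i) (hb' j)]
      · simp [killingForm_eq_zero (hb' i) (hb j)]
      · simp [hb1'])
    (by
      intro u hu
      obtain ⟨x, hx, y, hy, rfl⟩ := exists_add_eq hneg 𝔨 u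
      have hx0 : x = 0 := hb3' x hx fun i => by
        have := hu (inr i)
        rwa [Sum.elim_inr, map_add, killingForm_eq_zero (hb' i) hy, add_zero] at this
      have hy0 : y = 0 := hb3 y hy fun i => by
        have := hu (inl i)
        rwa [Sum.elim_inl, map_add, killingForm_eq_zero' (hb i) hx, zero_add] at this
      rw [hx0, hy0, add_zero])
  refine ⟨e, Sum.elim τ τ', ⟨fun i j => ?_, fun a => ?_, fun z => ?_⟩, ?_⟩
  · rw [he, he]
    rcases i with i | i <;> rcases j with j | j
    · simp [hb1]
    · simp [killingForm_eq_zero' (hb i) (hb' j)]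
    · simp [killingForm_eq_zero (hb' i) (hb j)]
    · simp [hb1']
  · rw [he]; exact hb a
  · rw [he]; exact hb' z
  · intro i j
    rw [he, he]
    rcases i with i | i <;> rcases j with j | j
    · simp [hb2]
    · simp [hcross _ (hb i) _ (hb' j)]
    · simp [hT (b' i), hcross _ (hb j) _ (hb' i)]
    · simp [hb2']

end LeftInvariant

/-! ### Invariant forms on a semisimple Lie algebra -/

section Semisimple

variable {L : Type*} [LieRing L] [LieAlgebra ℝ L] [LieAlgebra.IsSemisimple ℝ L]

namespace LieAlgebra.IsSemisimple

theorem mem_of_isAtom_le (N : Submodule ℝ L)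
    (h : ∀ J : LieIdeal ℝ L, IsAtom J → ∀ x ∈ J, x ∈ N) (x : L) : x ∈ N := by
  have h1 : x ∈ (sSup {J : LieIdeal ℝ L | IsAtom J}) := by
    rw [sSup_atoms_eq_top]
    trivial
  rw [← LieSubmodule.mem_toSubmodule, LieSubmodule.sSup_toSubmodule] at h1
  refine (sSup_le ?_ : _ ≤ N) h1
  rintro _ ⟨J, hJ, rfl⟩ y hy
  exact h J hJ y hy

/-- A simple ideal is not abelian, so an ideal containing its brackets cannot vanish. -/
theorem eq_of_forall_lie_mem {J N : LieIdeal ℝ L} (hJ : IsAtom J) (hN : N ≤ J)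
    (h : ∀ u ∈ J, ∀ v ∈ J, ⁅u, v⁆ ∈ N) : N = J := by
  rcases hJ.le_iff.mp hN with h0 | h0
  · exfalso
    apply non_abelian_of_isAtom J hJ
    constructor
    rintro ⟨u, hu⟩ ⟨v, hv⟩
    have h1 := h u hu v hv
    rw [h0, LieSubmodule.mem_bot] at h1
    exact Subtype.ext h1
  · exact h0

variable {T Q : LinearMap.BilinForm ℝ L}

/-- Distinct simple ideals are orthogonal for every invariant form. -/
theorem invariant_eq_zero (hT : ∀ z x y : L, T ⁅z, x⁆ y + T x ⁅z, y⁆ = 0) {J J' : LieIdeal ℝ L}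
    (hJ : IsAtom J) (hJ' : IsAtom J') (hne : J ≠ J') {x y : L} (hx : x ∈ J) (hy : y ∈ J') :
    T x y = 0 := by
  -- By invariance `N` is an ideal. It contains [J, J] because [J, J'] ⊆ J ∩ J' = 0.
  let N : LieIdeal ℝ L :=
    { carrier := {x | x ∈ J ∧ ∀ y ∈ J', T x y = 0}
      add_mem' := fun {a b} ha hb => ⟨J.add_mem ha.1 hb.1, fun y hy => by
        rw [map_add, LinearMap.add_apply, ha.2 y hy, hb.2 y hy, add_zero]⟩
      zero_mem' := ⟨J.zero_mem, fun y _ => by simp⟩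
      smul_mem' := fun r a ha => ⟨J.smul_mem r ha.1, fun y hy => by
        rw [map_smul, LinearMap.smul_apply, ha.2 y hy, smul_zero]⟩
      lie_mem := fun {z a} ha => ⟨lie_mem_right ℝ L J z a ha.1, fun y hy => by
        have h := hT z a y
        rw [ha.2 _ (lie_mem_right ℝ L J' z y hy), add_zero] at h
        exact h⟩ }
  have hN : N = J := by
    refine eq_of_forall_lie_mem hJ (fun x hx => hx.1) fun u hu v hv =>
      ⟨lie_mem_right ℝ L J u v hv, fun y hy => ?_⟩
    have h := hT u v y
    have h1 : ⁅u, y⁆ ∈ J ⊓ J' := ⟨lie_mem_left ℝ L J u y hu, lie_mem_right ℝ L J' u y hy⟩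
    rw [(IsAtom.disjoint_of_ne hJ hJ' hne).eq_bot, LieSubmodule.mem_bot] at h1
    rw [h1, map_zero, add_zero] at h
    exact h
  rw [← hN] at hx
  exact hx.2 y hy

/-- Invariant forms which agree on the simple ideals are equal. -/
theorem invariant_ext (hT : ∀ z x y : L, T ⁅z, x⁆ y + T x ⁅z, y⁆ = 0)
    (hQ : ∀ z x y : L, Q ⁅z, x⁆ y + Q x ⁅z, y⁆ = 0)
    (h : ∀ J : LieIdeal ℝ L, IsAtom J → ∀ x ∈ J, ∀ y ∈ J, T x y = Q x y) (x y : L) :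
    T x y = Q x y := by
  refine mem_of_isAtom_le (LinearMap.eqLocus (T.flip y) (Q.flip y)) (fun J hJ x hx => ?_) x
  change T x y = Q x y
  refine mem_of_isAtom_le (LinearMap.eqLocus (T x) (Q x)) (fun J' hJ' y hy => ?_) y
  change T x y = Q x y
  by_cases hne : J = J'
  · subst hne
    exact h J hJ x hx y hy
  · rw [invariant_eq_zero hT hJ hJ' hne hx hy, invariant_eq_zero hQ hJ hJ' hne hx hy]

/-- An invariant symmetric form is a multiple of any invariant inner product on a simple ideal. -/
theorem invariant_isAtom [FiniteDimensional ℝ L] (hT : ∀ z x y : L, T ⁅z, x⁆ y + T x ⁅z, y⁆ = 0)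
    (hTs : ∀ x y, T x y = T y x) (hQ : ∀ z x y : L, Q ⁅z, x⁆ y + Q x ⁅z, y⁆ = 0)
    (hQs : ∀ x y, Q x y = Q y x) (hpos : ∀ x, x ≠ 0 → 0 < Q x x) {J : LieIdeal ℝ L}
    (hJ : IsAtom J) : ∃ τ : ℝ, ∀ x ∈ J, ∀ y ∈ J, T x y = τ * Q x y := by
  let U : Submodule ℝ L := J.toSubmodule
  obtain ⟨b, τ, h1, h2⟩ := LinearMap.BilinForm.exists_orthonormal_diagonal
    (Q.restrict U) (T.restrict U) (fun x y => hQs x y)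
    (fun x hx => hpos x (by simpa using hx)) (fun x y => hTs x y)
  have hU : U ≠ ⊥ := fun h => hJ.1 ((LieSubmodule.toSubmodule_eq_bot J).mp h)
  have hn : 0 < Module.finrank ℝ U := by
    rw [Module.finrank_pos_iff]
    exact Submodule.nontrivial_iff_ne_bot.mpr hU
  let i₀ : Fin (Module.finrank ℝ U) := ⟨0, hn⟩
  -- An eigenspace of T relative to Q in J. Invariance makes it an ideal, and it contains the
  -- eigenvector `b i₀`.
  let N : LieIdeal ℝ L :=
    { carrier := {x | x ∈ J ∧ ∀ y ∈ J, T x y = τ i₀ * Q x y}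
      add_mem' := fun {a b} ha hb => ⟨J.add_mem ha.1 hb.1, fun y hy => by
        rw [map_add, LinearMap.add_apply, ha.2 y hy, hb.2 y hy, map_add, LinearMap.add_apply]
        ring⟩
      zero_mem' := ⟨J.zero_mem, fun y _ => by simp⟩
      smul_mem' := fun r a ha => ⟨J.smul_mem r ha.1, fun y hy => by
        rw [map_smul, LinearMap.smul_apply, ha.2 y hy, map_smul, LinearMap.smul_apply, smul_eq_mul,
          smul_eq_mul]
        ring⟩
      lie_mem := fun {z a} ha => ⟨lie_mem_right ℝ L J z a ha.1, fun y hy => by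
        have h := hT z a y
        have h' := hQ z a y
        rw [ha.2 _ (lie_mem_right ℝ L J z y hy)] at h
        linear_combination h - τ i₀ * h'⟩ }
  have hmem : (b i₀ : L) ∈ N := by
    refine ⟨(b i₀).2, fun y hy => ?_⟩
    have h3 : T.restrict U (b i₀) = τ i₀ • Q.restrict U (b i₀) := by
      apply b.ext
      intro j
      rw [h2, LinearMap.smul_apply, h1]
      split_ifs <;> simp
    exact LinearMap.congr_fun h3 ⟨y, hy⟩
  have hN : N = J := by
    rcases hJ.le_iff.mp (show N ≤ J from fun x hx => hx.1) with h0 | h0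
    · exfalso
      rw [h0, LieSubmodule.mem_bot] at hmem
      exact b.ne_zero i₀ (Subtype.ext hmem)
    · exact h0
  refine ⟨τ i₀, fun x hx y hy => ?_⟩
  rw [← hN] at hx
  exact hx.2 y hy

end LieAlgebra.IsSemisimple

end Semisimple

/-! ### Isotropy irreducible pairs at the Lie algebra level and Schur's lemma. -/

namespace LeftInvariant

open Sum

variable {𝔤 : Type*} [LieRing 𝔤] [LieAlgebra ℝ 𝔤] [FiniteDimensional ℝ 𝔤]
  {L : Type*} [LieRing L] [LieAlgebra ℝ L]

/-- The image of a homomorphism of Lie algebras, as a subspace. -/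
abbrev imageOf (φ : L →ₗ⁅ℝ⁆ 𝔤) : Submodule ℝ 𝔤 := LinearMap.range (φ : L →ₗ[ℝ] 𝔤)

/-- The infinitesimal data of an isotropy irreducible space `H/K`: a compact simple Lie algebra `𝔤`,
an embedded semisimple subalgebra `L`, and the isotropy representation `S`. -/
structure IsIsotropyIrreducible (φ : L →ₗ⁅ℝ⁆ 𝔤) (S : Set (𝔤 →ₗ[ℝ] 𝔤)) (c : ℝ) : Prop where
  simple : LieAlgebra.IsSimple ℝ 𝔤
  neg : ∀ X : 𝔤, X ≠ 0 → killingForm ℝ 𝔤 X X < 0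
  semisimple : LieAlgebra.IsSemisimple ℝ L
  injective : Function.Injective φ
  equiv : ∀ s ∈ S, ∃ σ : 𝔤 ≃ₗ⁅ℝ⁆ 𝔤, ∀ x, σ x = s x
  map_isAtom : ∀ s ∈ S, ∀ J : LieIdeal ℝ L, IsAtom J → ∀ x ∈ J, ∃ y ∈ J, φ y = s (φ x)
  invariant : ∀ T ∈ invariantForms S, ∀ z x y, T ⁅φ z, x⁆ y + T x ⁅φ z, y⁆ = 0
  ne_bot : killingOrthogonal (imageOf φ) ≠ ⊥
  irreducible : ∀ W : Submodule ℝ 𝔤, W ≤ killingOrthogonal (imageOf φ) →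
    (∀ s ∈ S, ∀ x ∈ W, s x ∈ W) → W = ⊥ ∨ W = killingOrthogonal (imageOf φ)
  eq_id : Subsingleton L → ∀ s ∈ S, s = LinearMap.id
  killing : ∀ J : LieIdeal ℝ L, IsAtom J → ∀ X Y : J,
    killingForm ℝ J X Y = c * killingForm ℝ 𝔤 (φ X) (φ Y)

namespace IsIsotropyIrreducible

variable {φ : L →ₗ⁅ℝ⁆ 𝔤} {S : Set (𝔤 →ₗ[ℝ] 𝔤)} {c : ℝ}

theorem map_imageOf (h : IsIsotropyIrreducible φ S c) {s : 𝔤 →ₗ[ℝ] 𝔤} (hs : s ∈ S) {x : 𝔤}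
    (hx : x ∈ imageOf φ) : s x ∈ imageOf φ := by
  have := h.semisimple
  obtain ⟨y, rfl⟩ := hx
  refine LieAlgebra.IsSemisimple.mem_of_isAtom_le
    ((imageOf φ).comap (s ∘ₗ (φ : L →ₗ[ℝ] 𝔤))) (fun J hJ x hx => ?_) y
  obtain ⟨y, -, hy⟩ := h.map_isAtom s hs J hJ x hx
  exact ⟨y, hy⟩

/-- `S` is only a set of maps. Finite dimension gives stability under inverses, and invariance of
the Killing form then gives stability of the complement. -/
theorem exists_equiv_of_stable (h : IsIsotropyIrreducible φ S c) {s : 𝔤 →ₗ[ℝ] 𝔤} (hs : s ∈ S)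
    {U : Submodule ℝ 𝔤} (hU : ∀ x ∈ U, s x ∈ U) :
    ∃ σ : 𝔤 ≃ₗ⁅ℝ⁆ 𝔤, (∀ x, σ x = s x) ∧
      (∀ x y, killingForm ℝ 𝔤 (σ x) (σ y) = killingForm ℝ 𝔤 x y) ∧
      (∀ x ∈ U, σ x ∈ U) ∧ (∀ x ∈ U, σ.symm x ∈ U) ∧
      (∀ x ∈ killingOrthogonal U, σ x ∈ killingOrthogonal U) ∧
      (∀ x ∈ killingOrthogonal U, σ.symm x ∈ killingOrthogonal U) := by
  obtain ⟨σ, hσ⟩ := h.equiv s hs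
  have hB : ∀ x y, killingForm ℝ 𝔤 (σ x) (σ y) = killingForm ℝ 𝔤 x y := fun x y =>
    LieAlgebra.killingForm_of_equiv_apply σ x y
  have h1 : ∀ x ∈ U, σ x ∈ U := fun x hx => by
    rw [hσ]; exact hU x hx
  have h2 : ∀ x ∈ U, σ.symm x ∈ U := by
    have hle : U.map (σ.toLinearEquiv : 𝔤 →ₗ[ℝ] 𝔤) ≤ U := by
      rintro _ ⟨x, hx, rfl⟩
      exact h1 x hx
    have heq := Submodule.eq_of_le_of_finrank_eq hle (LinearEquiv.finrank_map_eq σ.toLinearEquiv _)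
    intro x hx
    rw [← heq] at hx
    obtain ⟨y, hy, rfl⟩ := hx
    change σ.symm (σ y) ∈ _
    rwa [LieEquiv.symm_apply_apply]
  refine ⟨σ, hσ, hB, h1, h2, fun x hx => ?_, fun x hx => ?_⟩
  · refine LinearMap.BilinForm.mem_orthogonal_iff.mpr fun y hy => ?_
    have h3 := killingForm_eq_zero (h2 y hy) hx
    rw [← hB, LieEquiv.apply_symm_apply] at h3
    exact h3
  · refine LinearMap.BilinForm.mem_orthogonal_iff.mpr fun y hy => ?_
    have h3 := killingForm_eq_zero (h1 y hy) hx
    rw [← σ.apply_symm_apply x, hB] at h3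
    exact h3

theorem exists_equiv (h : IsIsotropyIrreducible φ S c) {s : 𝔤 →ₗ[ℝ] 𝔤} (hs : s ∈ S) :
    ∃ σ : 𝔤 ≃ₗ⁅ℝ⁆ 𝔤, (∀ x, σ x = s x) ∧
      (∀ x y, killingForm ℝ 𝔤 (σ x) (σ y) = killingForm ℝ 𝔤 x y) ∧
      (∀ x ∈ imageOf φ, σ x ∈ imageOf φ) ∧ (∀ x ∈ imageOf φ, σ.symm x ∈ imageOf φ) ∧
      (∀ x ∈ killingOrthogonal (imageOf φ), σ x ∈ killingOrthogonal (imageOf φ)) ∧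
      (∀ x ∈ killingOrthogonal (imageOf φ), σ.symm x ∈ killingOrthogonal (imageOf φ)) :=
  h.exists_equiv_of_stable hs fun _ hx => h.map_imageOf hs hx

theorem lie_mem_imageOf {x y : 𝔤} (hx : x ∈ imageOf φ) (hy : y ∈ imageOf φ) :
    ⁅x, y⁆ ∈ imageOf φ := by
  obtain ⟨x, rfl⟩ := hx
  obtain ⟨y, rfl⟩ := hy
  exact ⟨⁅x, y⁆, φ.map_lie x y⟩

theorem lie_mem_orthogonal {x y : 𝔤} (hx : x ∈ imageOf φ)
    (hy : y ∈ killingOrthogonal (imageOf φ)) : ⁅x, y⁆ ∈ killingOrthogonal (imageOf φ) := by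
  refine LinearMap.BilinForm.mem_orthogonal_iff.mpr fun z hz => ?_
  have h1 := killingForm_lie_add x z y
  rw [killingForm_eq_zero (lie_mem_imageOf hx hz) hy, zero_add] at h1
  exact h1

/-- `𝔨` acts faithfully on `𝔞`. -/
theorem eq_zero_of_lie_eq_zero (h : IsIsotropyIrreducible φ S c) {u : 𝔤} (hu : u ∈ imageOf φ)
    (h0 : ∀ x ∈ killingOrthogonal (imageOf φ), ⁅u, x⁆ = 0) : u = 0 := by
  have := h.simple
  -- The kernel of 𝔨 on 𝔞. It also commutes with 𝔞, so it is an ideal of 𝔤, and it is proper because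
  -- 𝔞 ≠ 0.
  let N : LieIdeal ℝ 𝔤 :=
    { carrier := {u | u ∈ imageOf φ ∧ ∀ x ∈ killingOrthogonal (imageOf φ), ⁅u, x⁆ = 0}
      add_mem' := fun {a b} ha hb => ⟨Submodule.add_mem _ ha.1 hb.1, fun y hy => by
        rw [add_lie, ha.2 y hy, hb.2 y hy, add_zero]⟩
      zero_mem' := ⟨Submodule.zero_mem _, fun y _ => by simp⟩
      smul_mem' := fun r a ha => ⟨Submodule.smul_mem _ r ha.1, fun y hy => by
        rw [smul_lie, ha.2 y hy, smul_zero]⟩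
      lie_mem := fun {z a} ha => by
        obtain ⟨k, hk, p, hp, rfl⟩ := exists_add_eq h.neg (imageOf φ) z
        have h1 : ⁅p, a⁆ = 0 := by rw [← lie_skew, ha.2 p hp, neg_zero]
        rw [add_lie, h1, add_zero]
        refine ⟨lie_mem_imageOf hk ha.1, fun x hx => ?_⟩
        rw [lie_lie, ha.2 x hx, ha.2 _ (lie_mem_orthogonal hk hx), lie_zero, sub_zero] }
  have hN : N ≠ ⊤ := by
    intro htop
    apply h.ne_bot
    rw [eq_bot_iff]
    intro x hx
    have h1 : x ∈ N := by rw [htop]; trivial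
    by_contra h2
    exact (h.neg x h2).ne (killingForm_eq_zero h1.1 hx)
  have hbot : N = ⊥ := (LieAlgebra.IsSimple.eq_bot_or_eq_top N).resolve_right hN
  have hmem : u ∈ N := ⟨hu, h0⟩
  rwa [hbot, LieSubmodule.mem_bot] at hmem

/-- Schur's lemma for invariant symmetric forms on `𝔞`. -/
theorem schur (h : IsIsotropyIrreducible φ S c) (R : LinearMap.BilinForm ℝ 𝔤)
    (hR : ∀ x y, R x y = R y x)
    (hinv : ∀ s ∈ S, ∀ x ∈ killingOrthogonal (imageOf φ), ∀ y ∈ killingOrthogonal (imageOf φ),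
      R (s x) (s y) = R x y) :
    ∃ l : ℝ, ∀ x ∈ killingOrthogonal (imageOf φ), ∀ y ∈ killingOrthogonal (imageOf φ),
      R x y = l * (-killingForm ℝ 𝔤 x y) := by
  set U := killingOrthogonal (imageOf φ) with hU
  obtain ⟨b, τ, h1, h2⟩ := LinearMap.BilinForm.exists_orthonormal_diagonal
    (-((killingForm ℝ 𝔤).restrict U)) (R.restrict U)
    (fun x y => by simp [killingForm_comm (x : 𝔤)])
    (fun x hx => by
      have := h.neg x (by simpa using hx)
      simpa using this)
    (fun x y => hR x y)
  have hn : 0 < Module.finrank ℝ U := by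
    rw [Module.finrank_pos_iff]
    exact Submodule.nontrivial_iff_ne_bot.mpr h.ne_bot
  let i₀ : Fin (Module.finrank ℝ U) := ⟨0, hn⟩
  -- A symmetric form has a real eigenvalue relative to -B, and the corresponding eigenspace in 𝔞 is
  -- stable under `S`.
  let W : Submodule ℝ 𝔤 :=
    { carrier := {x | x ∈ U ∧ ∀ y ∈ U, R x y = τ i₀ * (-killingForm ℝ 𝔤 x y)}
      add_mem' := fun {a b} ha hb => ⟨U.add_mem ha.1 hb.1, fun y hy => by
        rw [map_add, LinearMap.add_apply, ha.2 y hy, hb.2 y hy, map_add, LinearMap.add_apply]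
        ring⟩
      zero_mem' := ⟨U.zero_mem, fun y _ => by simp⟩
      smul_mem' := fun r a ha => ⟨U.smul_mem r ha.1, fun y hy => by
        rw [map_smul, LinearMap.smul_apply, ha.2 y hy, map_smul, LinearMap.smul_apply, smul_eq_mul,
          smul_eq_mul]
        ring⟩ }
  have hmem : (b i₀ : 𝔤) ∈ W := by
    refine ⟨(b i₀).2, fun y hy => ?_⟩
    have h3 : R.restrict U (b i₀) = τ i₀ • (-((killingForm ℝ 𝔤).restrict U)) (b i₀) := by
      apply b.ext
      intro j
      rw [h2, LinearMap.smul_apply, h1]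
      split_ifs <;> simp
    exact LinearMap.congr_fun h3 ⟨y, hy⟩
  have hW : W = U := by
    rcases h.irreducible W (fun x hx => hx.1) (by
      intro s hs x hx
      obtain ⟨σ, hσ, hB, -, -, ho, ho'⟩ := h.exists_equiv hs
      have hmap : ∀ x ∈ U, s x ∈ U := fun x hx => by rw [← hσ]; exact ho x hx
      refine ⟨hmap x hx.1, fun y hy => ?_⟩
      have h3 : s (σ.symm y) = y := by rw [← hσ, LieEquiv.apply_symm_apply]
      rw [← h3, hinv s hs x hx.1 _ (ho' y hy), hx.2 _ (ho' y hy), ← hσ, ← hσ, hB]) with h0 | h0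
    · exfalso
      rw [h0, Submodule.mem_bot] at hmem
      exact b.ne_zero i₀ (Subtype.ext hmem)
    · exact h0
  refine ⟨τ i₀, fun x hx y hy => ?_⟩
  rw [← hW] at hx
  exact hx.2 y hy

/-- Both sides are invariant forms, so agreement on the simple ideals suffices. -/
theorem killingForm_apply (h : IsIsotropyIrreducible φ S c) [FiniteDimensional ℝ L] (X Y : L) :
    killingForm ℝ L X Y = c * killingForm ℝ 𝔤 (φ X) (φ Y) := by
  have := h.semisimple
  let Q : LinearMap.BilinForm ℝ L := c • (killingForm ℝ 𝔤).compl₁₂ (φ : L →ₗ[ℝ] 𝔤) (φ : L →ₗ[ℝ] 𝔤)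
  have key := LieAlgebra.IsSemisimple.invariant_ext (T := killingForm ℝ L) (Q := Q)
    (fun z x y => killingForm_lie_add z x y)
    (fun z x y => by
      have h1 := killingForm_lie_add (φ z) (φ x) (φ y)
      simp only [Q, LinearMap.smul_apply, LinearMap.compl₁₂_apply, LieHom.coe_toLinearMap,
        LieHom.map_lie, smul_eq_mul, ← mul_add, h1, mul_zero])
    (fun J hJ x hx y hy => by
      have h1 := h.killing J hJ ⟨x, hx⟩ ⟨y, hy⟩
      rw [LieIdeal.killingForm_eq] at h1
      exact h1)
  exact key X Y

end IsIsotropyIrreducible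

end LeftInvariant

/-! ### Constants of an adapted frame: existence of C, and 0 < c < 1. -/

namespace LeftInvariant

open Sum

variable {𝔤 : Type*} [LieRing 𝔤] [LieAlgebra ℝ 𝔤] [FiniteDimensional ℝ 𝔤]
  {L : Type*} [LieRing L] [LieAlgebra ℝ L]
  {α κ : Type*} [Fintype α] [DecidableEq α] [Fintype κ] [DecidableEq κ]

namespace IsAdaptedBasis

variable {𝔨 : Submodule ℝ 𝔤} {e : Module.Basis (α ⊕ κ) ℝ 𝔤}

theorem eq_sum_inr (he : IsAdaptedBasis 𝔨 e) {x : 𝔤} (hx : x ∈ 𝔨) :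
    x = ∑ z, (-killingForm ℝ 𝔤 x (e (inr z))) • e (inr z) := by
  have h := he.orthonormal.eq_sum x
  rw [Fintype.sum_sum_type] at h
  simpa only [killingForm_eq_zero hx (he.inl_mem _), neg_zero, zero_smul, Finset.sum_const_zero,
    zero_add] using h

theorem eq_sum_inl (he : IsAdaptedBasis 𝔨 e) {x : 𝔤} (hx : x ∈ killingOrthogonal 𝔨) :
    x = ∑ a, (-killingForm ℝ 𝔤 x (e (inl a))) • e (inl a) := by
  have h := he.orthonormal.eq_sum x
  rw [Fintype.sum_sum_type] at h
  simpa only [killingForm_eq_zero' hx (he.inr_mem _), neg_zero, zero_smul, Finset.sum_const_zero,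
    add_zero] using h

/-- The trace of a bilinear form over an orthonormal basis of `𝔨` does not depend on the basis. -/
theorem sum_equiv (he : IsAdaptedBasis 𝔨 e) {σ : 𝔤 ≃ₗ⁅ℝ⁆ 𝔤}
    (hB : ∀ x y, killingForm ℝ 𝔤 (σ x) (σ y) = killingForm ℝ 𝔤 x y)
    (h1 : ∀ x ∈ 𝔨, σ x ∈ 𝔨) (h2 : ∀ x ∈ 𝔨, σ.symm x ∈ 𝔨) (Ψ : LinearMap.BilinForm ℝ 𝔤) :
    ∑ z, Ψ (σ.symm (e (inr z))) (σ.symm (e (inr z))) = ∑ z, Ψ (e (inr z)) (e (inr z)) := by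
  set O : κ → κ → ℝ := fun z w => -killingForm ℝ 𝔤 (σ.symm (e (inr z))) (e (inr w)) with hO
  have hsum : ∀ z, σ.symm (e (inr z)) = ∑ w, O z w • e (inr w) := fun z =>
    he.eq_sum_inr (h2 _ (he.inr_mem z))
  have hO' : ∀ z w, O z w = -killingForm ℝ 𝔤 (σ (e (inr w))) (e (inr z)) := by
    intro z w
    have h := hB (σ.symm (e (inr z))) (e (inr w))
    rw [LieEquiv.apply_symm_apply] at h
    rw [killingForm_comm, h]
  have horth : ∀ w v, ∑ z, O z w * O z v = if w = v then 1 else 0 := by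
    intro w v
    have h3 := he.eq_sum_inr (h1 _ (he.inr_mem w))
    have h4 := congrArg (fun u => -killingForm ℝ 𝔤 (σ (e (inr v))) u) h3
    simp only [map_sum, map_smul, smul_eq_mul, hB, ← hO'] at h4
    rw [he.orthonormal] at h4
    rw [← neg_inj] at h4
    have h5 : ∑ z, O z w * O z v =
        -∑ z, O z w * (killingForm ℝ 𝔤 (σ (e (inr v)))) (e (inr z)) := by
      rw [← Finset.sum_neg_distrib]
      refine Finset.sum_congr rfl fun z _ => ?_
      rw [hO' z v]
      ring
    rw [h5, ← neg_neg (∑ _, _), ← h4]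
    by_cases hwv : w = v
    · simp [hwv]
    · simp [hwv, Ne.symm hwv]
  have hexp : ∀ z, Ψ (σ.symm (e (inr z))) (σ.symm (e (inr z))) =
      ∑ w, ∑ v, O z w * O z v * Ψ (e (inr w)) (e (inr v)) := by
    intro z
    rw [hsum z]
    simp only [map_sum, LinearMap.sum_apply, map_smul, LinearMap.smul_apply, smul_eq_mul]
    rw [Finset.sum_comm]
    refine Finset.sum_congr rfl fun w _ => ?_
    rw [Finset.mul_sum]
    refine Finset.sum_congr rfl fun v _ => ?_
    ring
  simp only [hexp]
  rw [Finset.sum_comm]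
  refine Finset.sum_congr rfl fun w _ => ?_
  rw [Finset.sum_comm]
  simp only [← Finset.sum_mul, horth]
  simp

end IsAdaptedBasis

namespace IsIsotropyIrreducible

variable {φ : L →ₗ⁅ℝ⁆ 𝔤} {S : Set (𝔤 →ₗ[ℝ] 𝔤)} {c : ℝ} {e : Module.Basis (α ⊕ κ) ℝ 𝔤}

/-- The form R is the Casimir of 𝔨. It does not depend on the orthonormal basis of 𝔨 (`sum_equiv`),
so it is invariant and Schur's lemma provides C. Lifting the frame of 𝔨 to a basis of `L` gives the
identity with c. -/
theorem exists_isIsotropyFrame (h : IsIsotropyIrreducible φ S c) [FiniteDimensional ℝ L]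
    (he : IsAdaptedBasis (imageOf φ) e) : ∃ C, IsIsotropyFrame e c C := by
  have hsub : ∀ z w a, structureConst e (inr z) (inr w) (inl a) = 0 := fun z w a => by
    rw [structureConst, killingForm_eq_zero (lie_mem_imageOf (he.inr_mem z) (he.inr_mem w))
      (he.inl_mem a), neg_zero]
  have hsub' : ∀ z a w, structureConst e (inr z) (inl a) (inr w) = 0 := fun z a w => by
    rw [structureConst_antisymm₂, hsub, neg_zero]
  let R : LinearMap.BilinForm ℝ 𝔤 := ∑ z, (-(killingForm ℝ 𝔤)).compl₁₂
    (LieAlgebra.ad ℝ 𝔤 (e (inr z))) (LieAlgebra.ad ℝ 𝔤 (e (inr z)))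
  have hR : ∀ x y, R x y = -∑ z, killingForm ℝ 𝔤 ⁅e (inr z), x⁆ ⁅e (inr z), y⁆ := by
    intro x y
    simp [R, LinearMap.sum_apply]
  have hflip : ∀ u x y, killingForm ℝ 𝔤 ⁅u, x⁆ ⁅u, y⁆ = killingForm ℝ 𝔤 ⁅x, u⁆ ⁅y, u⁆ := by
    intro u x y
    rw [← lie_skew x u, ← lie_skew y u]
    simp only [map_neg, LinearMap.neg_apply, neg_neg]
  obtain ⟨C, hC⟩ := h.schur R (fun x y => by
      rw [hR, hR]
      simp only [killingForm_comm])
    (fun s hs x _ y _ => by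
      obtain ⟨σ, hσ, hB, h1, h2, -, -⟩ := h.exists_equiv hs
      rw [hR, hR, neg_inj, ← hσ, ← hσ]
      have key := he.sum_equiv hB h1 h2
        ((killingForm ℝ 𝔤).compl₁₂ (LieAlgebra.ad ℝ 𝔤 x) (LieAlgebra.ad ℝ 𝔤 y))
      simp only [LinearMap.compl₁₂_apply, LieAlgebra.ad_apply] at key
      simp only [hflip _ x y]
      rw [← key]
      refine Finset.sum_congr rfl fun z _ => ?_
      rw [← hflip, ← hB ⁅σ.symm (e (inr z)), x⁆ ⁅σ.symm (e (inr z)), y⁆, LieEquiv.map_lie, LieEquiv.map_lie, LieEquiv.apply_symm_apply])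
  refine ⟨C, he.orthonormal, hsub, ?_, ?_⟩
  · choose x hx using he.inr_mem
    have hx' : ∀ z, φ (x z) = e (inr z) := hx
    have hli : LinearIndependent ℝ x := by
      refine LinearIndependent.of_comp (φ : L →ₗ[ℝ] 𝔤) ?_
      have h1 : (φ : L →ₗ[ℝ] 𝔤) ∘ x = e ∘ inr := funext hx
      rw [h1]
      exact e.linearIndependent.comp _ inr_injective
    have hspan : ⊤ ≤ Submodule.span ℝ (Set.range x) := by
      intro y _
      have h1 := he.eq_sum_inr (x := φ y) ⟨y, rfl⟩
      have h2 : y = ∑ z, (-killingForm ℝ 𝔤 (φ y) (e (inr z))) • x z := by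
        apply h.injective
        have h3 : ∀ v, φ v = (φ : L →ₗ[ℝ] 𝔤) v := fun _ => rfl
        rw [h3 (∑ _, _), map_sum]
        simp only [map_smul, hx]
        exact h1
      rw [h2]
      exact Submodule.sum_mem _ fun z _ =>
        Submodule.smul_mem _ _ (Submodule.subset_span (Set.mem_range_self z))
    let b : Module.Basis κ ℝ L := Module.Basis.mk hli hspan
    have hb : ∀ z, b z = x z := fun z => Module.Basis.mk_apply hli hspan z
    have hlie : ∀ z w, ⁅x z, x w⁆ = ∑ v, structureConst e (inr z) (inr w) (inr v) • x v := by
      intro z w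
      apply h.injective
      have h3 : ∀ v, φ v = (φ : L →ₗ[ℝ] 𝔤) v := fun _ => rfl
      rw [h3 (∑ _, _), map_sum]
      simp only [map_smul, hx]
      rw [LieHom.map_lie, hx', hx']
      exact he.eq_sum_inr (lie_mem_imageOf (he.inr_mem z) (he.inr_mem w))
    intro z z'
    have hk := h.killingForm_apply (x z) (x z')
    rw [hx', hx', he.orthonormal, killingForm_apply_apply, LinearMap.trace_eq_matrix_trace ℝ b,
      Matrix.trace] at hk
    have h4 : ∀ w, Matrix.diag (LinearMap.toMatrix b b (LieAlgebra.ad ℝ L (x z) ∘ₗ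
        LieAlgebra.ad ℝ L (x z'))) w = -∑ v, structureConst e (inr z) (inr w) (inr v) *
          structureConst e (inr z') (inr w) (inr v) := by
      intro w
      rw [Matrix.diag, LinearMap.toMatrix_apply, LinearMap.comp_apply, LieAlgebra.ad_apply,
        LieAlgebra.ad_apply, hb, hlie]
      simp only [lie_sum, lie_smul, hlie]
      simp only [← hb, map_sum, map_smul, Finsupp.coe_finsetSum,
        Finset.sum_apply, Finsupp.coe_smul, Pi.smul_apply, Module.Basis.repr_self, smul_eq_mul]
      rw [← Finset.sum_neg_distrib]
      refine Finset.sum_congr rfl fun v _ => ?_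
      rw [structureConst_antisymm₂ (inr z) (inr w) (inr v)]
      simp [Finsupp.single_apply]
      ring
    simp only [h4, Finset.sum_neg_distrib, inr.injEq] at hk
    split_ifs at hk ⊢ <;> linarith
  · intro a a'
    have h1 := hC _ (he.inl_mem a) _ (he.inl_mem a')
    rw [hR, he.orthonormal] at h1
    simp only [he.orthonormal.killingForm_lie_lie, Fintype.sum_sum_type, hsub', mul_zero,
      Finset.sum_const_zero, add_zero, Finset.sum_neg_distrib, neg_neg, inl.injEq] at h1
    rw [h1]
    split_ifs <;> simp

theorem nonempty_left (h : IsIsotropyIrreducible φ S c) (he : IsAdaptedBasis (imageOf φ) e) :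
    Nonempty α := by
  by_contra hα
  rw [not_nonempty_iff] at hα
  apply h.ne_bot
  rw [eq_bot_iff]
  intro x hx
  rw [he.eq_sum_inl hx]
  simp

/-- If L were trivial, every line would be stable, so 𝔤 would be a line and abelian. -/
theorem nontrivial (h : IsIsotropyIrreducible φ S c) : Nontrivial L := by
  by_contra hL
  rw [not_nontrivial_iff_subsingleton] at hL
  have hS := h.eq_id hL
  have hbot : imageOf φ = ⊥ := by
    rw [eq_bot_iff]
    rintro _ ⟨y, rfl⟩
    rw [Subsingleton.elim y 0, map_zero]
    exact Submodule.zero_mem _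
  have htop : ∀ x, x ∈ killingOrthogonal (imageOf φ) := fun x =>
    LinearMap.BilinForm.mem_orthogonal_iff.mpr fun y hy => by
      rw [hbot, Submodule.mem_bot] at hy
      rw [hy]
      simp
  apply h.simple.non_abelian
  constructor
  intro x y
  by_cases hx : x = 0
  · rw [hx, zero_lie]
  · rcases h.irreducible (ℝ ∙ x) (fun y _ => htop y) (fun s hs y hy => by
      rw [hS s hs]; exact hy) with h0 | h0
    · exact absurd (Submodule.span_singleton_eq_bot.mp h0) hx
    · have hy := htop y
      rw [← h0, Submodule.mem_span_singleton] at hy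
      obtain ⟨r, rfl⟩ := hy
      rw [lie_smul, lie_self, smul_zero]

theorem nonempty_right (h : IsIsotropyIrreducible φ S c) (he : IsAdaptedBasis (imageOf φ) e) :
    Nonempty κ := by
  by_contra hκ
  rw [not_nonempty_iff] at hκ
  have := h.nontrivial
  obtain ⟨x, hx⟩ := exists_ne (0 : L)
  apply hx
  apply h.injective
  rw [he.eq_sum_inr (x := φ x) ⟨x, rfl⟩]
  simp

/-- 1 - c is a sum of squares. If it vanished, a basis vector of 𝔨 would act trivially on 𝔞. -/
theorem lt_one (h : IsIsotropyIrreducible φ S c) (he : IsAdaptedBasis (imageOf φ) e) {C : ℝ}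
    (hf : IsIsotropyFrame e c C) : c < 1 := by
  obtain ⟨z⟩ := h.nonempty_right he
  have h1 := hf.sum_inr z z
  simp only [if_true] at h1
  have h2 : 0 ≤ 1 - c := by
    rw [← h1]
    exact Finset.sum_nonneg fun a _ => Finset.sum_nonneg fun b _ => mul_self_nonneg _
  by_contra hc
  have h3 : 1 - c = 0 := by linarith
  rw [h3, Finset.sum_eq_zero_iff_of_nonneg fun a _ =>
    Finset.sum_nonneg fun b _ => mul_self_nonneg _] at h1
  apply e.ne_zero (inr z)
  refine h.eq_zero_of_lie_eq_zero (he.inr_mem z) fun x hx => ?_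
  rw [he.eq_sum_inl hx, lie_sum]
  refine Finset.sum_eq_zero fun a _ => ?_
  have h4 := h1 a (Finset.mem_univ a)
  rw [Finset.sum_eq_zero_iff_of_nonneg fun b _ => mul_self_nonneg _] at h4
  rw [lie_smul, he.eq_sum_inl (lie_mem_orthogonal (he.inr_mem z) (he.inl_mem a)),
    Finset.sum_eq_zero fun b _ => ?_, smul_zero]
  have h5 : structureConst e (inr z) (inl a) (inl b) = 0 :=
    mul_self_eq_zero.mp (h4 b (Finset.mem_univ b))
  change structureConst e (inr z) (inl a) (inl b) • _ = _
  rw [h5, zero_smul]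

/-- c is a sum of squares of structure constants of 𝔨. If it vanished, `L` would be abelian. -/
theorem pos (h : IsIsotropyIrreducible φ S c) (he : IsAdaptedBasis (imageOf φ) e) {C : ℝ}
    (hf : IsIsotropyFrame e c C) : 0 < c := by
  have hss := h.semisimple
  have hL := h.nontrivial
  have hnn : ∀ z, 0 ≤ ∑ w, ∑ v, structureConst e (inr z) (inr w) (inr v) *
      structureConst e (inr z) (inr w) (inr v) := fun z =>
    Finset.sum_nonneg fun a _ => Finset.sum_nonneg fun b _ => mul_self_nonneg _
  by_contra hc
  have h0 : ∀ z w v, structureConst e (inr z) (inr w) (inr v) = 0 := by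
    intro z w v
    have h1 := hf.killing z z
    simp only [if_true] at h1
    have h3 : c = 0 := le_antisymm (not_lt.mp hc) (h1 ▸ hnn z)
    rw [h3, Finset.sum_eq_zero_iff_of_nonneg fun a _ =>
      Finset.sum_nonneg fun b _ => mul_self_nonneg _] at h1
    have h4 := h1 w (Finset.mem_univ w)
    rw [Finset.sum_eq_zero_iff_of_nonneg fun b _ => mul_self_nonneg _] at h4
    exact mul_self_eq_zero.mp (h4 v (Finset.mem_univ v))
  have hlie : ∀ z w, ⁅e (inr z), e (inr w)⁆ = 0 := by
    intro z w
    rw [he.eq_sum_inr (lie_mem_imageOf (he.inr_mem z) (he.inr_mem w))]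
    refine Finset.sum_eq_zero fun v _ => ?_
    change structureConst e (inr z) (inr w) (inr v) • _ = _
    rw [h0, zero_smul]
  have hab : IsLieAbelian L := by
    constructor
    intro x y
    apply h.injective
    rw [LieHom.map_lie, map_zero, he.eq_sum_inr (x := φ x) ⟨x, rfl⟩,
      he.eq_sum_inr (x := φ y) ⟨y, rfl⟩]
    simp [lie_sum, sum_lie, hlie]
  have : Subsingleton L := LieAlgebra.subsingleton_of_hasTrivialRadical_lie_abelian ℝ L
  exact not_subsingleton L this

end IsIsotropyIrreducible

end LeftInvariant

/-! ### Absence of mixed terms in invariant forms. -/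

namespace LeftInvariant

open Sum

variable {𝔤 : Type*} [LieRing 𝔤] [LieAlgebra ℝ 𝔤] [FiniteDimensional ℝ 𝔤]
  {L : Type*} [LieRing L] [LieAlgebra ℝ L]

/-- If `𝔞` is isometric to `𝔨` as a representation, then `𝔤` is not simple. -/
theorem IsIsotropyFrame.not_isSimple {α : Type*} [Fintype α] [DecidableEq α] [Nonempty α]
    {e : Module.Basis (α ⊕ α) ℝ 𝔤} {c C : ℝ} (he : IsIsotropyFrame e c C)
    (hF : ∀ z a b, structureConst e (inr z) (inl a) (inl b) =
      structureConst e (inr z) (inr a) (inr b)) : ¬LieAlgebra.IsSimple ℝ 𝔤 := by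
  intro hs
  obtain ⟨a₀⟩ := ‹Nonempty α›
  -- Equal structure constants give 1 - c = c and C = c, hence 1 - 2C = 0, and [𝔞, 𝔞] has no
  -- component in 𝔞.
  have hc : c = 1 - c := by
    have h1 := he.sum_inr a₀ a₀
    simp only [hF] at h1
    rw [he.killing] at h1
    simpa using h1
  have hC : C = c := by
    have h1 := he.casimir a₀ a₀
    have h2 := he.killing a₀ a₀
    simp only [if_true] at h1 h2
    rw [← h1, ← h2]
    refine Finset.sum_congr rfl fun z _ => Finset.sum_congr rfl fun b _ => ?_
    rw [hF, structureConst_antisymm₁, neg_mul_neg]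
  have h0 : ∀ a b b', structureConst e (inl a) (inl b) (inl b') = 0 := by
    intro a b b'
    have h1 := he.sum_inl a a
    rw [if_pos rfl, show 1 - 2 * C = 0 by linarith,
      Finset.sum_eq_zero_iff_of_nonneg fun a _ => Finset.sum_nonneg fun b _ => mul_self_nonneg _]
      at h1
    have h2 := h1 b (Finset.mem_univ b)
    rw [Finset.sum_eq_zero_iff_of_nonneg fun b _ => mul_self_nonneg _] at h2
    exact mul_self_eq_zero.mp (h2 b' (Finset.mem_univ b'))
  have h1 : ∀ z a, ⁅e (inr z), e (inl a) - e (inr a)⁆ =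
      ∑ b, structureConst e (inr z) (inr a) (inr b) • (e (inl b) - e (inr b)) := by
    intro z a
    rw [lie_sub, he.orthonormal.lie_eq, he.orthonormal.lie_eq, Fintype.sum_sum_type,
      Fintype.sum_sum_type]
    simp [he.inr_inl_inr, he.subalgebra, hF, smul_sub, Finset.sum_sub_distrib]
  have h2 : ∀ z a, ⁅e (inl z), e (inl a) - e (inr a)⁆ =
      -∑ b, structureConst e (inr z) (inr a) (inr b) • (e (inl b) - e (inr b)) := by
    intro z a
    have e1 : ∀ b, structureConst e (inl z) (inl a) (inr b) =
        structureConst e (inr z) (inr a) (inr b) := fun b => by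
      rw [← structureConst_cyclic, hF, structureConst_cyclic]
    have e2 : ∀ b, structureConst e (inl z) (inr a) (inl b) =
        structureConst e (inr z) (inr a) (inr b) := fun b => by
      rw [structureConst_antisymm₁, hF, ← structureConst_antisymm₁]
    rw [lie_sub, he.orthonormal.lie_eq, he.orthonormal.lie_eq, Fintype.sum_sum_type,
      Fintype.sum_sum_type]
    simp [he.inl_inr_inr, h0, e1, e2, smul_sub, Finset.sum_sub_distrib]
  -- The vectors `e (inl a) - e (inr a)` span an ideal by `h1` and `h2`. `N` is its Killing
  -- complement, which is neither zero nor everything.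
  let N : LieIdeal ℝ 𝔤 :=
    { carrier := {v | ∀ a, killingForm ℝ 𝔤 v (e (inl a) - e (inr a)) = 0}
      add_mem' := fun {a b} ha hb i => by
        rw [map_add, LinearMap.add_apply, ha i, hb i, add_zero]
      zero_mem' := fun i => by simp
      smul_mem' := fun r a ha i => by
        rw [map_smul, LinearMap.smul_apply, ha i, smul_zero]
      lie_mem := fun {x v} hv a => by
        have hv' : ∀ a, killingForm ℝ 𝔤 v (e (inl a) - e (inr a)) = 0 := hv
        have h3 := killingForm_lie_add x v (e (inl a) - e (inr a))
        have h4 : killingForm ℝ 𝔤 v ⁅x, e (inl a) - e (inr a)⁆ = 0 := by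
          rw [← e.sum_repr x, sum_lie, map_sum]
          refine Finset.sum_eq_zero fun i _ => ?_
          rw [smul_lie, map_smul]
          rcases i with i | i
          · rw [h2, map_neg, map_sum]
            simp only [map_smul, hv', smul_zero, Finset.sum_const_zero, neg_zero]
          · rw [h1, map_sum]
            simp only [map_smul, hv', smul_zero, Finset.sum_const_zero]
        rw [h4, add_zero] at h3
        exact h3 }
  have hin : e (inl a₀) + e (inr a₀) ∈ N := by
    intro a
    simp only [map_add, map_sub, LinearMap.add_apply, he.orthonormal _ _, inl.injEq, inr.injEq,
      reduceCtorEq, if_false]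
    ring
  have hout : e (inl a₀) ∉ N := by
    intro h
    have h3 : killingForm ℝ 𝔤 (e (inl a₀)) (e (inl a₀) - e (inr a₀)) = 0 := h a₀
    rw [map_sub, he.orthonormal, he.orthonormal] at h3
    simp at h3
  rcases LieAlgebra.IsSimple.eq_bot_or_eq_top (R := ℝ) N with h | h
  · rw [h, LieSubmodule.mem_bot] at hin
    have h3 := congrArg (fun v => e.repr v (inl a₀)) hin
    simp at h3
  · apply hout
    rw [h]
    trivial

namespace IsIsotropyIrreducible

variable {φ : L →ₗ⁅ℝ⁆ 𝔤} {S : Set (𝔤 →ₗ[ℝ] 𝔤)} {c : ℝ}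

/-- Invariant symmetric forms have no mixed terms. -/
theorem apply_eq_zero (h : IsIsotropyIrreducible φ S c) [FiniteDimensional ℝ L]
    {T : LinearMap.BilinForm ℝ 𝔤} (hT : T ∈ invariantForms S) {x y : 𝔤}
    (hx : x ∈ killingOrthogonal (imageOf φ)) (hy : y ∈ imageOf φ) : T x y = 0 := by
  obtain ⟨e, -, he, -⟩ := exists_isAdaptedBasis h.neg (imageOf φ) 0 (by simp) (by simp)
  -- β x ∈ 𝔨 represents T(x, ·) on 𝔨 with respect to -B. It intertwines the actions, and Schur's
  -- lemma gives B(βx, βy) = l B(x, y) on 𝔞. The sign of l is then discussed.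
  let β : 𝔤 →ₗ[ℝ] 𝔤 := ∑ z, (T.flip (e (inr z))).smulRight (e (inr z))
  have hβ : ∀ x, β x = ∑ z, T x (e (inr z)) • e (inr z) := fun x => by
    simp [β, LinearMap.sum_apply]
  have hβmem : ∀ x, β x ∈ imageOf φ := fun x => by
    rw [hβ]
    exact Submodule.sum_mem _ fun z _ => Submodule.smul_mem _ _ (he.inr_mem z)
  have hβT : ∀ x, ∀ w ∈ imageOf φ, killingForm ℝ 𝔤 (β x) w = -T x w := by
    intro x w hw
    have h1 := congrArg (T x) (he.eq_sum_inr hw)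
    rw [h1, hβ]
    simp only [map_sum, map_smul, LinearMap.sum_apply, LinearMap.smul_apply, smul_eq_mul,
      ← Finset.sum_neg_distrib, killingForm_comm w]
    exact Finset.sum_congr rfl fun z _ => by ring
  have hinv : ∀ u ∈ imageOf φ, ∀ x y, T ⁅u, x⁆ y + T x ⁅u, y⁆ = 0 := by
    rintro _ ⟨z, rfl⟩ x y
    exact h.invariant T hT z x y
  have hlie : ∀ u ∈ imageOf φ, ∀ x, β ⁅u, x⁆ = ⁅u, β x⁆ := by
    intro u hu x
    have hz : ∀ w ∈ imageOf φ, killingForm ℝ 𝔤 (β ⁅u, x⁆ - ⁅u, β x⁆) w = 0 := by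
      intro w hw
      have h1 := killingForm_lie_add u (β x) w
      have h2 := hinv u hu x w
      rw [hβT _ _ (lie_mem_imageOf hu hw)] at h1
      rw [map_sub, LinearMap.sub_apply, hβT _ _ hw]
      linarith
    rw [← sub_eq_zero]
    by_contra h0
    exact (h.neg _ h0).ne (hz _ (Submodule.sub_mem _ (hβmem _) (lie_mem_imageOf hu (hβmem _))))
  obtain ⟨l, hl⟩ := h.schur ((-killingForm ℝ 𝔤).compl₁₂ β β)
    (fun x y => by simp [killingForm_comm (β x)])
    (fun s hs x _ y _ => by
      obtain ⟨σ, hσ, hB, h1, h2, -, -⟩ := h.exists_equiv hs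
      have hTσ : ∀ x z, T (s x) (e (inr z)) = T x (σ.symm (e (inr z))) := by
        intro x z
        rw [← hT.2 s hs x, ← hσ (σ.symm _), LieEquiv.apply_symm_apply]
      have hsum : ∀ x y, killingForm ℝ 𝔤 (β x) (β y) =
          -∑ z, T x (e (inr z)) * T y (e (inr z)) := by
        intro x y
        rw [hβT _ _ (hβmem y), hβ, map_sum]
        simp only [map_smul, smul_eq_mul]
        rw [neg_inj]
        exact Finset.sum_congr rfl fun z _ => mul_comm _ _
      have key := he.sum_equiv hB h1 h2 ((LinearMap.mul ℝ ℝ).compl₁₂ (T x) (T y))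
      simp only [LinearMap.compl₁₂_apply, LinearMap.mul_apply_apply] at key
      simp only [LinearMap.compl₁₂_apply, LinearMap.neg_apply, hsum, hTσ, key])
  have hl' : ∀ x ∈ killingOrthogonal (imageOf φ), ∀ y ∈ killingOrthogonal (imageOf φ),
      killingForm ℝ 𝔤 (β x) (β y) = l * killingForm ℝ 𝔤 x y := by
    intro x hx y hy
    have h1 := hl x hx y hy
    simp only [LinearMap.compl₁₂_apply, LinearMap.neg_apply] at h1
    linarith
  have hα := h.nonempty_left he
  rcases lt_trichotomy l 0 with hneg | hzero | hpos
  · exfalso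
    obtain ⟨a⟩ := hα
    have h1 := hl' _ (he.inl_mem a) _ (he.inl_mem a)
    rw [he.orthonormal, if_pos rfl] at h1
    have h2 : killingForm ℝ 𝔤 (β (e (inl a))) (β (e (inl a))) ≤ 0 := by
      by_cases h0 : β (e (inl a)) = 0
      · simp [h0]
      · exact (h.neg _ h0).le
    linarith
  · have h1 := hl' x hx x hx
    rw [hzero, zero_mul] at h1
    have h2 : β x = 0 := by
      by_contra h0
      exact (h.neg _ h0).ne h1
    have h3 := hβT x y hy
    rw [h2, map_zero, LinearMap.zero_apply] at h3
    linarith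
  · exfalso
    -- For l > 0 the map mβ is an isometry of 𝔞 into 𝔨. It is onto, since a vector of 𝔨 orthogonal
    -- to its image acts trivially on 𝔞. Thus 𝔞 and 𝔨 are isometric representations.
    set m : ℝ := (Real.sqrt l)⁻¹ with hm
    have hml : m * m * l = 1 := by
      rw [hm, ← mul_inv, Real.mul_self_sqrt hpos.le, inv_mul_cancel₀ hpos.ne']
    obtain ⟨e', he'⟩ := exists_basis_of_orthonormal h.neg
      (Sum.elim (fun a => e (inl a)) fun a => m • β (e (inl a)))
      (by
        rintro (a | a) (b | b)
        · simp [he.orthonormal _ _]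
        · simp [killingForm_eq_zero' (he.inl_mem a) (hβmem _)]
        · simp [killingForm_eq_zero (hβmem _) (he.inl_mem b)]
        · simp only [Sum.elim_inr, map_smul, LinearMap.smul_apply, smul_eq_mul,
            hl' _ (he.inl_mem a) _ (he.inl_mem b), he.orthonormal _ _, inl.injEq, inr.injEq]
          split_ifs <;> linarith)
      (by
        intro u hu
        have hu1 : u ∈ imageOf φ := mem_of_killingForm_eq_zero h.neg fun y hy => by
          have h1 := congrArg (killingForm ℝ 𝔤 u) (he.eq_sum_inl hy)
          rw [h1, map_sum]
          refine Finset.sum_eq_zero fun a _ => ?_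
          have h2 := hu (inl a)
          rw [Sum.elim_inl, killingForm_comm] at h2
          rw [map_smul, h2, smul_zero]
        have hu2 : ∀ y ∈ killingOrthogonal (imageOf φ), killingForm ℝ 𝔤 u (β y) = 0 := by
          intro y hy
          have h1 := congrArg (fun v => killingForm ℝ 𝔤 u (β v)) (he.eq_sum_inl hy)
          simp only [map_sum, map_smul] at h1
          rw [h1]
          refine Finset.sum_eq_zero fun a _ => ?_
          have h2 := hu (inr a)
          rw [Sum.elim_inr, killingForm_comm, map_smul, smul_eq_mul] at h2
          have hm0 : m ≠ 0 := by
            rintro h0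
            rw [h0] at hml
            simp at hml
          rw [(mul_eq_zero.mp h2).resolve_left hm0, smul_zero]
        refine h.eq_zero_of_lie_eq_zero hu1 fun y hy => ?_
        by_contra h0
        refine (h.neg _ h0).ne ?_
        have hmem := lie_mem_orthogonal hu1 hy
        have h1 := hl' _ hmem _ hmem
        -- l B([u, y], [u, y]) = B([u, βy], β[u, y]) = B(u, β[βy, [u, y]]) = 0.
        have h2 := killingForm_lie_left u (β y) (β ⁅u, y⁆)
        rw [← hlie _ (hβmem y), hu2 _ (lie_mem_orthogonal (hβmem y) hmem), ← hlie u hu1, h1] at h2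
        exact (mul_eq_zero.mp h2).resolve_left hpos.ne')
    have hinl : ∀ a, e' (inl a) = e (inl a) := fun a => he' _
    have hinr : ∀ a, e' (inr a) = m • β (e (inl a)) := fun a => he' _
    have had : IsAdaptedBasis (imageOf φ) e' := by
      refine ⟨fun i j => ?_, fun a => ?_, fun a => ?_⟩
      · rcases i with a | a <;> rcases j with b | b
        · simp [hinl, he.orthonormal _ _]
        · simp [hinl, hinr, killingForm_eq_zero' (he.inl_mem a) (hβmem _)]
        · simp [hinl, hinr, killingForm_eq_zero (hβmem _) (he.inl_mem b)]
        · simp only [hinr, map_smul, LinearMap.smul_apply, smul_eq_mul,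
            hl' _ (he.inl_mem a) _ (he.inl_mem b), he.orthonormal _ _, inl.injEq, inr.injEq]
          split_ifs <;> linarith
      · rw [hinl]; exact he.inl_mem a
      · rw [hinr]; exact Submodule.smul_mem _ _ (hβmem _)
    obtain ⟨C, hf⟩ := h.exists_isIsotropyFrame had
    refine hf.not_isSimple (fun z a b => ?_) h.simple
    have hz := had.inr_mem z
    rw [structureConst, structureConst, hinl, hinl, hinr a, hinr b, lie_smul, ← hlie _ hz]
    simp only [map_smul, LinearMap.smul_apply, smul_eq_mul]
    rw [hl' _ (lie_mem_orthogonal hz (he.inl_mem a)) _ (he.inl_mem b), ← mul_assoc, ← mul_assoc, hml,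
      one_mul]

end IsIsotropyIrreducible

end LeftInvariant

/-! ### Invariant forms as block forms. -/

namespace LeftInvariant

open Sum

variable {𝔤 : Type*} [LieRing 𝔤] [LieAlgebra ℝ 𝔤] [FiniteDimensional ℝ 𝔤]
  {L : Type*} [LieRing L] [LieAlgebra ℝ L]

/-- The restriction of minus the Killing form to `U`, extended by zero along `V`. -/
def killingProj {U V : Submodule ℝ 𝔤} (hUV : IsCompl U V) : LinearMap.BilinForm ℝ 𝔤 :=
  (-1 : ℝ) • (killingForm ℝ 𝔤).compl₁₂ (Submodule.projection U V hUV)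
    (Submodule.projection U V hUV)

theorem killingProj_apply {U V : Submodule ℝ 𝔤} (hUV : IsCompl U V) (x y : 𝔤) :
    killingProj hUV x y = -killingForm ℝ 𝔤 (Submodule.projection U V hUV x)
      (Submodule.projection U V hUV y) := by
  simp [killingProj]

theorem killingProj_of_mem {U V : Submodule ℝ 𝔤} (hUV : IsCompl U V) {x y : 𝔤} (hx : x ∈ U)
    (hy : y ∈ U) : killingProj hUV x y = -killingForm ℝ 𝔤 x y := by
  rw [killingProj_apply, Submodule.projection_apply_of_mem_left hUV hx,
    Submodule.projection_apply_of_mem_left hUV hy]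

theorem killingProj_left {U V : Submodule ℝ 𝔤} (hUV : IsCompl U V) {x : 𝔤} (hx : x ∈ V) (y : 𝔤) :
    killingProj hUV x y = 0 := by
  rw [killingProj_apply, Submodule.projection_apply_of_mem_right hUV hx, map_zero,
    LinearMap.zero_apply, neg_zero]

theorem killingProj_right {U V : Submodule ℝ 𝔤} (hUV : IsCompl U V) (x : 𝔤) {y : 𝔤} (hy : y ∈ V) :
    killingProj hUV x y = 0 := by
  rw [killingProj_apply, Submodule.projection_apply_of_mem_right hUV hy, map_zero, neg_zero]

theorem jensenForm_eq (hneg : ∀ X : 𝔤, X ≠ 0 → killingForm ℝ 𝔤 X X < 0) (𝔨 : Submodule ℝ 𝔤)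
    (t : ℝ) : jensenForm hneg 𝔨 t = killingProj (isCompl_killingOrthogonal hneg 𝔨).symm +
      t • killingProj (isCompl_killingOrthogonal hneg 𝔨) := rfl

namespace IsIsotropyIrreducible

variable {φ : L →ₗ⁅ℝ⁆ 𝔤} {S : Set (𝔤 →ₗ[ℝ] 𝔤)} {c : ℝ}

theorem killingProj_mem (h : IsIsotropyIrreducible φ S c) {U V : Submodule ℝ 𝔤}
    (hUV : IsCompl U V) (hU : ∀ s ∈ S, ∀ x ∈ U, s x ∈ U) (hV : ∀ s ∈ S, ∀ x ∈ V, s x ∈ V) :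
    killingProj hUV ∈ invariantForms S := by
  refine ⟨fun x y => ?_, fun s hs x y => ?_⟩
  · rw [killingProj_apply, killingProj_apply, killingForm_comm]
  · have hP : ∀ x, Submodule.projection U V hUV (s x) = s (Submodule.projection U V hUV x) := by
      intro x
      obtain ⟨u, hu, v, hv, rfl⟩ : ∃ u ∈ U, ∃ v ∈ V, u + v = x := by
        rw [← Submodule.mem_sup, hUV.sup_eq_top]
        trivial
      simp only [map_add, Submodule.projection_apply_of_mem_left hUV hu,
        Submodule.projection_apply_of_mem_left hUV (hU s hs u hu),
        Submodule.projection_apply_of_mem_right hUV hv,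
        Submodule.projection_apply_of_mem_right hUV (hV s hs v hv), add_zero]
    obtain ⟨σ, hσ, hB, -⟩ := h.exists_equiv hs
    rw [killingProj_apply, killingProj_apply, hP, hP, ← hσ, ← hσ, hB]

theorem map_orthogonal (h : IsIsotropyIrreducible φ S c) {U : Submodule ℝ 𝔤}
    (hU : ∀ s ∈ S, ∀ x ∈ U, s x ∈ U) :
    ∀ s ∈ S, ∀ x ∈ killingOrthogonal U, s x ∈ killingOrthogonal U := by
  intro s hs x hx
  obtain ⟨σ, hσ, -, -, -, h1, -⟩ := h.exists_equiv_of_stable hs (hU s hs)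
  rw [← hσ]
  exact h1 x hx

theorem jensenForm_mem (h : IsIsotropyIrreducible φ S c) (t : ℝ) :
    jensenForm h.neg (imageOf φ) t ∈ invariantForms S := by
  have hU : ∀ s ∈ S, ∀ x ∈ imageOf φ, s x ∈ imageOf φ := fun s hs x hx => h.map_imageOf hs hx
  rw [jensenForm_eq]
  exact Submodule.add_mem _ (h.killingProj_mem _ (h.map_orthogonal hU) hU)
    (Submodule.smul_mem _ _ (h.killingProj_mem _ hU (h.map_orthogonal hU)))

variable {α κ : Type*} [Fintype α] [DecidableEq α] [Fintype κ] [DecidableEq κ]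

theorem isBlockForm_jensenForm (h : IsIsotropyIrreducible φ S c) {e : Module.Basis (α ⊕ κ) ℝ 𝔤}
    (he : IsAdaptedBasis (imageOf φ) e) (t : ℝ) :
    IsBlockForm e (jensenForm h.neg (imageOf φ) t) 1 fun _ => t where
  apply i j := by
    rw [jensenForm_eq, LinearMap.add_apply, LinearMap.add_apply, LinearMap.smul_apply,
      LinearMap.smul_apply]
    rcases i with a | z <;> rcases j with b | w
    · rw [killingProj_of_mem _ (he.inl_mem a) (he.inl_mem b), killingProj_left _ (he.inl_mem a),
        he.orthonormal]
      split_ifs <;> simp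
    · rw [killingProj_left _ (he.inl_mem a), killingProj_right _ _ (he.inr_mem w)]
      simp
    · rw [killingProj_right _ _ (he.inl_mem b), killingProj_left _ (he.inr_mem z)]
      simp
    · rw [killingProj_of_mem _ (he.inr_mem z) (he.inr_mem w), killingProj_left _ (he.inr_mem z),
        he.orthonormal]
      split_ifs <;> simp
  linked _ _ _ _ := rfl

/-- Every invariant symmetric form is a block form in a suitable frame. -/
theorem exists_isBlockForm (h : IsIsotropyIrreducible φ S c) [FiniteDimensional ℝ L]
    {T : LinearMap.BilinForm ℝ 𝔤} (hT : T ∈ invariantForms S) :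
    ∃ (e : Module.Basis (Fin (Module.finrank ℝ (killingOrthogonal (imageOf φ))) ⊕
      Fin (Module.finrank ℝ (imageOf φ))) ℝ 𝔤) (C x₀ : ℝ) (x : _ → ℝ),
      IsAdaptedBasis (imageOf φ) e ∧ IsIsotropyFrame e c C ∧ IsBlockForm e T x₀ x := by
  obtain ⟨e, τ, he, hdiag⟩ := exists_isAdaptedBasis h.neg (imageOf φ) T hT.1
    fun x hx y hy => h.apply_eq_zero hT hx hy
  obtain ⟨C, hf⟩ := h.exists_isIsotropyFrame he
  obtain ⟨l, hl⟩ := h.schur T hT.1 fun s hs x _ y _ => hT.2 s hs x y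
  refine ⟨e, C, l, fun z => τ (inr z), he, hf, fun i j => ?_, fun z w v hne => ?_⟩
  · rcases i with a | z
    · rcases j with b | w
      · rw [hl _ (he.inl_mem a) _ (he.inl_mem b), he.orthonormal]
        split_ifs <;> simp
      · rw [hdiag]
        simp
    · rw [hdiag]
      rfl
  · obtain ⟨Z, hZ⟩ := he.inr_mem z
    -- Infinitesimal invariance on two frame vectors reads F · (τ_w - τ_v) = 0, which is linkedness.
    have h1 := h.invariant T hT Z (e (inr w)) (e (inr v))
    have hZ' : φ Z = e (inr z) := hZ
    rw [hZ', he.orthonormal.lie_eq, he.orthonormal.lie_eq] at h1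
    simp only [map_sum, map_smul, LinearMap.sum_apply, LinearMap.smul_apply, hdiag, smul_eq_mul,
      mul_ite, mul_zero, Finset.sum_ite_eq, Finset.sum_ite_eq', Finset.mem_univ, if_true] at h1
    rw [structureConst_antisymm₂ (inr z) (inr v) (inr w)] at h1
    have h2 : structureConst e (inr z) (inr w) (inr v) * (τ (inr w) - τ (inr v)) = 0 := by linarith
    linarith [(mul_eq_zero.mp h2).resolve_left hne]

end IsIsotropyIrreducible

end LeftInvariant

/-! ### Dimension count and the theorem at the Lie algebra level. -/

namespace LeftInvariant

open Sum

variable {𝔤 : Type*} [LieRing 𝔤] [LieAlgebra ℝ 𝔤] [FiniteDimensional ℝ 𝔤]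
  {L : Type*} [LieRing L] [LieAlgebra ℝ L] [FiniteDimensional ℝ L]

namespace IsIsotropyIrreducible

variable {φ : L →ₗ⁅ℝ⁆ 𝔤} {S : Set (𝔤 →ₗ[ℝ] 𝔤)} {c : ℝ}

/-- The invariant symmetric forms are parametrised by their values on one vector of `𝔞` and one
vector in each simple ideal. -/
theorem nonempty_equiv_invariantForms (h : IsIsotropyIrreducible φ S c) :
    Nonempty (invariantForms S ≃ₗ[ℝ] (Option {J : LieIdeal ℝ L // IsAtom J} → ℝ)) := by
  have hss := h.semisimple
  have hfin := LieAlgebra.IsSemisimple.finite_isAtom (L := L)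
  let At := {J : LieIdeal ℝ L // IsAtom J}
  have : Fintype At := hfin.fintype
  obtain ⟨v₀, hv₀, hv₀'⟩ := Submodule.exists_mem_ne_zero_of_ne_bot h.ne_bot
  have hv : ∀ J : At, ∃ v ∈ J.1, v ≠ 0 := by
    intro J
    obtain ⟨v, hv, hv'⟩ := Submodule.exists_mem_ne_zero_of_ne_bot
      (p := J.1.toSubmodule) fun h => J.2.1 ((LieSubmodule.toSubmodule_eq_bot J.1).mp h)
    exact ⟨v, hv, hv'⟩
  choose v hv hv' using hv
  have hφ : ∀ J : At, φ (v J) ≠ 0 := fun J h0 => hv' J (h.injective (by rw [h0, map_zero]))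
  let p : Option At → 𝔤 := fun o => o.elim v₀ fun J => φ (v J)
  let Φ : invariantForms S →ₗ[ℝ] (Option At → ℝ) :=
    { toFun := fun T o => T.1 (p o) (p o)
      map_add' := fun T T' => by ext o; simp
      map_smul' := fun r T => by ext o; simp }
  let pull : LinearMap.BilinForm ℝ 𝔤 → LinearMap.BilinForm ℝ L := fun T =>
    T.compl₁₂ (φ : L →ₗ[ℝ] 𝔤) (φ : L →ₗ[ℝ] 𝔤)
  have hB : ∀ z x y : L, pull (-killingForm ℝ 𝔤) ⁅z, x⁆ y + pull (-killingForm ℝ 𝔤) x ⁅z, y⁆ = 0 := by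
    intro z x y
    have h1 := killingForm_lie_add (φ z) (φ x) (φ y)
    simp only [pull, LinearMap.compl₁₂_apply, LieHom.coe_toLinearMap, LieHom.map_lie,
      LinearMap.neg_apply]
    linarith
  have hatoms : ∀ J J' : At, J ≠ J' → ∀ x ∈ J.1, ∀ y ∈ J'.1,
      killingForm ℝ 𝔤 (φ x) (φ y) = 0 := by
    intro J J' hne x hx y hy
    have h1 := LieAlgebra.IsSemisimple.invariant_eq_zero hB J.2 J'.2
      (fun h => hne (Subtype.ext h)) hx hy
    simp only [pull, LinearMap.compl₁₂_apply, LieHom.coe_toLinearMap, LinearMap.neg_apply,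
      neg_eq_zero] at h1
    exact h1
  have hinj : ∀ T ∈ invariantForms S, (∀ o, T (p o) (p o) = 0) → T = 0 := by
    intro T hT h0
    have h00 : T v₀ v₀ = 0 := h0 none
    have h0J : ∀ J : At, T (φ (v J)) (φ (v J)) = 0 := fun J => h0 (some J)
    obtain ⟨l, hl⟩ := h.schur T hT.1 fun s hs x _ y _ => hT.2 s hs x y
    have hl0 : l = 0 := by
      have h1 := hl _ hv₀ _ hv₀
      rw [h00] at h1
      exact (mul_eq_zero.mp h1.symm).resolve_right (neg_pos.mpr (h.neg v₀ hv₀')).ne'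
    have hTinv : ∀ z x y : L, pull T ⁅z, x⁆ y + pull T x ⁅z, y⁆ = 0 := by
      intro z x y
      have h1 := h.invariant T hT z (φ x) (φ y)
      simpa only [pull, LinearMap.compl₁₂_apply, LieHom.coe_toLinearMap, LieHom.map_lie] using h1
    have hpull : ∀ x y, pull T x y = (0 : LinearMap.BilinForm ℝ L) x y := by
      refine LieAlgebra.IsSemisimple.invariant_ext hTinv (by simp) fun J hJ x hx y hy => ?_
      obtain ⟨τ, hτ⟩ := LieAlgebra.IsSemisimple.invariant_isAtom hTinv (fun x y => hT.1 _ _) hB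
        (fun x y => by simp [pull, killingForm_comm (φ x)])
        (fun x hx => by
          have h1 := h.neg (φ x) fun h0 => hx (h.injective (by rw [h0, map_zero]))
          simpa [pull] using h1) hJ
      have h1 := hτ _ (hv ⟨J, hJ⟩) _ (hv ⟨J, hJ⟩)
      have h2 : pull T (v ⟨J, hJ⟩) (v ⟨J, hJ⟩) = 0 := h0J ⟨J, hJ⟩
      have h3 : pull (-killingForm ℝ 𝔤) (v ⟨J, hJ⟩) (v ⟨J, hJ⟩) ≠ 0 := by
        have := h.neg _ (hφ ⟨J, hJ⟩)
        simpa [pull] using this.ne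
      rw [h2] at h1
      rw [hτ x hx y hy, (mul_eq_zero.mp h1.symm).resolve_right h3, zero_mul]
      rfl
    refine LinearMap.ext₂ fun x y => ?_
    obtain ⟨_, ⟨x₁, rfl⟩, x₂, hx₂, rfl⟩ := exists_add_eq h.neg (imageOf φ) x
    obtain ⟨_, ⟨y₁, rfl⟩, y₂, hy₂, rfl⟩ := exists_add_eq h.neg (imageOf φ) y
    have e1 : T ((φ : L →ₗ[ℝ] 𝔤) x₁) ((φ : L →ₗ[ℝ] 𝔤) y₁) = 0 := hpull x₁ y₁
    have e2 : T x₂ ((φ : L →ₗ[ℝ] 𝔤) y₁) = 0 := h.apply_eq_zero hT hx₂ ⟨y₁, rfl⟩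
    have e3 : T ((φ : L →ₗ[ℝ] 𝔤) x₁) y₂ = 0 := by
      rw [hT.1]
      exact h.apply_eq_zero hT hy₂ ⟨x₁, rfl⟩
    have e4 : T x₂ y₂ = 0 := by rw [hl _ hx₂ _ hy₂, hl0, zero_mul]
    simp only [map_add, LinearMap.add_apply, e1, e2, e3, e4, add_zero, LinearMap.zero_apply]
  have hinj' : Function.Injective Φ := by
    intro T T' hTT'
    have h1 := hinj (T.1 + (-1 : ℝ) • T'.1)
      ((invariantForms S).add_mem T.2 ((invariantForms S).smul_mem _ T'.2)) fun o => by
        have h2 : T.1 (p o) (p o) = T'.1 (p o) (p o) := congrFun hTT' o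
        simp [h2]
    refine Subtype.ext (LinearMap.ext₂ fun x y => ?_)
    have h3 := LinearMap.congr_fun₂ h1 x y
    simp only [LinearMap.add_apply, LinearMap.smul_apply, smul_eq_mul, LinearMap.zero_apply] at h3
    linarith
  have hsurj : Function.Surjective Φ := by
    have hstab : ∀ J : At, ∀ s ∈ S, ∀ x ∈ J.1.toSubmodule.map (φ : L →ₗ[ℝ] 𝔤),
        s x ∈ J.1.toSubmodule.map (φ : L →ₗ[ℝ] 𝔤) := by
      rintro J s hs _ ⟨x, hx, rfl⟩
      obtain ⟨y, hy, hy'⟩ := h.map_isAtom s hs J.1 J.2 x hx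
      exact ⟨y, hy, hy'⟩
    have hU : ∀ s ∈ S, ∀ x ∈ imageOf φ, s x ∈ imageOf φ := fun s hs x hx => h.map_imageOf hs hx
    -- -B on one summand, extended by zero to its complement. Up to nonzero factors these forms are
    -- dual to the evaluations at the vectors `p`.
    let q : Option At → invariantForms S := fun o => o.elim
      ⟨_, h.killingProj_mem (isCompl_killingOrthogonal h.neg (imageOf φ)).symm
        (h.map_orthogonal hU) hU⟩
      fun J => ⟨_, h.killingProj_mem (isCompl_killingOrthogonal h.neg
        (J.1.toSubmodule.map (φ : L →ₗ[ℝ] 𝔤))) (hstab J) (h.map_orthogonal (hstab J))⟩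
    have hq : ∀ o, Φ (q o) o = -killingForm ℝ 𝔤 (p o) (p o) := by
      rintro (_ | J)
      · exact killingProj_of_mem _ hv₀ hv₀
      · exact killingProj_of_mem _ (Submodule.mem_map_of_mem (hv J))
          (Submodule.mem_map_of_mem (hv J))
    have hq' : ∀ o o', o ≠ o' → Φ (q o) o' = 0 := by
      rintro (_ | J) (_ | J') hne
      · exact absurd rfl hne
      · exact killingProj_left _ (LinearMap.mem_range_self (φ : L →ₗ[ℝ] 𝔤) (v J')) _
      · refine killingProj_left _ (LinearMap.BilinForm.mem_orthogonal_iff.mpr ?_) _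
        rintro _ ⟨x, hx, rfl⟩
        exact killingForm_eq_zero (LinearMap.mem_range_self (φ : L →ₗ[ℝ] 𝔤) x) hv₀
      · refine killingProj_left _ (LinearMap.BilinForm.mem_orthogonal_iff.mpr ?_) _
        rintro _ ⟨x, hx, rfl⟩
        exact hatoms J J' (fun h => hne (congrArg some h)) x hx _ (hv J')
    have hp : ∀ o, -killingForm ℝ 𝔤 (p o) (p o) ≠ 0 := by
      rintro (_ | J)
      · exact (neg_pos.mpr (h.neg _ hv₀')).ne'
      · exact (neg_pos.mpr (h.neg _ (hφ J))).ne'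
    intro f
    refine ⟨∑ o, (f o / -killingForm ℝ 𝔤 (p o) (p o)) • q o, ?_⟩
    ext o'
    rw [map_sum, Finset.sum_apply, Finset.sum_eq_single o']
    · rw [map_smul, Pi.smul_apply, hq, smul_eq_mul, div_mul_cancel₀ _ (hp o')]
    · intro o _ ho
      rw [map_smul, Pi.smul_apply, hq' o o' ho, smul_zero]
    · exact fun h => absurd (Finset.mem_univ _) h
  exact ⟨LinearEquiv.ofBijective Φ ⟨hinj', hsurj⟩⟩

/-- The trace-free invariant symmetric forms. -/
theorem exists_traceFree (h : IsIsotropyIrreducible φ S c) {t : ℝ} (ht : 0 < t) :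
    ∃ W : Submodule ℝ (LinearMap.BilinForm ℝ 𝔤),
      (∀ T, T ∈ W ↔ T ∈ invariantForms S ∧
        metricTrace (jensenForm h.neg (imageOf φ) t) T = 0) ∧
      Module.finrank ℝ W = {J : LieIdeal ℝ L | IsAtom J}.ncard := by
  set g := jensenForm h.neg (imageOf φ) t with hg
  obtain ⟨e, -, he, -⟩ := exists_isAdaptedBasis h.neg (imageOf φ) 0 (by simp) (by simp)
  have hd := (h.isBlockForm_jensenForm he t).isDiagonalMetric one_pos fun _ => ht
  rw [← hg] at hd
  let ψ : invariantForms S →ₗ[ℝ] ℝ :=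
    { toFun := fun T => metricTrace g T.1
      map_add' := fun T T' => by
        simp [hd.metricTrace_eq, add_div, Finset.sum_add_distrib]
      map_smul' := fun r T => by
        simp [hd.metricTrace_eq, mul_add, mul_div_assoc, Finset.mul_sum] }
  -- The trace of g itself is a positive sum, so the trace is onto and its kernel has dimension (r +
  -- 1) - 1.
  have hψg : ψ ⟨g, h.jensenForm_mem t⟩ ≠ 0 := by
    have h1 : ψ ⟨g, h.jensenForm_mem t⟩ = metricTrace g g := rfl
    obtain ⟨a⟩ := h.nonempty_left he
    have : Nonempty (Fin (Module.finrank ℝ (killingOrthogonal (imageOf φ))) ⊕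
      Fin (Module.finrank ℝ (imageOf φ))) := ⟨inl a⟩
    rw [h1, hd.metricTrace_eq]
    refine (Finset.sum_pos (fun i _ => ?_) Finset.univ_nonempty).ne'
    rw [hd.apply, if_pos rfl, div_self (hd.pos i).ne']
    exact one_pos
  obtain ⟨Ψ⟩ := h.nonempty_equiv_invariantForms
  have hss := h.semisimple
  have : Fintype {J : LieIdeal ℝ L // IsAtom J} :=
    (LieAlgebra.IsSemisimple.finite_isAtom (L := L)).fintype
  let χ : (Option {J : LieIdeal ℝ L // IsAtom J} → ℝ) →ₗ[ℝ] ℝ := ψ ∘ₗ Ψ.symm.toLinearMap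
  have hrange : LinearMap.range χ = ⊤ := by
    rw [LinearMap.range_eq_top]
    refine LinearMap.surjective fun h0 => hψg ?_
    have h1 := LinearMap.congr_fun h0 (Ψ ⟨g, h.jensenForm_mem t⟩)
    simpa [χ] using h1
  let incl : (Option {J : LieIdeal ℝ L // IsAtom J} → ℝ) →ₗ[ℝ] LinearMap.BilinForm ℝ 𝔤 :=
    (invariantForms S).subtype ∘ₗ Ψ.symm.toLinearMap
  have hincl : Function.Injective incl :=
    Subtype.val_injective.comp Ψ.symm.injective
  refine ⟨(LinearMap.ker χ).map incl, fun T => ⟨?_, ?_⟩, ?_⟩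
  · rintro ⟨f, hf, rfl⟩
    exact ⟨(Ψ.symm f).2, hf⟩
  · rintro ⟨hT, h0⟩
    refine ⟨Ψ ⟨T, hT⟩, ?_, ?_⟩
    · change ψ (Ψ.symm (Ψ ⟨T, hT⟩)) = 0
      rw [LinearEquiv.symm_apply_apply]
      exact h0
    · change (Ψ.symm (Ψ ⟨T, hT⟩)).1 = T
      rw [LinearEquiv.symm_apply_apply]
  · have h1 := LinearMap.finrank_range_add_finrank_ker χ
    rw [hrange, finrank_top, Module.finrank_self, Module.finrank_fintype_fun_eq_card,
      Fintype.card_option] at h1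
    rw [← (Submodule.equivMapOfInjective incl hincl _).finrank_eq, ← Nat.card_coe_set_eq,
      Set.coe_ofPred, Nat.card_eq_fintype_card]
    omega

/-- Instability, coindex and local minimality of `g_t` for `t = dc / ((d + 2k)(1 - c))`. -/
theorem jensen_unstable (h : IsIsotropyIrreducible φ S c) {t : ℝ}
    (ht : t = Module.finrank ℝ (killingOrthogonal (imageOf φ)) * c /
      ((Module.finrank ℝ (killingOrthogonal (imageOf φ)) +
        2 * Module.finrank ℝ (imageOf φ)) * (1 - c))) :
    0 < t ∧ IsUnstable S (jensenForm h.neg (imageOf φ) t) ∧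
    HasCoindex S (jensenForm h.neg (imageOf φ) t) {J : LieIdeal ℝ L | IsAtom J}.ncard ∧
    IsLocalMinScalar S (jensenForm h.neg (imageOf φ) t) ∧
    IsUnstable {LinearMap.id} (jensenForm h.neg (imageOf φ) t) := by
  have hss := h.semisimple
  have hL := h.nontrivial
  obtain ⟨e, C, -, -, he, hf, -⟩ := h.exists_isBlockForm (T := 0) (Submodule.zero_mem _)
  have hα := h.nonempty_left he
  have hκ := h.nonempty_right he
  have hc0 := h.pos he hf
  have hc1 := h.lt_one he hf
  have hlt := hf.lt_of_card hc0 hc1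
  have hd : (0 : ℝ) < Fintype.card (Fin (Module.finrank ℝ (killingOrthogonal (imageOf φ)))) := by
    exact_mod_cast Fintype.card_pos
  have h1c : 0 < 1 - c := by linarith
  rw [← Fintype.card_fin (Module.finrank ℝ (killingOrthogonal (imageOf φ))),
    ← Fintype.card_fin (Module.finrank ℝ (imageOf φ))] at ht
  have ht0 : 0 < t := by
    rw [ht]
    positivity
  have ht1 : t < 1 := by
    rw [ht, div_lt_one (by positivity)]
    exact hlt
  have hE : t * ((Fintype.card (Fin (Module.finrank ℝ (killingOrthogonal (imageOf φ)))) +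
      2 * Fintype.card (Fin (Module.finrank ℝ (imageOf φ)))) * (1 - c)) =
      Fintype.card (Fin (Module.finrank ℝ (killingOrthogonal (imageOf φ)))) * c := by
    rw [ht]
    exact div_mul_cancel₀ _ (by positivity)
  clear ht
  set g := jensenForm h.neg (imageOf φ) t with hg
  have hgb := h.isBlockForm_jensenForm he t
  have hmetric : IsMetric g := (hgb.isDiagonalMetric one_pos fun _ => ht0).isMetric
  have hein : IsEinstein g := hf.isEinstein ht0 hgb hE
  have hmem : g ∈ invariantForms S := h.jensenForm_mem t
  obtain ⟨W, hW, hWr⟩ := h.exists_traceFree ht0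
  have hTT : ∀ T ∈ W, IsTTTensor S g T ∧ (T ≠ 0 → 0 < scalarHessian g T) := by
    intro T hT
    obtain ⟨hT1, hT2⟩ := (hW T).mp hT
    obtain ⟨e', C', x₀, x, he', hf', hb⟩ := h.exists_isBlockForm hT1
    have hgb' := h.isBlockForm_jensenForm he' t
    exact ⟨⟨hT1, hT2, hgb'.divergence_eq_zero hf' ht0 hb⟩, fun hne =>
      hgb'.scalarHessian_pos hf' ht0 ht1 hc1 hE hb hT2 hne⟩
  obtain ⟨T, hTW, hT0⟩ : ∃ T ∈ W, T ≠ 0 := by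
    apply Submodule.exists_mem_ne_zero_of_ne_bot
    intro hbot
    rw [hbot, finrank_bot] at hWr
    have hempty := (Set.ncard_eq_zero LieAlgebra.IsSemisimple.finite_isAtom).mp hWr.symm
    obtain ⟨x, hx⟩ := exists_ne (0 : L)
    have := LieAlgebra.IsSemisimple.mem_of_isAtom_le (⊥ : Submodule ℝ L) (fun J hJ => by
      have : J ∈ {J : LieIdeal ℝ L | IsAtom J} := hJ
      rw [hempty] at this
      exact this.elim) x
    exact hx this
  obtain ⟨hTT1, hTT2⟩ := hTT T hTW
  refine ⟨ht0, ⟨⟨hmetric, hmem⟩, hein, T, hTT1, hTT2 hT0⟩, ⟨⟨W, hWr, hTT⟩, ?_⟩, ?_, ?_⟩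
  -- Every competing space consists of trace-free invariant forms, so it lies in `W`.
  · rintro _ ⟨V, rfl, hV⟩
    rw [← hWr]
    exact Submodule.finrank_mono fun T hT => (hW T).mpr ⟨(hV T hT).1.1, (hV T hT).1.2.1⟩
  · obtain ⟨ε, hε, hmin⟩ := IsBlockForm.exists_localMin 𝔤
      (Fin (Module.finrank ℝ (killingOrthogonal (imageOf φ))))
      (Fin (Module.finrank ℝ (imageOf φ))) ht0 ht1 hc0 hc1 hE
    refine ⟨ε, hε, fun g' hg' hdet hclose => ?_⟩
    -- The frame is adapted to g', while g_t has its block form in every adapted frame.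
    obtain ⟨e', C', x₀, x, he', hf', hb⟩ := h.exists_isBlockForm hg'.2
    have hpos : ∀ i : Fin (Module.finrank ℝ (killingOrthogonal (imageOf φ))) ⊕
        Fin (Module.finrank ℝ (imageOf φ)), 0 < Sum.elim (fun _ => x₀) x i := by
      intro i
      have h1 := hg'.1.pos (e' i) (e'.ne_zero i)
      rwa [hb.apply, if_pos rfl] at h1
    exact hmin e' C' g g' x₀ x hf' (h.isBlockForm_jensenForm he' t) hb
      (hpos (inl (Classical.arbitrary _))) (fun z => hpos (inr z)) hdet hclose
  -- A `G`-invariant TT-tensor is also a left-invariant one.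
  · exact ⟨⟨hmetric, hmem.1, by simp⟩, hein, T, ⟨⟨hTT1.1.1, by simp⟩, hTT1.2⟩, hTT2 hT0⟩

end IsIsotropyIrreducible

end LeftInvariant

end

noncomputable section

/-! ### From Lie groups to the infinitesimal data. -/

section LieGroupData

variable {E : Type*} [NormedAddCommGroup E] [NormedSpace ℝ E] [FiniteDimensional ℝ E]
  {H : Type*} [TopologicalSpace H] [ChartedSpace E H] [Group H] [LieGroup 𝓘(ℝ, E) ∞ H]
  {F : Type*} [NormedAddCommGroup F] [NormedSpace ℝ F] [FiniteDimensional ℝ F]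
  {K : Type*} [TopologicalSpace K] [ChartedSpace F K] [Group K] [LieGroup 𝓘(ℝ, F) ∞ K]

variable (E F) in
/-- The homomorphism of Lie algebras induced by a homomorphism of Lie groups. -/
def derivAtOneHom (ι : K →* H) (hι : ContMDiff 𝓘(ℝ, F) 𝓘(ℝ, E) ∞ ι) :
    GroupLieAlgebra 𝓘(ℝ, F) K →ₗ⁅ℝ⁆ GroupLieAlgebra 𝓘(ℝ, E) H :=
  { derivAtOne E F ι with map_lie' := derivAtOne_lie hι _ _ }

open LeftInvariant in
/-- An isotropy irreducible pair of Lie groups satisfies the infinitesimal conditions. -/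
theorem isIsotropyIrreducible_derivAtOneHom [ConnectedSpace K]
    (hsimple : LieAlgebra.IsSimple ℝ (GroupLieAlgebra 𝓘(ℝ, E) H))
    (hneg : ∀ X : GroupLieAlgebra 𝓘(ℝ, E) H, X ≠ 0 → killingForm ℝ _ X X < 0)
    (hss : LieAlgebra.IsSemisimple ℝ (GroupLieAlgebra 𝓘(ℝ, F) K))
    (ι : K →* H) (hι : ContMDiff 𝓘(ℝ, F) 𝓘(ℝ, E) ∞ ι)
    (himm : Function.Injective (derivAtOne E F ι))
    (hne : killingOrthogonal (LinearMap.range (derivAtOne E F ι)) ≠ ⊥)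
    (hirr : ∀ W : Submodule ℝ (GroupLieAlgebra 𝓘(ℝ, E) H),
      W ≤ killingOrthogonal (LinearMap.range (derivAtOne E F ι)) →
      (∀ φ ∈ isotropyRep E ι, ∀ x ∈ W, φ x ∈ W) →
      W = ⊥ ∨ W = killingOrthogonal (LinearMap.range (derivAtOne E F ι)))
    (c : ℝ)
    (hc : ∀ J : LieIdeal ℝ (GroupLieAlgebra 𝓘(ℝ, F) K), IsAtom J → ∀ X Y : J,
      killingForm ℝ J X Y = c * killingForm ℝ (GroupLieAlgebra 𝓘(ℝ, E) H)
        (derivAtOne E F ι (X : GroupLieAlgebra 𝓘(ℝ, F) K))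
        (derivAtOne E F ι (Y : GroupLieAlgebra 𝓘(ℝ, F) K))) :
    IsIsotropyIrreducible (derivAtOneHom E F ι hι) (isotropyRep E ι) c where
  simple := hsimple
  neg := hneg
  semisimple := hss
  injective := himm
  equiv := by
    rintro _ ⟨k, rfl⟩
    exact ⟨groupAdEquiv (ι k), fun x => rfl⟩
  map_isAtom := by
    rintro _ ⟨k, rfl⟩ J hJ x hx
    exact ⟨groupAd F k x, groupAd_mem_of_isAtom hss hJ k hx, (groupAd_derivAtOne hι k x).symm⟩
  invariant := fun T hT z x y =>
    lie_invariant_of_groupAd_invariant hι T (fun k x y => hT.2 _ ⟨k, rfl⟩ x y) z x y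
  ne_bot := hne
  irreducible := hirr
  eq_id := by
    rintro hsub _ ⟨k, rfl⟩
    have h1 : Subsingleton F := hsub
    have h2 : Subsingleton K := subsingleton_of_subsingleton_model (F := F)
    ext x
    change groupAd E (ι k) x = x
    rw [Subsingleton.elim k 1, map_one]
    exact groupAd_one x
  killing := hc

end LieGroupData

end

theorem proposition7p2
    {E : Type*} [NormedAddCommGroup E] [NormedSpace ℝ E] [FiniteDimensional ℝ E]
    {H : Type*} [TopologicalSpace H] [ChartedSpace E H] [Group H] [LieGroup 𝓘(ℝ, E) ∞ H]
    [ConnectedSpace H]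
    {F : Type*} [NormedAddCommGroup F] [NormedSpace ℝ F] [FiniteDimensional ℝ F]
    {K : Type*} [TopologicalSpace K] [ChartedSpace F K] [Group K] [LieGroup 𝓘(ℝ, F) ∞ K]
    [ConnectedSpace K]
    -- `H` is simple and its Killing form is negative definite
    (hsimple : LieAlgebra.IsSimple ℝ (GroupLieAlgebra 𝓘(ℝ, E) H))
    (hneg : ∀ X : GroupLieAlgebra 𝓘(ℝ, E) H, X ≠ 0 → killingForm ℝ _ X X < 0)
    -- `ι : K → H` is the inclusion of a semisimple Lie subgroup
    (hss : LieAlgebra.IsSemisimple ℝ (GroupLieAlgebra 𝓘(ℝ, F) K))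
    (ι : K →* H) (hι : ContMDiff 𝓘(ℝ, F) 𝓘(ℝ, E) ∞ ι) (hinj : Function.Injective ι)
    (himm : Function.Injective (derivAtOne E F ι))
    -- the Lie algebra `𝔨` of `K` inside that of `H`, and its Killing-orthogonal complement `𝔞`
    (𝔨 𝔞 : Submodule ℝ (GroupLieAlgebra 𝓘(ℝ, E) H))
    (h𝔨 : 𝔨 = LinearMap.range (derivAtOne E F ι))
    (h𝔞 : 𝔞 = LinearMap.BilinForm.orthogonal (killingForm ℝ _) 𝔨)
    -- `𝔞` is `Ad(K)`-irreducible
    (hne : 𝔞 ≠ ⊥)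
    (hirr : ∀ W : Submodule ℝ (GroupLieAlgebra 𝓘(ℝ, E) H), W ≤ 𝔞 →
      (∀ φ ∈ isotropyRep E ι, ∀ x ∈ W, φ x ∈ W) → W = ⊥ ∨ W = 𝔞)
    -- the Killing forms of the simple ideals of the Lie algebra of `K` are `c` times that of `H`
    (c : ℝ)
    (hc : ∀ J : LieIdeal ℝ (GroupLieAlgebra 𝓘(ℝ, F) K), IsAtom J → ∀ X Y : J,
      killingForm ℝ J X Y = c * killingForm ℝ (GroupLieAlgebra 𝓘(ℝ, E) H)
        (derivAtOne E F ι (X : GroupLieAlgebra 𝓘(ℝ, F) K))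
        (derivAtOne E F ι (Y : GroupLieAlgebra 𝓘(ℝ, F) K)))
    (d k r : ℕ) (hd : d = Module.finrank ℝ 𝔞) (hk : k = Module.finrank ℝ 𝔨)
    (hr : r = {J : LieIdeal ℝ (GroupLieAlgebra 𝓘(ℝ, F) K) | IsAtom J}.ncard)
    (tE : ℝ) (htE : tE = d * c / ((d + 2 * k) * (1 - c)))
    (g : LinearMap.BilinForm ℝ (GroupLieAlgebra 𝓘(ℝ, E) H))
    (hg : g = LeftInvariant.jensenForm hneg 𝔨 tE) :
    0 < tE ∧
    LeftInvariant.IsUnstable (isotropyRep E ι) g ∧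
    LeftInvariant.HasCoindex (isotropyRep E ι) g r ∧
    LeftInvariant.IsLocalMinScalar (isotropyRep E ι) g ∧
    LeftInvariant.IsUnstable {LinearMap.id} g := by

  subst h𝔞 h𝔨 hd hk hr hg
  have h := isIsotropyIrreducible_derivAtOneHom hsimple hneg hss ι hι himm hne hirr c hc
  exact h.jensen_unstable htE
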